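/- Let $(\mathbb N^{n+1},\bar g)$ be a static Riemannian manifold: a smooth Riemannian manifold with a smooth function $N\not\equiv 0$ (the static potential) satisfying $(\bar\Delta N)\bar g-\bar D^2N+N\,\overline{\mathrm{Ric}}=0$. Let $J\subset\mathbb R$ be an open interval, $\Sigma$ a closed $n$-manifold, and let $X:J\times\Sigma\to\mathbb N$ be a smooth map such that each $X(t,\cdot)$ is an embedding, with image $\Sigma_t$, and $\frac{\partial X}{\partial t}=f\nu$, where $f>0$ is a smooth function on $J\times\Sigma$ and $\nu$ is a unit normal to $\Sigma_t$. Let $g_t$ be the metric induced on $\Sigma_t$ and $d\sigma$ its volume element, so that in the coordinates $(t,p)\in J\times\Sigma$ of the region swept by the flow $\bar g=f^2dt^2+g_t$. Let $\eta>0$ be a smooth function on $J\times\Sigma$ and $g_\eta=\eta^2dt^2+g_t$. Let $T\subset J$ be an interval with more than one point (for instance $T=J$), and suppose that at all times $t\in T$ the scalar curvature of $g_\eta$ equals that of $\bar g$. Let $\bar H$ and $H_\eta$ be the mean curvatures of $\Sigma_t$ with respect to $\bar g$ (and $\nu$) and with respect to $g_\eta$ (and $\eta^{-1}\partial_t$),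 where mean curvature is the trace of $u\mapsto\nabla_u\nu$, and let $\sigma_1=\bar H$ and $\sigma_2$ be the first and second elementary symmetric functions of the principal curvatures of $\Sigma_t$ in $(\mathbb N,\bar g)$. (1) For every $t\in T$ the function $t\mapsto\int_{\Sigma_t}N(\bar H-H_\eta)\,d\sigma$ is differentiable at $t$, and $$\frac{d}{dt}\int_{\Sigma_t}N(\bar H-H_\eta)\,d\sigma=-\int_{\Sigma_t}\eta^{-1}(\eta-f)^2\,\bar H\,\frac{\partial N}{\partial\nu}\,d\sigma-\int_{\Sigma_t}N\,\sigma_2\,\eta^{-1}(\eta-f)^2\,d\sigma .$$ (2) If moreover $N>0$, $\frac{\partial N}{\partial\nu}>0$, $\sigma_1>0$ and $\sigma_2>0$ on $\Sigma_t$ for all $t\in T$, then $\int_{\Sigma_t}N(\bar H-H_\eta)\,d\sigma$ is nonincreasing in $t\in T$, and it is constant on $T$ if and only if $\eta=f$ on $T\times\Sigma$. -/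

import Mathlib

set_option maxSynthPendingDepth 3

open scoped Manifold ContDiff Topology

noncomputable section

namespace StaticFlow

/-! # Riemannian geometry in coordinates

`G : E → E →L[ℝ] E →L[ℝ] ℝ` is a metric tensor near a point of a finite-dimensional vector
space `E`: `G y u v` is the inner product at `y` of `u` and `v`. -/

section Coordinates

variable {E : Type*} [NormedAddCommGroup E] [NormedSpace ℝ E]

/-- The Christoffel symbols of the first kind,
`(u, v) ↦ (w ↦ (∂_u G(v, w) + ∂_v G(u, w) - ∂_w G(u, v)) / 2)`. -/
def christoffelFirst (G : E → E →L[ℝ] E →L[ℝ] ℝ) (y : E) : E →L[ℝ] E →L[ℝ] E →L[ℝ] ℝ :=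
  (1 / 2 : ℝ) • (fderiv ℝ G y + (fderiv ℝ G y).flip -
    (ContinuousLinearMap.flipₗᵢ ℝ E E ℝ).toContinuousLinearEquiv.toContinuousLinearMap.comp
      (fderiv ℝ G y).flip)

theorem christoffelFirst_apply (G : E → E →L[ℝ] E →L[ℝ] ℝ) (y u v w : E) :
    christoffelFirst G y u v w =
      (fderiv ℝ G y u v w + fderiv ℝ G y v u w - fderiv ℝ G y w u v) / 2 := by
  simp [christoffelFirst]
  ring

/-- Raising an index: the inverse `E* → E` of `u ↦ G(u, ·)`. -/
def sharp (B : E →L[ℝ] E →L[ℝ] ℝ) : (E →L[ℝ] ℝ) →L[ℝ] E :=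
  ContinuousLinearMap.inverse B

/-- The Christoffel symbols `Γ(u, v)` of the Levi-Civita connection of `G`:
`∇_u V = ∂_u V + Γ(u, V)`. -/
def christoffel (G : E → E →L[ℝ] E →L[ℝ] ℝ) (y : E) : E →L[ℝ] E →L[ℝ] E :=
  (ContinuousLinearMap.compL ℝ E (E →L[ℝ] ℝ) E (sharp (G y))).comp (christoffelFirst G y)

theorem christoffel_apply (G : E → E →L[ℝ] E →L[ℝ] ℝ) (y u v : E) :
    christoffel G y u v = sharp (G y) (christoffelFirst G y u v) := rfl

/-- For fixed `v, w`, the endomorphism `u ↦ R(u, v) w` of the Riemann curvature tensor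
`R(u, v) w = ∇_u ∇_v w - ∇_v ∇_u w - ∇_[u,v] w`. -/
def curvatureEnd (G : E → E →L[ℝ] E →L[ℝ] ℝ) (y v w : E) : E →L[ℝ] E :=
  ((fderiv ℝ (christoffel G) y).flip v).flip w - (fderiv ℝ (christoffel G) y v).flip w +
    (christoffel G y).flip (christoffel G y v w) -
    (christoffel G y v).comp ((christoffel G y).flip w)

theorem curvatureEnd_apply (G : E → E →L[ℝ] E →L[ℝ] ℝ) (y u v w : E) :
    curvatureEnd G y v w u =
      fderiv ℝ (christoffel G) y u v w - fderiv ℝ (christoffel G) y v u w +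
        christoffel G y u (christoffel G y v w) - christoffel G y v (christoffel G y u w) := by
  simp [curvatureEnd]

/-- The Hessian `D²φ - dφ ∘ Γ` of a function. -/
def hessianCoord (G : E → E →L[ℝ] E →L[ℝ] ℝ) (φ : E → ℝ) (y : E) : E →L[ℝ] E →L[ℝ] ℝ :=
  fderiv ℝ (fderiv ℝ φ) y -
    (ContinuousLinearMap.compL ℝ E E ℝ (fderiv ℝ φ y)).comp (christoffel G y)

theorem hessianCoord_apply (G : E → E →L[ℝ] E →L[ℝ] ℝ) (φ : E → ℝ) (y u v : E) :
    hessianCoord G φ y u v = fderiv ℝ (fderiv ℝ φ) y u v - fderiv ℝ φ y (christoffel G y u v) :=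
  rfl

/-- The endomorphism `A` with `B(A u, v) = C(u, v)`. -/
def raise (B C : E →L[ℝ] E →L[ℝ] ℝ) : E →L[ℝ] E := (sharp B).comp C

/-- The trace of the bilinear form `C` with respect to the inner product `B`. -/
def metricTrace (B C : E →L[ℝ] E →L[ℝ] ℝ) : ℝ := LinearMap.trace ℝ E (raise B C : E →ₗ[ℝ] E)

variable [FiniteDimensional ℝ E]

/-- The Ricci tensor `Ric(v, w) = tr (u ↦ R(u, v) w)`. -/
def ricciCoord (G : E → E →L[ℝ] E →L[ℝ] ℝ) (y : E) : E →L[ℝ] E →L[ℝ] ℝ :=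
  LinearMap.toContinuousLinearMap
    ((LinearMap.toContinuousLinearMap : (E →ₗ[ℝ] ℝ) ≃ₗ[ℝ] (E →L[ℝ] ℝ)).toLinearMap ∘ₗ
      LinearMap.mk₂ ℝ (fun v w => LinearMap.trace ℝ E (curvatureEnd G y v w : E →ₗ[ℝ] E))
        (fun v v' w => by
          rw [← map_add]
          congr 1
          ext u
          simp only [ContinuousLinearMap.coe_coe, LinearMap.add_apply, curvatureEnd_apply, map_add,
            _root_.add_apply]
          abel)
        (fun c v w => by
          rw [← map_smul]
          congr 1
          ext u
          simp only [ContinuousLinearMap.coe_coe, LinearMap.smul_apply, curvatureEnd_apply,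
            map_smul, _root_.smul_apply, smul_sub, smul_add])
        (fun v w w' => by
          rw [← map_add]
          congr 1
          ext u
          simp only [ContinuousLinearMap.coe_coe, LinearMap.add_apply, curvatureEnd_apply, map_add]
          abel)
        (fun c v w => by
          rw [← map_smul]
          congr 1
          ext u
          simp only [ContinuousLinearMap.coe_coe, LinearMap.smul_apply, curvatureEnd_apply,
            map_smul, smul_sub, smul_add]))

theorem ricciCoord_apply (G : E → E →L[ℝ] E →L[ℝ] ℝ) (y v w : E) :
    ricciCoord G y v w = LinearMap.trace ℝ E (curvatureEnd G y v w : E →ₗ[ℝ] E) := rfl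

end Coordinates

/-! # Riemannian geometry on manifolds

`TangentSpace I x` is, by definition in Mathlib, the model space `E`, seen through the preferred
chart at `x`.  A (not necessarily smooth) field of bilinear forms on the tangent spaces of `M` is
therefore a map `g : M → E →L[ℝ] E →L[ℝ] ℝ`. -/

section Manifolds

variable {E : Type*} [NormedAddCommGroup E] [NormedSpace ℝ E]
  {H : Type*} [TopologicalSpace H] (I : ModelWithCorners ℝ E H)
  {M : Type*} [TopologicalSpace M] [ChartedSpace H M]
  {E' : Type*} [NormedAddCommGroup E'] [NormedSpace ℝ E']
  {H' : Type*} [TopologicalSpace H'] (I' : ModelWithCorners ℝ E' H')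
  {M' : Type*} [TopologicalSpace M'] [ChartedSpace H' M']

/-- The field of bilinear forms underlying a smooth Riemannian metric. -/
def metricForm {I : ModelWithCorners ℝ E H} [IsManifold I 1 M]
    (g : Bundle.ContMDiffRiemannianMetric I ∞ E (fun x : M => TangentSpace I x)) (x : M) :
    E →L[ℝ] E →L[ℝ] ℝ :=
  g.inner x

/-- The differential of `F` at `x`. -/
def differential (F : M → M') (x : M) : E →L[ℝ] E' := mfderiv I I' F x

/-- The pullback `F^* g`, `(u, v) ↦ g (dF u, dF v)`. -/
def pullback (g : M' → E' →L[ℝ] E' →L[ℝ] ℝ) (F : M → M') (x : M) : E →L[ℝ] E →L[ℝ] ℝ :=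
  (g (F x)).bilinearComp (differential I I' F x) (differential I I' F x)

theorem pullback_apply (g : M' → E' →L[ℝ] E' →L[ℝ] ℝ) (F : M → M') (x : M) (u v : E) :
    pullback I I' g F x u v = g (F x) (differential I I' F x u) (differential I I' F x v) :=
  rfl

/-- The coordinate expression of `g` in the preferred chart at `x₀`. -/
def chartMetric (g : M → E →L[ℝ] E →L[ℝ] ℝ) (x₀ : M) : E → E →L[ℝ] E →L[ℝ] ℝ :=
  pullback 𝓘(ℝ, E) I g (extChartAt I x₀).symm

/-- The Hessian `D²φ` of a function `φ` on `(M, g)`, a bilinear form on each tangent space. -/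
def hessian (g : M → E →L[ℝ] E →L[ℝ] ℝ) (φ : M → ℝ) (x : M) : E →L[ℝ] E →L[ℝ] ℝ :=
  hessianCoord (chartMetric I g x) (φ ∘ (extChartAt I x).symm) (extChartAt I x x)

/-- The Laplacian, the trace of the Hessian. -/
def laplacian (g : M → E →L[ℝ] E →L[ℝ] ℝ) (φ : M → ℝ) (x : M) : ℝ :=
  metricTrace (g x) (hessian I g φ x)

/-- The second fundamental form at `p` of the hypersurface parametrized by `F : M → (M', g)`, with
respect to the unit normal `ν` at `F p`:
`h(u, v) = - g(∇dF(u, v), ν)`, which equals `g(∇_u ν, dF v)`; here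
`∇dF(u, v) = D²F(u, v) + Γ(dF u, dF v)` in coordinates of `M` and `M'`. -/
def secondFundamentalForm (g : M' → E' →L[ℝ] E' →L[ℝ] ℝ) (F : M → M') (p : M) (ν : E') :
    E →L[ℝ] E →L[ℝ] ℝ :=
  let F' : E → E' := writtenInExtChartAt I I' p F
  let y : E := extChartAt I p p
  let Γ : E' →L[ℝ] E' →L[ℝ] E' :=
    christoffel (chartMetric I' g (F p)) (extChartAt I' (F p) (F p))
  let B : E →L[ℝ] E →L[ℝ] E' :=
    fderiv ℝ (fderiv ℝ F') y + Γ.bilinearComp (fderiv ℝ F' y) (fderiv ℝ F' y)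
  (ContinuousLinearMap.compL ℝ E E' ℝ (-(g (F p)).flip ν)).comp B

/-- The shape operator `A` of the hypersurface, `(F^*g)(A u, v) = h(u, v)`. -/
def shapeOperator (g : M' → E' →L[ℝ] E' →L[ℝ] ℝ) (F : M → M') (p : M) (ν : E') : E →ₗ[ℝ] E :=
  raise (pullback I I' g F p) (secondFundamentalForm I I' g F p ν)

/-- The mean curvature, the trace of the shape operator. -/
def meanCurvature (g : M' → E' →L[ℝ] E' →L[ℝ] ℝ) (F : M → M') (p : M) (ν : E') : ℝ :=
  LinearMap.trace ℝ E (shapeOperator I I' g F p ν)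

variable [FiniteDimensional ℝ E]

/-- The principal curvatures, with multiplicity: the eigenvalues of the shape operator. -/
def principalCurvatures (g : M' → E' →L[ℝ] E' →L[ℝ] ℝ) (F : M → M') (p : M) (ν : E') :
    Multiset ℝ :=
  (shapeOperator I I' g F p ν).charpoly.roots

/-- `σ_k`, the `k`-th elementary symmetric function of the principal curvatures. -/
def sigma (k : ℕ) (g : M' → E' →L[ℝ] E' →L[ℝ] ℝ) (F : M → M') (p : M) (ν : E') : ℝ :=
  (principalCurvatures I I' g F p ν).esymm k

/-- The Ricci tensor of `(M, g)`. -/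
def ricci (g : M → E →L[ℝ] E →L[ℝ] ℝ) (x : M) : E →L[ℝ] E →L[ℝ] ℝ :=
  ricciCoord (chartMetric I g x) (extChartAt I x x)

/-- The scalar curvature of `(M, g)`. -/
def scalarCurvature (g : M → E →L[ℝ] E →L[ℝ] ℝ) (x : M) : ℝ :=
  metricTrace (g x) (ricci I g x)

/-- `N` is a static potential on `(M, g)`: a nontrivial smooth function such that
`(ΔN) g - D²N + N Ric = 0`. -/
structure IsStaticPotential (g : M → E →L[ℝ] E →L[ℝ] ℝ) (N : M → ℝ) : Prop where
  smooth : ContMDiff I 𝓘(ℝ, ℝ) ∞ N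
  nontrivial : N ≠ 0
  static : ∀ x : M, laplacian I g N x • g x - hessian I g N x + N x • ricci I g x = 0

end Manifolds

/-! # Integration over a closed Riemannian manifold -/

section Integration

variable {n : ℕ} {S : Type*} [TopologicalSpace S] [T2Space S] [CompactSpace S]
  [ChartedSpace (EuclideanSpace ℝ (Fin n)) S] [IsManifold (𝓡 n) ∞ S]

variable (n S) in
/-- A smooth partition of unity on `S` subordinate to the cover by chart domains. -/
def chartPartition : SmoothPartitionOfUnity S (𝓡 n) S Set.univ :=
  (SmoothPartitionOfUnity.exists_isSubordinate_chartAt_source (𝓡 n) S).choose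

variable (n S) in
theorem chartPartition_isSubordinate :
    (chartPartition n S).IsSubordinate
      (fun x => (chartAt (EuclideanSpace ℝ (Fin n)) x).source) :=
  (SmoothPartitionOfUnity.exists_isSubordinate_chartAt_source (𝓡 n) S).choose_spec

/-- The volume density `√det (g_ij)` in the standard basis of `ℝⁿ`. -/
def volumeDensity (B : EuclideanSpace ℝ (Fin n) →L[ℝ] EuclideanSpace ℝ (Fin n) →L[ℝ] ℝ) : ℝ :=
  √(Matrix.det (Matrix.of fun i j : Fin n =>
    B (EuclideanSpace.single i 1) (EuclideanSpace.single j 1)))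

/-- The integral `∫_S φ dσ` of a continuous function over the closed manifold `S` with respect to
the Riemannian volume of `g`:
the sum over the charts of `∫ ρ_x φ √det (g_ij) dy`, with `ρ_x` a partition of unity
(only finitely many `ρ_x` are nonzero, as `S` is compact). -/
def surfaceIntegral
    (g : S → EuclideanSpace ℝ (Fin n) →L[ℝ] EuclideanSpace ℝ (Fin n) →L[ℝ] ℝ) (φ : S → ℝ) : ℝ :=
  ∑ᶠ x : S, ∫ y in (extChartAt (𝓡 n) x).target,
    chartPartition n S x ((extChartAt (𝓡 n) x).symm y) * φ ((extChartAt (𝓡 n) x).symm y) *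
      volumeDensity (chartMetric (𝓡 n) g x y)

end Integration

/-! # Flows of hypersurfaces -/

section Flow

variable {n : ℕ}
  {M : Type*} [TopologicalSpace M] [ChartedSpace (EuclideanSpace ℝ (Fin (n + 1))) M]
  {S : Type*} [TopologicalSpace S] [ChartedSpace (EuclideanSpace ℝ (Fin n)) S]

/-- `X` is a smooth family, parametrized by `t ∈ J`, of embedded hypersurfaces
`Σ_t = X(t, S)` in `(M, g)`, evolving by `∂X/∂t = f ν` with speed `f > 0`, where `ν` is a unit
normal to `Σ_t`. -/
structure IsNormalFlow
    (g : M → EuclideanSpace ℝ (Fin (n + 1)) →L[ℝ] EuclideanSpace ℝ (Fin (n + 1)) →L[ℝ] ℝ)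
    (J : Set ℝ) (X : ℝ × S → M) (ν : ∀ q : ℝ × S, TangentSpace (𝓡 (n + 1)) (X q))
    (f : ℝ × S → ℝ) : Prop where
  smooth : ContMDiffOn (𝓘(ℝ, ℝ).prod (𝓡 n)) (𝓡 (n + 1)) ∞ X (J ×ˢ Set.univ)
  embedding : ∀ t ∈ J, Topology.IsEmbedding fun p : S => X (t, p)
  immersion : ∀ t ∈ J, ∀ p : S,
    Function.Injective (differential (𝓡 n) (𝓡 (n + 1)) (fun p' : S => X (t, p')) p)
  speed_smooth : ContMDiffOn (𝓘(ℝ, ℝ).prod (𝓡 n)) 𝓘(ℝ, ℝ) ∞ f (J ×ˢ Set.univ)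
  speed_pos : ∀ t ∈ J, ∀ p : S, 0 < f (t, p)
  unit : ∀ t ∈ J, ∀ p : S, g (X (t, p)) (ν (t, p)) (ν (t, p)) = 1
  normal : ∀ t ∈ J, ∀ p : S, ∀ u : EuclideanSpace ℝ (Fin n),
    g (X (t, p)) (differential (𝓡 n) (𝓡 (n + 1)) (fun p' : S => X (t, p')) p u) (ν (t, p)) = 0
  flow : ∀ t ∈ J, ∀ p : S,
    mfderiv 𝓘(ℝ, ℝ) (𝓡 (n + 1)) (fun s : ℝ => X (s, p)) t (1 : ℝ) = f (t, p) • ν (t, p)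

/-- The induced metric `g_t` of `Σ_t`, on the parameter manifold `S`. -/
def inducedMetric
    (g : M → EuclideanSpace ℝ (Fin (n + 1)) →L[ℝ] EuclideanSpace ℝ (Fin (n + 1)) →L[ℝ] ℝ)
    (X : ℝ × S → M) (t : ℝ) :
    S → EuclideanSpace ℝ (Fin n) →L[ℝ] EuclideanSpace ℝ (Fin n) →L[ℝ] ℝ :=
  pullback (𝓡 n) (𝓡 (n + 1)) g (fun p : S => X (t, p))

/-- The metric `g_η = η² dt² + g_t` in the coordinates `(t, p)` of the region swept by the flow. -/
def warpedMetric
    (g : M → EuclideanSpace ℝ (Fin (n + 1)) →L[ℝ] EuclideanSpace ℝ (Fin (n + 1)) →L[ℝ] ℝ)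
    (X : ℝ × S → M) (η : ℝ × S → ℝ) (q : ℝ × S) :
    (ℝ × EuclideanSpace ℝ (Fin n)) →L[ℝ] (ℝ × EuclideanSpace ℝ (Fin n)) →L[ℝ] ℝ :=
  (η q ^ 2) • (ContinuousLinearMap.mul ℝ ℝ).bilinearComp
      (ContinuousLinearMap.fst ℝ ℝ (EuclideanSpace ℝ (Fin n)))
      (ContinuousLinearMap.fst ℝ ℝ (EuclideanSpace ℝ (Fin n))) +
    (inducedMetric g X q.1 q.2).bilinearComp
      (ContinuousLinearMap.snd ℝ ℝ (EuclideanSpace ℝ (Fin n)))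
      (ContinuousLinearMap.snd ℝ ℝ (EuclideanSpace ℝ (Fin n)))

/-- `H̄`, the mean curvature of `Σ_t` in `(M, g)` with respect to `ν`. -/
def meanCurvatureBar
    (g : M → EuclideanSpace ℝ (Fin (n + 1)) →L[ℝ] EuclideanSpace ℝ (Fin (n + 1)) →L[ℝ] ℝ)
    (X : ℝ × S → M) (ν : ∀ q : ℝ × S, TangentSpace (𝓡 (n + 1)) (X q)) (q : ℝ × S) : ℝ :=
  meanCurvature (𝓡 n) (𝓡 (n + 1)) g (fun p : S => X (q.1, p)) q.2 (ν q)

/-- `σ_k` of the principal curvatures of `Σ_t` in `(M, g)` with respect to `ν`. -/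
def sigmaBar (k : ℕ)
    (g : M → EuclideanSpace ℝ (Fin (n + 1)) →L[ℝ] EuclideanSpace ℝ (Fin (n + 1)) →L[ℝ] ℝ)
    (X : ℝ × S → M) (ν : ∀ q : ℝ × S, TangentSpace (𝓡 (n + 1)) (X q)) (q : ℝ × S) : ℝ :=
  sigma (𝓡 n) (𝓡 (n + 1)) k g (fun p : S => X (q.1, p)) q.2 (ν q)

/-- `H_η`, the mean curvature of the slice `{t} × S` with respect to `g_η` and its `g_η`-unit
normal `η⁻¹ ∂_t`. -/
def meanCurvatureEta
    (g : M → EuclideanSpace ℝ (Fin (n + 1)) →L[ℝ] EuclideanSpace ℝ (Fin (n + 1)) →L[ℝ] ℝ)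
    (X : ℝ × S → M) (η : ℝ × S → ℝ) (q : ℝ × S) : ℝ :=
  meanCurvature (𝓡 n) (𝓘(ℝ, ℝ).prod (𝓡 n)) (warpedMetric g X η)
    (fun p : S => (q.1, p)) q.2 ((η q)⁻¹, 0)

/-- `∂N/∂ν` along the flow. -/
def normalDerivative (N : M → ℝ) (X : ℝ × S → M)
    (ν : ∀ q : ℝ × S, TangentSpace (𝓡 (n + 1)) (X q)) (q : ℝ × S) : ℝ :=
  differential (𝓡 (n + 1)) 𝓘(ℝ, ℝ) N (X q) (ν q)

/-- `∫_{Σ_t} N (H̄ - H_η) dσ`. -/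
def weightedIntegral [T2Space S] [CompactSpace S] [IsManifold (𝓡 n) ∞ S]
    (g : M → EuclideanSpace ℝ (Fin (n + 1)) →L[ℝ] EuclideanSpace ℝ (Fin (n + 1)) →L[ℝ] ℝ)
    (N : M → ℝ) (X : ℝ × S → M) (ν : ∀ q : ℝ × S, TangentSpace (𝓡 (n + 1)) (X q))
    (η : ℝ × S → ℝ) (t : ℝ) : ℝ :=
  surfaceIntegral (inducedMetric g X t) fun p =>
    N (X (t, p)) * (meanCurvatureBar g X ν (t, p) - meanCurvatureEta g X η (t, p))

end Flow

end StaticFlow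

end

/-! In coordinates `(t, z)` of the swept region both metrics have the form `a² dt² + γ(t)` with the
same slice metric `γ`; only the lapse `a` differs, `a = f` for `ḡ` and `a = η` for `g_η`. Put `L = ½
γ⁻¹ ∂_t γ` (`timeShape`). The slices have shape operator `a⁻¹ L`, hence `H̄ = f⁻¹ tr L`, `H_η = η⁻¹
tr L` and `σ₂ = f⁻² ((tr L)² - tr L²) / 2`, and `dσ` has logarithmic time derivative `tr L`.

Two formulas carry the curvature. The traced Riccati equation (`ricciCoord_warpedForm_time`) is
`Ric_a(∂_t, ∂_t) = -a Δa - tr ∂_t L + a⁻¹ ∂_t a tr L - tr L²`, and the Gauss equation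
(`metricTrace_ricciCoord_warpedForm`) is `R_a = R_γ + 2 a⁻² Ric_a(∂_t, ∂_t) - a⁻² ((tr L)² - tr
L²)`. When the scalar curvatures for `a = η` and `a = f` agree, the intrinsic term `R_γ` cancels.
The static equation evaluated on `(∂_t, ∂_t)` loses the normal second derivative of `N`
(`static_normal`): `ΔN + f⁻² ∂_t N tr L + N f⁻² Ric_f(∂_t, ∂_t) = 0`. In the combination of the
first relation times `N η / 2` and the second times `η - f`, the time derivative of `N (f⁻¹ - η⁻¹)
tr L dσ` becomes the two terms containing `η⁻¹ (η - f)²` plus `N Δ(η - f) - (η - f) ΔN`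
(`evolution_identity`). Green's formula (`surfaceIntegral_green`) removes the last expression on the
closed slice. The computation at time `t` uses equality of scalar curvatures at that time only, so
the two-sided derivative exists at every point of `T`, endpoints included.

Under the sign conditions both integrands are nonnegative, which gives monotonicity. If the integral
is constant, the `σ₂` term has zero integral; it is continuous and nonnegative with positive weight,
so `η = f`. Conversely `η = f` makes the integral vanish identically.

The remaining work is transfer. The geometric quantities are defined in the preferred chart at each
point, so their invariance under local parametrizations is needed to compute in one fixed chart
(`IsParametrizationAt`). The integral is a finite sum of chart integrals weighted by a partition of
unity that does not depend on `t`, and each summand is differentiated under the integral sign. -/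

noncomputable section

namespace StaticFlow

/-! ### Coordinate invariance of curvature, Hessian and trace -/

section CoordinateCalculus

variable {E : Type*} [NormedAddCommGroup E] [NormedSpace ℝ E]
  {F : Type*} [NormedAddCommGroup F] [NormedSpace ℝ F]

theorem sharp_apply_self {B : E →L[ℝ] E →L[ℝ] ℝ} (hB : B.IsInvertible) (α : E →L[ℝ] ℝ) :
    B (sharp B α) = α :=
  hB.self_apply_inverse α

theorem sharp_self_apply {B : E →L[ℝ] E →L[ℝ] ℝ} (hB : B.IsInvertible) (u : E) :
    sharp B (B u) = u :=
  hB.inverse_apply_self u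

theorem form_ext {B : E →L[ℝ] E →L[ℝ] ℝ} (hB : B.IsInvertible) {u v : E}
    (h : ∀ w, B u w = B v w) : u = v :=
  hB.injective (ContinuousLinearMap.ext h)

theorem eventually_isInvertible [CompleteSpace E] {X : Type*} [TopologicalSpace X]
    {A : X → E →L[ℝ] F} {x : X} (hc : ContinuousAt A x) (h : (A x).IsInvertible) :
    ∀ᶠ z in 𝓝 x, (A z).IsInvertible := by
  obtain ⟨e, he⟩ := h
  have h1 : Set.range ((↑) : (E ≃L[ℝ] F) → E →L[ℝ] F) ∈ 𝓝 (A x) := by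
    rw [← he]; exact ContinuousLinearEquiv.nhds e
  filter_upwards [hc h1] with z hz
  exact hz

theorem fderiv_apply_const {A : E → F →L[ℝ] ℝ} {y : E} (hA : DifferentiableAt ℝ A y) (w : E)
    (u : F) : fderiv ℝ (fun z => A z u) y w = fderiv ℝ A y w u := by
  rw [fderiv_clm_apply hA (differentiableAt_const u)]
  simp

/-- A metric tensor of class `C²` near a point. -/
structure IsMetricAt (G : E → E →L[ℝ] E →L[ℝ] ℝ) (y : E) : Prop where
  contDiffAt : ContDiffAt ℝ 2 G y
  symm : ∀ᶠ z in 𝓝 y, ∀ u v, G z u v = G z v u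
  invertible : (G y).IsInvertible

namespace IsMetricAt

variable {G : E → E →L[ℝ] E →L[ℝ] ℝ} {y : E}

theorem congr {G' : E → E →L[ℝ] E →L[ℝ] ℝ} (h : IsMetricAt G y) (hG : G' =ᶠ[𝓝 y] G) :
    IsMetricAt G' y where
  contDiffAt := h.contDiffAt.congr_of_eventuallyEq hG
  symm := by
    filter_upwards [h.symm, hG] with z h1 h2
    rw [h2]; exact h1
  invertible := by rw [hG.eq_of_nhds]; exact h.invertible

theorem eventually [CompleteSpace E] (h : IsMetricAt G y) : ∀ᶠ z in 𝓝 y, IsMetricAt G z := by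
  filter_upwards [h.contDiffAt.eventually (by simp), h.symm.eventually_nhds,
    eventually_isInvertible h.contDiffAt.continuousAt h.invertible] with z h1 h2 h3
  exact ⟨h1, h2, h3⟩

theorem differentiableAt (h : IsMetricAt G y) : DifferentiableAt ℝ G y :=
  h.contDiffAt.differentiableAt (by simp)

theorem symm_apply (h : IsMetricAt G y) (u v : E) : G y u v = G y v u := h.symm.self_of_nhds u v

theorem fderiv_apply (h : IsMetricAt G y) (w u v : E) :
    fderiv ℝ (fun z => G z u v) y w = fderiv ℝ G y w u v := by
  have h1 : DifferentiableAt ℝ (fun z => G z u) y :=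
    h.differentiableAt.clm_apply (differentiableAt_const u)
  rw [fderiv_apply_const h1, fderiv_clm_apply h.differentiableAt (differentiableAt_const u)]
  simp

theorem fderiv_symm (h : IsMetricAt G y) (w u v : E) :
    fderiv ℝ G y w u v = fderiv ℝ G y w v u := by
  rw [← h.fderiv_apply, ← h.fderiv_apply]
  refine congrArg (fun A : E →L[ℝ] ℝ => A w) (Filter.EventuallyEq.fderiv_eq ?_)
  filter_upwards [h.symm] with z hz
  exact hz u v

theorem apply_christoffel (h : IsMetricAt G y) (u v w : E) :
    G y (christoffel G y u v) w =
      (fderiv ℝ G y u v w + fderiv ℝ G y v u w - fderiv ℝ G y w u v) / 2 := by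
  rw [christoffel_apply, sharp_apply_self h.invertible, christoffelFirst_apply]

theorem christoffel_symm (h : IsMetricAt G y) (u v : E) :
    christoffel G y u v = christoffel G y v u := by
  refine form_ext h.invertible fun w => ?_
  rw [h.apply_christoffel, h.apply_christoffel, h.fderiv_symm w u v]
  ring

theorem contDiffAt_sharp [CompleteSpace E] (h : IsMetricAt G y) :
    ContDiffAt ℝ 2 (fun z => sharp (G z)) y := by
  obtain ⟨e, he⟩ := h.invertible
  have := contDiffAt_map_inverse (𝕜 := ℝ) (n := 2) e
  rw [he] at this
  exact this.comp y h.contDiffAt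

theorem contDiffAt_christoffelFirst (h : IsMetricAt G y) :
    ContDiffAt ℝ 1 (christoffelFirst G) y := by
  have h1 : ContDiffAt ℝ 1 (fderiv ℝ G) y := h.contDiffAt.fderiv_right (by norm_num)
  have h2 : ContDiffAt ℝ 1 (fun z => (fderiv ℝ G z).flip) y :=
    (ContinuousLinearMap.flipₗᵢ ℝ E E (E →L[ℝ] ℝ)).toContinuousLinearEquiv.contDiff.contDiffAt.comp
      y h1
  exact ((h1.add h2).sub (contDiffAt_const.clm_comp h2)).const_smul (1 / 2 : ℝ)

/-- One derivative is lost: a `C²` metric has differentiable Christoffel symbols, which is the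
regularity the curvature requires. -/
theorem contDiffAt_christoffel [CompleteSpace E] (h : IsMetricAt G y) :
    ContDiffAt ℝ 1 (christoffel G) y := by
  have h1 : ContDiffAt ℝ 1 (fun z => ContinuousLinearMap.compL ℝ E (E →L[ℝ] ℝ) E (sharp (G z))) y :=
    (ContinuousLinearMap.compL ℝ E (E →L[ℝ] ℝ) E).contDiff.contDiffAt.comp y
      (h.contDiffAt_sharp.of_le (by norm_num))
  exact h1.clm_comp h.contDiffAt_christoffelFirst

theorem differentiableAt_christoffel [CompleteSpace E] (h : IsMetricAt G y) :
    DifferentiableAt ℝ (christoffel G) y :=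
  h.contDiffAt_christoffel.differentiableAt (by simp)

end IsMetricAt

theorem christoffel_congr {G G' : E → E →L[ℝ] E →L[ℝ] ℝ} {y : E} (h : G =ᶠ[𝓝 y] G') :
    christoffel G y = christoffel G' y := by
  unfold christoffel christoffelFirst
  rw [h.fderiv_eq, h.eq_of_nhds]

theorem ricciCoord_congr [FiniteDimensional ℝ E] {G G' : E → E →L[ℝ] E →L[ℝ] ℝ} {y : E}
    (h : G =ᶠ[𝓝 y] G') : ricciCoord G y = ricciCoord G' y := by
  have h1 : christoffel G =ᶠ[𝓝 y] christoffel G' := by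
    filter_upwards [h.eventuallyEq_nhds] with z hz
    exact christoffel_congr hz
  ext v w
  rw [ricciCoord_apply, ricciCoord_apply]
  congr 2
  ext u
  rw [curvatureEnd_apply, curvatureEnd_apply, h1.fderiv_eq, h1.eq_of_nhds]

theorem hessianCoord_congr {G G' : E → E →L[ℝ] E →L[ℝ] ℝ} {φ φ' : E → ℝ} {y : E}
    (h : G =ᶠ[𝓝 y] G') (hφ : φ =ᶠ[𝓝 y] φ') : hessianCoord G φ y = hessianCoord G' φ' y := by
  unfold hessianCoord
  rw [christoffel_congr h, hφ.fderiv_eq, hφ.fderiv.fderiv_eq]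

/-- The pullback of a field of bilinear forms by a map between vector spaces. -/
def coordPullback (G : F → F →L[ℝ] F →L[ℝ] ℝ) (Φ : E → F) (y : E) : E →L[ℝ] E →L[ℝ] ℝ :=
  (G (Φ y)).bilinearComp (fderiv ℝ Φ y) (fderiv ℝ Φ y)

theorem coordPullback_apply (G : F → F →L[ℝ] F →L[ℝ] ℝ) (Φ : E → F) (y u v : E) :
    coordPullback G Φ y u v = G (Φ y) (fderiv ℝ Φ y u) (fderiv ℝ Φ y v) := rfl

theorem _root_.ContDiffAt.bilinearComp {D : Type*} [NormedAddCommGroup D] [NormedSpace ℝ D]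
    {n : WithTop ℕ∞} {B : D → F →L[ℝ] F →L[ℝ] ℝ} {A : D → E →L[ℝ] F} {y : D}
    (hB : ContDiffAt ℝ n B y) (hA : ContDiffAt ℝ n A y) :
    ContDiffAt ℝ n (fun z => (B z).bilinearComp (A z) (A z)) y := by
  have h1 : ContDiffAt ℝ n (fun z => ((B z).comp (A z)).flip) y :=
    (ContinuousLinearMap.flipₗᵢ ℝ E F ℝ).toContinuousLinearEquiv.contDiff.contDiffAt.comp
      y (hB.clm_comp hA)
  exact (ContinuousLinearMap.flipₗᵢ ℝ E E ℝ).toContinuousLinearEquiv.contDiff.contDiffAt.comp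
      y (h1.clm_comp hA)

theorem _root_.ContinuousLinearMap.IsInvertible.bilinearComp [FiniteDimensional ℝ E]
    {B : F →L[ℝ] F →L[ℝ] ℝ} {A : E →L[ℝ] F}
    (hB : B.IsInvertible) (hA : A.IsInvertible) : (B.bilinearComp A A).IsInvertible := by
  obtain ⟨e, rfl⟩ := hA
  have : B.bilinearComp (e : E →L[ℝ] F) (e : E →L[ℝ] F) =
      ((e.symm.arrowCongr (ContinuousLinearEquiv.refl ℝ ℝ) :
        (F →L[ℝ] ℝ) ≃L[ℝ] (E →L[ℝ] ℝ)) : (F →L[ℝ] ℝ) →L[ℝ] (E →L[ℝ] ℝ)).comp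
        (B.comp (e : E →L[ℝ] F)) := by
    ext u v
    simp [ContinuousLinearEquiv.arrowCongr]
  rw [this]
  exact (ContinuousLinearMap.isInvertible_equiv).comp
    (hB.comp ContinuousLinearMap.isInvertible_equiv)

theorem contDiffAt_coordPullback {n m : WithTop ℕ∞} (hm : n + 1 ≤ m)
    {G : F → F →L[ℝ] F →L[ℝ] ℝ} {Φ : E → F} {y : E}
    (hG : ContDiffAt ℝ n G (Φ y)) (hΦ : ContDiffAt ℝ m Φ y) :
    ContDiffAt ℝ n (coordPullback G Φ) y :=
  (hG.comp y (hΦ.of_le (le_self_add.trans hm))).bilinearComp (hΦ.fderiv_right hm)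

theorem IsMetricAt.coordPullback [FiniteDimensional ℝ E] {G : F → F →L[ℝ] F →L[ℝ] ℝ} {Φ : E → F}
    {y : E} (hG : IsMetricAt G (Φ y)) (hΦ : ContDiffAt ℝ 3 Φ y)
    (hΦ' : (fderiv ℝ Φ y).IsInvertible) : IsMetricAt (coordPullback G Φ) y where
  contDiffAt := contDiffAt_coordPullback (by norm_num) hG.contDiffAt hΦ
  symm := by
    filter_upwards [hΦ.continuousAt.eventually hG.symm] with z hz u v
    exact hz _ _
  invertible := hG.invertible.bilinearComp hΦ'

theorem fderiv_coordPullback_apply {G : F → F →L[ℝ] F →L[ℝ] ℝ} {Φ : E → F}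
    {y : E} (hG : ContDiffAt ℝ 1 G (Φ y)) (hΦ : ContDiffAt ℝ 2 Φ y) (w u v : E) :
    fderiv ℝ (coordPullback G Φ) y w u v =
      fderiv ℝ G (Φ y) (fderiv ℝ Φ y w) (fderiv ℝ Φ y u) (fderiv ℝ Φ y v) +
      G (Φ y) (fderiv ℝ (fderiv ℝ Φ) y w u) (fderiv ℝ Φ y v) +
      G (Φ y) (fderiv ℝ Φ y u) (fderiv ℝ (fderiv ℝ Φ) y w v) := by
  have hP : DifferentiableAt ℝ (coordPullback G Φ) y :=
    (contDiffAt_coordPullback (n := 1) (by norm_num) hG hΦ).differentiableAt (by simp)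
  have h1 : DifferentiableAt ℝ (fun z => coordPullback G Φ z u) y :=
    hP.clm_apply (differentiableAt_const u)
  have h2 : fderiv ℝ (fun z => coordPullback G Φ z u v) y w =
      fderiv ℝ (coordPullback G Φ) y w u v := by
    rw [fderiv_apply_const h1, fderiv_clm_apply hP (differentiableAt_const u)]
    simp
  rw [← h2]
  have hd : HasFDerivAt Φ (fderiv ℝ Φ y) y := (hΦ.differentiableAt (by simp)).hasFDerivAt
  have hd2 : HasFDerivAt (fderiv ℝ Φ) (fderiv ℝ (fderiv ℝ Φ) y) y :=
    ((hΦ.fderiv_right (m := 1) (by norm_num)).differentiableAt (by simp)).hasFDerivAt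
  have hc := (hG.differentiableAt (by simp)).hasFDerivAt.comp y hd
  have := (hc.clm_apply (hd2.clm_apply (hasFDerivAt_const u y))).clm_apply
    (hd2.clm_apply (hasFDerivAt_const v y))
  erw [this.fderiv]
  simp
  ring

theorem fderiv_fderiv_symm {Φ : E → F} {y : E} (hΦ : ContDiffAt ℝ 2 Φ y) (u v : E) :
    fderiv ℝ (fderiv ℝ Φ) y u v = fderiv ℝ (fderiv ℝ Φ) y v u :=
  (hΦ.isSymmSndFDerivAt (by simp)).eq u v

/-- Both sides are tested against vectors `dΦ w`. Differentiating the pulled-back metric produces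
six terms with `D²Φ`; by symmetry of `D²Φ` and `G`, four cancel and the other two add up to `D²Φ(u,
v)`. -/
theorem christoffel_coordPullback [FiniteDimensional ℝ E]
    {G : F → F →L[ℝ] F →L[ℝ] ℝ} {Φ : E → F}
    {y : E} (hG : IsMetricAt G (Φ y)) (hΦ : ContDiffAt ℝ 3 Φ y)
    (hΦ' : (fderiv ℝ Φ y).IsInvertible) (u v : E) :
    fderiv ℝ Φ y (christoffel (coordPullback G Φ) y u v) =
      christoffel G (Φ y) (fderiv ℝ Φ y u) (fderiv ℝ Φ y v) + fderiv ℝ (fderiv ℝ Φ) y u v := by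
  have hP := hG.coordPullback hΦ hΦ'
  have hΦ2 : ContDiffAt ℝ 2 Φ y := hΦ.of_le (by norm_num)
  have hG1 : ContDiffAt ℝ 1 G (Φ y) := hG.contDiffAt.of_le (by norm_num)
  refine form_ext hG.invertible fun w => ?_
  -- Test vectors of the form `dΦ w` turn the pairing by `G` into the pairing by the pulled-back
  -- metric.
  obtain ⟨w, rfl⟩ := hΦ'.surjective w
  rw [← coordPullback_apply, hP.apply_christoffel, map_add, _root_.add_apply,
    hG.apply_christoffel, fderiv_coordPullback_apply hG1 hΦ2, fderiv_coordPullback_apply hG1 hΦ2,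
    fderiv_coordPullback_apply hG1 hΦ2, fderiv_fderiv_symm hΦ2 v u, fderiv_fderiv_symm hΦ2 w u,
    fderiv_fderiv_symm hΦ2 w v, hG.symm_apply (fderiv ℝ (fderiv ℝ Φ) y u w)]
  ring

/-- Differentiate the transformation rule of the Christoffel symbols and antisymmetrize. `D³Φ` is
symmetric and drops out; the `D²Φ` terms cancel against those coming from the part of the curvature
quadratic in `Γ`. -/
theorem curvatureEnd_coordPullback [FiniteDimensional ℝ E] [FiniteDimensional ℝ F]
    {G : F → F →L[ℝ] F →L[ℝ] ℝ} {Φ : E → F}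
    {y : E} (hG : IsMetricAt G (Φ y)) (hΦ : ContDiffAt ℝ 3 Φ y)
    (hΦ' : (fderiv ℝ Φ y).IsInvertible) (u v w : E) :
    fderiv ℝ Φ y (curvatureEnd (coordPullback G Φ) y v w u) =
      curvatureEnd G (Φ y) (fderiv ℝ Φ y v) (fderiv ℝ Φ y w) (fderiv ℝ Φ y u) := by
  have hP := hG.coordPullback hΦ hΦ'
  have hΦ2 : ContDiffAt ℝ 2 Φ y := hΦ.of_le (by norm_num)
  have hd : HasFDerivAt Φ (fderiv ℝ Φ y) y := (hΦ.differentiableAt (by simp)).hasFDerivAt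
  have hc2 : ContDiffAt ℝ 2 (fderiv ℝ Φ) y := hΦ.fderiv_right (m := 2) (by norm_num)
  have hd2 : HasFDerivAt (fderiv ℝ Φ) (fderiv ℝ (fderiv ℝ Φ) y) y :=
    (hc2.differentiableAt (by simp)).hasFDerivAt
  have hd3 : HasFDerivAt (fderiv ℝ (fderiv ℝ Φ)) (fderiv ℝ (fderiv ℝ (fderiv ℝ Φ)) y) y :=
    ((hc2.fderiv_right (m := 1) (by norm_num)).differentiableAt (by simp)).hasFDerivAt
  have hΓG := hG.differentiableAt_christoffel.hasFDerivAt.comp y hd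
  have hΓP := hP.differentiableAt_christoffel.hasFDerivAt
  -- The derivative along `u` of `christoffel_coordPullback`, which holds at all points near `y`,
  -- solved for the term containing the derivative of the pulled-back symbols.
  have key : ∀ u v w : E, fderiv ℝ Φ y (fderiv ℝ (christoffel (coordPullback G Φ)) y u v w) =
      fderiv ℝ (christoffel G) (Φ y) (fderiv ℝ Φ y u) (fderiv ℝ Φ y v) (fderiv ℝ Φ y w) +
      christoffel G (Φ y) (fderiv ℝ (fderiv ℝ Φ) y u v) (fderiv ℝ Φ y w) +
      christoffel G (Φ y) (fderiv ℝ Φ y v) (fderiv ℝ (fderiv ℝ Φ) y u w) +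
      fderiv ℝ (fderiv ℝ (fderiv ℝ Φ)) y u v w -
      fderiv ℝ (fderiv ℝ Φ) y u (christoffel (coordPullback G Φ) y v w) := by
    intro u v w
    have h1 := hd2.clm_apply ((hΓP.clm_apply (hasFDerivAt_const v y)).clm_apply
      (hasFDerivAt_const w y))
    have h2 := ((hΓG.clm_apply (hd2.clm_apply (hasFDerivAt_const v y))).clm_apply
      (hd2.clm_apply (hasFDerivAt_const w y))).add ((hd3.clm_apply
        (hasFDerivAt_const v y)).clm_apply (hasFDerivAt_const w y))
    have hev : ∀ᶠ z in 𝓝 y, fderiv ℝ Φ z (christoffel (coordPullback G Φ) z v w) =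
      christoffel G (Φ z) (fderiv ℝ Φ z v) (fderiv ℝ Φ z w) + fderiv ℝ (fderiv ℝ Φ) z v w := by
      filter_upwards [hΦ.continuousAt.eventually hG.eventually, hΦ.eventually (by simp),
        eventually_isInvertible hc2.continuousAt hΦ'] with z h1 h2 h3
      exact christoffel_coordPullback h1 h2 h3 v w
    have h3 := (h1.congr_of_eventuallyEq (Filter.EventuallyEq.symm hev)).unique h2
    have h4 := congrArg (fun A : E →L[ℝ] F => A u) h3
    simp at h4
    rw [eq_sub_iff_add_eq, h4]
    abel
  have h3 : fderiv ℝ (fderiv ℝ (fderiv ℝ Φ)) y u v w =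
      fderiv ℝ (fderiv ℝ (fderiv ℝ Φ)) y v u w := by
    rw [fderiv_fderiv_symm hc2]
  rw [curvatureEnd_apply, curvatureEnd_apply, map_sub, map_add, map_sub, key, key,
    christoffel_coordPullback hG hΦ hΦ', christoffel_coordPullback hG hΦ hΦ',
    christoffel_coordPullback hG hΦ hΦ', christoffel_coordPullback hG hΦ hΦ', h3,
    fderiv_fderiv_symm hΦ2 v u]
  simp only [map_add]
  abel

/-- The trace is invariant under conjugation. -/
theorem trace_eq_of_intertwine {V W : Type*} [AddCommGroup V] [Module ℝ V]
    [AddCommGroup W] [Module ℝ W] (e : V ≃ₗ[ℝ] W) (P : V →ₗ[ℝ] V) (Q : W →ₗ[ℝ] W)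
    (h : ∀ v, e (P v) = Q (e v)) : LinearMap.trace ℝ V P = LinearMap.trace ℝ W Q := by
  have : Q = e.conj P := by
    ext w
    rw [LinearEquiv.conj_apply_apply, h, LinearEquiv.apply_symm_apply]
  rw [this, LinearMap.trace_conj']

theorem trace_eq_of_isInvertible {A : E →L[ℝ] F} (hA : A.IsInvertible) (P : E →ₗ[ℝ] E)
    (Q : F →ₗ[ℝ] F) (h : ∀ v, A (P v) = Q (A v)) :
    LinearMap.trace ℝ E P = LinearMap.trace ℝ F Q := by
  obtain ⟨e, rfl⟩ := hA
  exact trace_eq_of_intertwine e.toLinearEquiv P Q h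

theorem ricciCoord_coordPullback [FiniteDimensional ℝ E] [FiniteDimensional ℝ F]
    {G : F → F →L[ℝ] F →L[ℝ] ℝ} {Φ : E → F}
    {y : E} (hG : IsMetricAt G (Φ y)) (hΦ : ContDiffAt ℝ 3 Φ y)
    (hΦ' : (fderiv ℝ Φ y).IsInvertible) :
    ricciCoord (coordPullback G Φ) y =
      (ricciCoord G (Φ y)).bilinearComp (fderiv ℝ Φ y) (fderiv ℝ Φ y) := by
  ext v w
  rw [ricciCoord_apply, ContinuousLinearMap.bilinearComp_apply, ricciCoord_apply]
  exact trace_eq_of_isInvertible hΦ' _ _ fun u => curvatureEnd_coordPullback hG hΦ hΦ' u v w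

/-- The chain rule for second derivatives contributes `dφ(D²Φ(u, v))`, exactly the inhomogeneous
term in the transformation of `Γ`. -/
theorem hessianCoord_coordPullback [FiniteDimensional ℝ E]
    {G : F → F →L[ℝ] F →L[ℝ] ℝ} {Φ : E → F} {φ : F → ℝ}
    {y : E} (hG : IsMetricAt G (Φ y)) (hΦ : ContDiffAt ℝ 3 Φ y)
    (hΦ' : (fderiv ℝ Φ y).IsInvertible) (hφ : ContDiffAt ℝ 2 φ (Φ y)) :
    hessianCoord (coordPullback G Φ) (φ ∘ Φ) y =
      (hessianCoord G φ (Φ y)).bilinearComp (fderiv ℝ Φ y) (fderiv ℝ Φ y) := by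
  have hc2 : ContDiffAt ℝ 2 (fderiv ℝ Φ) y := hΦ.fderiv_right (m := 2) (by norm_num)
  have hd : HasFDerivAt Φ (fderiv ℝ Φ y) y := (hΦ.differentiableAt (by simp)).hasFDerivAt
  have hd2 : HasFDerivAt (fderiv ℝ Φ) (fderiv ℝ (fderiv ℝ Φ) y) y :=
    (hc2.differentiableAt (by simp)).hasFDerivAt
  have hdφ : HasFDerivAt (fderiv ℝ φ) (fderiv ℝ (fderiv ℝ φ) (Φ y)) (Φ y) :=
    ((hφ.fderiv_right (m := 1) (by norm_num)).differentiableAt (by simp)).hasFDerivAt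
  have hev : fderiv ℝ (φ ∘ Φ) =ᶠ[𝓝 y] fun z => ((fderiv ℝ φ ∘ Φ) z).comp (fderiv ℝ Φ z) := by
    filter_upwards [hΦ.continuousAt.eventually (hφ.eventually (by simp)),
      hΦ.eventually (by simp)] with z h1 h2
    exact fderiv_comp z (h1.differentiableAt (by simp)) (h2.differentiableAt (by simp))
  ext u v
  rw [hessianCoord_apply, ContinuousLinearMap.bilinearComp_apply, hessianCoord_apply,
    hev.fderiv_eq, ((hdφ.comp y hd).clm_comp hd2).fderiv, hev.eq_of_nhds,
    ContinuousLinearMap.comp_apply, Function.comp_apply, christoffel_coordPullback hG hΦ hΦ']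
  simp
  ring

/-- The two raised endomorphisms are conjugate through `A`. -/
theorem metricTrace_bilinearComp {B C : F →L[ℝ] F →L[ℝ] ℝ} {A : E →L[ℝ] F} [FiniteDimensional ℝ E]
    (hB : B.IsInvertible) (hA : A.IsInvertible) :
    metricTrace (B.bilinearComp A A) (C.bilinearComp A A) = metricTrace B C := by
  refine trace_eq_of_isInvertible hA _ _ fun v => form_ext hB fun w => ?_
  obtain ⟨w, rfl⟩ := hA.surjective w
  have h1 : B.bilinearComp A A (raise (B.bilinearComp A A) (C.bilinearComp A A) v) w =
      C (A v) (A w) := by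
    simp only [raise, ContinuousLinearMap.comp_apply]
    rw [sharp_apply_self (hB.bilinearComp hA)]
    rfl
  have h2 : B (raise B C (A v)) (A w) = C (A v) (A w) := by
    simp only [raise, ContinuousLinearMap.comp_apply]
    rw [sharp_apply_self hB]
  rw [ContinuousLinearMap.coe_coe, ContinuousLinearMap.coe_coe, h2]
  exact h1

end CoordinateCalculus

/-! ### Christoffel symbols of `a² dt² + γ` -/

section WarpedMetric

variable {E : Type*} [NormedAddCommGroup E] [NormedSpace ℝ E]
  {F : Type*} [NormedAddCommGroup F] [NormedSpace ℝ F]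

/-- A finite-dimensional space and its dual have equal dimension, so nondegeneracy is enough. -/
theorem isInvertible_of_injective [FiniteDimensional ℝ E] {B : E →L[ℝ] E →L[ℝ] ℝ}
    (hB : ∀ u, (∀ v, B u v = 0) → u = 0) : B.IsInvertible := by
  have h1 : Module.finrank ℝ E = Module.finrank ℝ (E →L[ℝ] ℝ) := by
    rw [← (LinearMap.toContinuousLinearMap : (E →ₗ[ℝ] ℝ) ≃ₗ[ℝ] (E →L[ℝ] ℝ)).finrank_eq]
    exact (Subspace.dual_finrank_eq (K := ℝ) (V := E)).symm
  have h2 : Function.Injective (B : E →ₗ[ℝ] (E →L[ℝ] ℝ)) := by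
    rw [injective_iff_map_eq_zero]
    intro u hu
    exact hB u fun v => congrArg (fun A : E →L[ℝ] ℝ => A v) hu
  refine ⟨(LinearEquiv.ofInjectiveOfFinrankEq _ h2 h1).toContinuousLinearEquiv, ?_⟩
  ext u v
  rfl

theorem fderiv_apply_const₂ {D : Type*} [NormedAddCommGroup D] [NormedSpace ℝ D]
    {A : D → E →L[ℝ] E →L[ℝ] F} {y : D} (h : DifferentiableAt ℝ A y) (w : D) (u v : E) :
    fderiv ℝ (fun z => A z u v) y w = fderiv ℝ A y w u v := by
  have h1 : DifferentiableAt ℝ (fun z => A z u) y :=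
    h.clm_apply (differentiableAt_const u)
  rw [fderiv_clm_apply h1 (differentiableAt_const v),
    fderiv_clm_apply h (differentiableAt_const u)]
  simp

theorem hasFDerivAt_slice {A : ℝ × E → F} {q : ℝ × E} (hA : DifferentiableAt ℝ A q) :
    HasFDerivAt (fun z => A (q.1, z)) ((fderiv ℝ A q).comp (ContinuousLinearMap.inr ℝ ℝ E)) q.2 :=
  HasFDerivAt.comp (f := fun z => (q.1, z)) q.2 hA.hasFDerivAt (hasFDerivAt_prodMk_right q.1 q.2)

theorem fderiv_slice {A : ℝ × E → F} {q : ℝ × E} (hA : DifferentiableAt ℝ A q) (u : E) :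
    fderiv ℝ (fun z => A (q.1, z)) q.2 u = fderiv ℝ A q (0, u) := by
  rw [(hasFDerivAt_slice hA).fderiv]
  rfl

theorem contDiffAt_slice {n : WithTop ℕ∞} {A : ℝ × E → F} {q : ℝ × E} (hA : ContDiffAt ℝ n A q) :
    ContDiffAt ℝ n (fun z => A (q.1, z)) q.2 :=
  ContDiffAt.comp (f := fun z => (q.1, z)) q.2 hA (by fun_prop)

/-- The covariant derivative of the gradient of `φ` is the Hessian with an index raised. -/
theorem IsMetricAt.fderiv_gradient [FiniteDimensional ℝ E] {G : E → E →L[ℝ] E →L[ℝ] ℝ} {y : E}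
    {φ : E → ℝ} (hG : IsMetricAt G y) (hφ : ContDiffAt ℝ 2 φ y) (u : E) :
    fderiv ℝ (fun z => sharp (G z) (fderiv ℝ φ z)) y u +
      christoffel G y u (sharp (G y) (fderiv ℝ φ y)) = raise (G y) (hessianCoord G φ y) u := by
  refine form_ext hG.invertible fun v => ?_
  have hdφ : DifferentiableAt ℝ (fderiv ℝ φ) y :=
    (hφ.fderiv_right (m := 1) (by norm_num)).differentiableAt (by simp)
  have hgrad : DifferentiableAt ℝ (fun z => sharp (G z) (fderiv ℝ φ z)) y :=
    (hG.contDiffAt_sharp.differentiableAt (by simp)).clm_apply hdφ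
  have hev : (fun z => G z (sharp (G z) (fderiv ℝ φ z)) v) =ᶠ[𝓝 y] fun z => fderiv ℝ φ z v := by
    filter_upwards [hG.eventually] with z hz
    rw [sharp_apply_self hz.invertible]
  have h1 : HasFDerivAt (fun z => G z (sharp (G z) (fderiv ℝ φ z)) v) _ y :=
    (hG.differentiableAt.hasFDerivAt.clm_apply hgrad.hasFDerivAt).clm_apply (hasFDerivAt_const v y)
  have h2 := hdφ.hasFDerivAt.clm_apply (hasFDerivAt_const v y)
  -- The derivative along `u` of `G(grad φ, v) = dφ(v)`.
  have h3 := congrArg (fun A : E →L[ℝ] ℝ => A u) ((h1.congr_of_eventuallyEq hev.symm).unique h2)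
  simp at h3
  have h4 : fderiv ℝ φ y (christoffel G y u v) =
      G y (christoffel G y u v) (sharp (G y) (fderiv ℝ φ y)) := by
    rw [hG.symm_apply, sharp_apply_self hG.invertible]
  rw [map_add, _root_.add_apply, hG.apply_christoffel, raise, ContinuousLinearMap.comp_apply,
    sharp_apply_self hG.invertible, hessianCoord_apply, h4, hG.apply_christoffel, ← h3,
    hG.fderiv_symm v u, hG.fderiv_symm u v]
  ring

/-- A family `t ↦ γ (t, ·)` of metric tensors. -/
structure IsMetricFamilyAt (γ : ℝ × E → E →L[ℝ] E →L[ℝ] ℝ) (q : ℝ × E) : Prop where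
  contDiffAt : ContDiffAt ℝ 2 γ q
  symm : ∀ᶠ r in 𝓝 q, ∀ u v, γ r u v = γ r v u
  invertible : (γ q).IsInvertible

/-- `½ γ⁻¹ ∂_t γ`, the shape operator of the slices up to the factor given by the lapse. -/
def timeShape (γ : ℝ × E → E →L[ℝ] E →L[ℝ] ℝ) (q : ℝ × E) : E →L[ℝ] E :=
  (1 / 2 : ℝ) • raise (γ q) (fderiv ℝ γ q (1, 0))

/-- The gradient of a function along the slices. -/
def sliceGradient (γ : ℝ × E → E →L[ℝ] E →L[ℝ] ℝ) (a : ℝ × E → ℝ) (q : ℝ × E) : E :=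
  sharp (γ q) ((fderiv ℝ a q).comp (ContinuousLinearMap.inr ℝ ℝ E))

/-- The Laplacian of a function along the slices. -/
def sliceLaplacian (γ : ℝ × E → E →L[ℝ] E →L[ℝ] ℝ) (a : ℝ × E → ℝ) (q : ℝ × E) : ℝ :=
  metricTrace (γ q) (hessianCoord (fun z => γ (q.1, z)) (fun z => a (q.1, z)) q.2)

namespace IsMetricFamilyAt

variable {γ : ℝ × E → E →L[ℝ] E →L[ℝ] ℝ} {q : ℝ × E}

theorem eventually [CompleteSpace E] (h : IsMetricFamilyAt γ q) :
    ∀ᶠ r in 𝓝 q, IsMetricFamilyAt γ r := by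
  filter_upwards [h.contDiffAt.eventually (by simp), h.symm.eventually_nhds,
    eventually_isInvertible h.contDiffAt.continuousAt h.invertible] with z h1 h2 h3
  exact ⟨h1, h2, h3⟩

theorem differentiableAt (h : IsMetricFamilyAt γ q) : DifferentiableAt ℝ γ q :=
  h.contDiffAt.differentiableAt (by simp)

theorem symm_apply (h : IsMetricFamilyAt γ q) (u v : E) : γ q u v = γ q v u :=
  h.symm.self_of_nhds u v

theorem fderiv_symm (h : IsMetricFamilyAt γ q) (X : ℝ × E) (u v : E) :
    fderiv ℝ γ q X u v = fderiv ℝ γ q X v u := by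
  rw [← fderiv_apply_const₂ h.differentiableAt, ← fderiv_apply_const₂ h.differentiableAt]
  refine congrArg (fun A : (ℝ × E) →L[ℝ] ℝ => A X) (Filter.EventuallyEq.fderiv_eq ?_)
  filter_upwards [h.symm] with z hz
  exact hz u v

theorem slice (h : IsMetricFamilyAt γ q) : IsMetricAt (fun z => γ (q.1, z)) q.2 where
  contDiffAt := contDiffAt_slice h.contDiffAt
  symm := by
    have : Filter.Tendsto (fun z => (q.1, z)) (𝓝 q.2) (𝓝 q) :=
      (Continuous.prodMk_right q.1).tendsto q.2
    exact this.eventually h.symm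
  invertible := h.invertible

theorem contDiffAt_sharp [CompleteSpace E] (h : IsMetricFamilyAt γ q) :
    ContDiffAt ℝ 2 (fun r => sharp (γ r)) q := by
  obtain ⟨e, he⟩ := h.invertible
  have := contDiffAt_map_inverse (𝕜 := ℝ) (n := 2) e
  rw [he] at this
  exact this.comp q h.contDiffAt

theorem contDiffAt_timeDeriv (h : IsMetricFamilyAt γ q) :
    ContDiffAt ℝ 1 (fun r => fderiv ℝ γ r (1, 0)) q :=
  (h.contDiffAt.fderiv_right (m := 1) (by norm_num)).clm_apply contDiffAt_const

theorem differentiableAt_timeShape [CompleteSpace E] (h : IsMetricFamilyAt γ q) :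
    DifferentiableAt ℝ (timeShape γ) q :=
  (((h.contDiffAt_sharp.of_le (by norm_num)).clm_comp h.contDiffAt_timeDeriv).differentiableAt
    (by simp)).const_smul (1 / 2 : ℝ)

theorem apply_timeShape (h : IsMetricFamilyAt γ q) (u v : E) :
    γ q (timeShape γ q u) v = fderiv ℝ γ q (1, 0) u v / 2 := by
  simp only [timeShape, raise, _root_.smul_apply, ContinuousLinearMap.comp_apply, map_smul,
    sharp_apply_self h.invertible, smul_eq_mul]
  ring

theorem timeDeriv_eq (h : IsMetricFamilyAt γ q) (u v : E) :
    fderiv ℝ γ q (1, 0) u v = 2 * γ q (timeShape γ q u) v := by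
  rw [h.apply_timeShape]; ring

theorem timeShape_symm (h : IsMetricFamilyAt γ q) (u v : E) :
    γ q (timeShape γ q u) v = γ q u (timeShape γ q v) := by
  rw [h.symm_apply u, h.apply_timeShape, h.apply_timeShape, h.fderiv_symm]

/-- Differentiate `γ(L u, v) = ½ ∂_t γ(u, v)` with `L = timeShape γ`. The derivative falling on `γ`
is again `2 γ(L ·, ·)`, whence the `L²` term. Second time derivatives of `γ` can thus be expressed
through `∂_t L` and `L²`. -/
theorem timeDeriv_timeDeriv [CompleteSpace E] (h : IsMetricFamilyAt γ q) (u v : E) :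
    fderiv ℝ (fun r => fderiv ℝ γ r (1, 0)) q (1, 0) u v =
      2 * γ q (fderiv ℝ (timeShape γ) q (1, 0) u) v +
        4 * γ q (timeShape γ q (timeShape γ q u)) v := by
  have h1 : HasFDerivAt (fun r => γ r (timeShape γ r u) v) _ q :=
    (h.differentiableAt.hasFDerivAt.clm_apply (h.differentiableAt_timeShape.hasFDerivAt.clm_apply
      (hasFDerivAt_const u q))).clm_apply (hasFDerivAt_const v q)
  have h2 := (((h.contDiffAt_timeDeriv.differentiableAt (by simp)).hasFDerivAt.clm_apply
    (hasFDerivAt_const u q)).clm_apply (hasFDerivAt_const v q)).const_mul (1 / 2 : ℝ)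
  have hev : (fun r => γ r (timeShape γ r u) v) =ᶠ[𝓝 q]
      fun r => 1 / 2 * fderiv ℝ γ r (1, 0) u v := by
    filter_upwards [h.eventually] with r hr
    rw [hr.apply_timeShape]; ring
  have h3 := congrArg (fun A : (ℝ × E) →L[ℝ] ℝ => A (1, 0))
    ((h1.congr_of_eventuallyEq hev.symm).unique h2)
  simp [h.timeDeriv_eq] at h3
  linear_combination -2 * h3

theorem differentiableAt_sliceGradient [CompleteSpace E] (h : IsMetricFamilyAt γ q) {a : ℝ × E → ℝ}
    (ha : ContDiffAt ℝ 2 a q) : DifferentiableAt ℝ (sliceGradient γ a) q := by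
  have h1 : ContDiffAt ℝ 1 (fderiv ℝ a) q := ha.fderiv_right (m := 1) (by norm_num)
  exact (h.contDiffAt_sharp.differentiableAt (by simp)).clm_apply
    ((h1.clm_comp contDiffAt_const).differentiableAt (by simp))

/-- This is `IsMetricAt.fderiv_gradient` on a slice, restated for the gradient as a function of `(t,
z)`, the form in which it appears in the derivative of the warped Christoffel symbols. -/
theorem fderiv_sliceGradient [FiniteDimensional ℝ E] (h : IsMetricFamilyAt γ q) {a : ℝ × E → ℝ}
    (ha : ContDiffAt ℝ 2 a q) (u : E) :
    fderiv ℝ (sliceGradient γ a) q (0, u) +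
      christoffel (fun z => γ (q.1, z)) q.2 u (sliceGradient γ a q) =
      raise (γ q) (hessianCoord (fun z => γ (q.1, z)) (fun z => a (q.1, z)) q.2) u := by
  have h1 := h.slice.fderiv_gradient (contDiffAt_slice ha) u
  have h2 : fderiv ℝ (fun z => a (q.1, z)) q.2 =
      (fderiv ℝ a q).comp (ContinuousLinearMap.inr ℝ ℝ E) :=
    (hasFDerivAt_slice (ha.differentiableAt (by simp))).fderiv
  have h3 : (fun z => sharp (γ (q.1, z)) (fderiv ℝ (fun z => a (q.1, z)) z)) =ᶠ[𝓝 q.2]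
      fun z => sliceGradient γ a (q.1, z) := by
    have ht : Filter.Tendsto (fun z => (q.1, z)) (𝓝 q.2) (𝓝 q) :=
      (Continuous.prodMk_right q.1).tendsto q.2
    filter_upwards [ht.eventually (ha.eventually (by simp))] with z hz
    rw [(hasFDerivAt_slice (q := (q.1, z)) (hz.differentiableAt (by simp))).fderiv, sliceGradient]
  rw [h3.fderiv_eq, fderiv_slice (h.differentiableAt_sliceGradient ha), h2] at h1
  exact h1

end IsMetricFamilyAt

/-- The metric tensor `a² dt² + γ`. -/
def warpedForm (a : ℝ × E → ℝ) (γ : ℝ × E → E →L[ℝ] E →L[ℝ] ℝ) (q : ℝ × E) :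
    (ℝ × E) →L[ℝ] (ℝ × E) →L[ℝ] ℝ :=
  (a q ^ 2) • (ContinuousLinearMap.mul ℝ ℝ).bilinearComp
      (ContinuousLinearMap.fst ℝ ℝ E) (ContinuousLinearMap.fst ℝ ℝ E) +
    (γ q).bilinearComp (ContinuousLinearMap.snd ℝ ℝ E) (ContinuousLinearMap.snd ℝ ℝ E)

theorem warpedForm_apply (a : ℝ × E → ℝ) (γ : ℝ × E → E →L[ℝ] E →L[ℝ] ℝ) (q X Y : ℝ × E) :
    warpedForm a γ q X Y = a q ^ 2 * (X.1 * Y.1) + γ q X.2 Y.2 := rfl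

/-- The trace of an endomorphism of `ℝ × E` is the sum of the traces of its diagonal blocks. -/
theorem trace_prod_eq [FiniteDimensional ℝ E] (P : (ℝ × E) →ₗ[ℝ] (ℝ × E)) (Q : E →ₗ[ℝ] E)
    (hQ : ∀ u, Q u = (P (0, u)).2) :
    LinearMap.trace ℝ (ℝ × E) P = (P (1, 0)).1 + LinearMap.trace ℝ E Q := by
  have h0 : P (0, 0) = 0 := map_zero P
  have h1 : P = P ∘ₗ LinearMap.inl ℝ ℝ E ∘ₗ LinearMap.fst ℝ ℝ E +
      P ∘ₗ LinearMap.inr ℝ ℝ E ∘ₗ LinearMap.snd ℝ ℝ E := by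
    ext x <;> simp [h0]
  have h2 : LinearMap.snd ℝ ℝ E ∘ₗ P ∘ₗ LinearMap.inr ℝ ℝ E = Q := by
    ext u; simp [hQ]
  rw [h1, map_add, ← LinearMap.comp_assoc, ← LinearMap.comp_assoc, LinearMap.trace_comp_comm',
    LinearMap.trace_comp_comm' _ (P ∘ₗ LinearMap.inr ℝ ℝ E), h2,
    LinearMap.trace_eq_matrix_trace ℝ (Module.Basis.singleton Unit ℝ)]
  simp [Matrix.trace, LinearMap.toMatrix_apply, h0]

section

variable [FiniteDimensional ℝ E] {a : ℝ × E → ℝ} {γ : ℝ × E → E →L[ℝ] E →L[ℝ] ℝ} {q : ℝ × E}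

theorem IsMetricFamilyAt.warpedForm (h : IsMetricFamilyAt γ q) (ha : ContDiffAt ℝ 2 a q)
    (ha0 : a q ≠ 0) : IsMetricAt (warpedForm a γ) q where
  contDiffAt := ((ha.pow 2).smul contDiffAt_const).add
    (h.contDiffAt.bilinearComp contDiffAt_const)
  symm := by
    filter_upwards [h.symm] with r hr X Y
    rw [warpedForm_apply, warpedForm_apply, hr, mul_comm X.1]
  invertible := by
    refine isInvertible_of_injective fun X hX => ?_
    have h1 := hX (1, 0)
    have h2 : X.2 = 0 := form_ext h.invertible fun w => by
      simpa [warpedForm_apply] using hX (0, w)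
    simp [warpedForm_apply, ha0] at h1
    exact Prod.ext h1 h2

theorem fderiv_warpedForm (h : IsMetricFamilyAt γ q) (ha : ContDiffAt ℝ 2 a q)
    (ha0 : a q ≠ 0) (X Y Z : ℝ × E) :
    fderiv ℝ (warpedForm a γ) q X Y Z =
      2 * a q * fderiv ℝ a q X * Y.1 * Z.1 + fderiv ℝ γ q X Y.2 Z.2 := by
  rw [← (h.warpedForm ha ha0).fderiv_apply]
  have h1 := (((ha.differentiableAt (by simp)).hasFDerivAt.pow 2).mul_const (Y.1 * Z.1)).add
    ((h.differentiableAt.hasFDerivAt.clm_apply (hasFDerivAt_const Y.2 q)).clm_apply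
      (hasFDerivAt_const Z.2 q))
  have h2 := h1.fderiv
  rw [show (fun z => warpedForm a γ z Y Z) = _ from rfl]
  erw [h2]
  simp
  ring

/-- The formula is verified by pairing with an arbitrary `Z`: once every direction is split into its
time and slice parts, the slice part is the Christoffel formula for `γ` at fixed time and the rest
is `γ(L u, v) = ½ ∂_t γ(u, v)`. -/
theorem christoffel_warpedForm (h : IsMetricFamilyAt γ q) (ha : ContDiffAt ℝ 2 a q)
    (ha0 : a q ≠ 0) (X Y : ℝ × E) :
    christoffel (warpedForm a γ) q X Y =
      ((a q)⁻¹ * (fderiv ℝ a q X * Y.1 + fderiv ℝ a q Y * X.1 - fderiv ℝ a q (1, 0) * X.1 * Y.1) -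
        1 / 2 * (a q)⁻¹ ^ 2 * fderiv ℝ γ q (1, 0) X.2 Y.2,
       X.1 • timeShape γ q Y.2 + Y.1 • timeShape γ q X.2 +
        christoffel (fun z => γ (q.1, z)) q.2 X.2 Y.2 - (a q * X.1 * Y.1) • sliceGradient γ a q) := by
  refine form_ext (h.warpedForm ha ha0).invertible fun Z => ?_
  have hs : ∀ X : ℝ × E, ∀ u v, fderiv ℝ γ q X u v =
      X.1 * (fderiv ℝ γ q (1, 0) u v) + fderiv ℝ (fun z => γ (q.1, z)) q.2 X.2 u v := by
    intro X u v
    rw [fderiv_slice h.differentiableAt]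
    have : X = X.1 • ((1 : ℝ), (0 : E)) + (0, X.2) := by ext <;> simp
    conv_lhs => rw [this, map_add, map_smul]
    simp
  have hs' : ∀ X : ℝ × E, fderiv ℝ a q X = X.1 * (fderiv ℝ a q (1, 0)) + fderiv ℝ a q (0, X.2) := by
    intro X
    have : X = X.1 • ((1 : ℝ), (0 : E)) + (0, X.2) := by ext <;> simp
    conv_lhs => rw [this, map_add, map_smul]
    simp
  have hg : γ q (sliceGradient γ a q) Z.2 = fderiv ℝ a q (0, Z.2) := by
    rw [sliceGradient, sharp_apply_self h.invertible]; rfl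
  have hΓ := h.slice.apply_christoffel X.2 Y.2 Z.2
  rw [(h.warpedForm ha ha0).apply_christoffel, fderiv_warpedForm h ha ha0,
    fderiv_warpedForm h ha ha0, fderiv_warpedForm h ha ha0, warpedForm_apply]
  simp only [map_add, map_sub, map_smul, _root_.add_apply, _root_.sub_apply, _root_.smul_apply,
    smul_eq_mul, h.apply_timeShape, hg, hΓ]
  rw [hs X, hs Y, hs Z, hs' X, hs' Y, hs' Z]
  field_simp
  ring

end

end WarpedMetric

/-! ### Ricci and scalar curvature of `a² dt² + γ` -/

section WarpedCurvature

variable {E : Type*} [NormedAddCommGroup E] [NormedSpace ℝ E]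

theorem raise_apply_apply {B C : E →L[ℝ] E →L[ℝ] ℝ} (hB : B.IsInvertible) (u v : E) :
    B (raise B C u) v = C u v := by
  rw [raise, ContinuousLinearMap.comp_apply, sharp_apply_self hB]

theorem _root_.ContDiffAt.hasFDerivAt_fderiv_apply {a : E → ℝ} {q : E}
    (ha : ContDiffAt ℝ 2 a q) (X : E) :
    HasFDerivAt (fun r => fderiv ℝ a r X) ((fderiv ℝ (fderiv ℝ a) q).flip X) q := by
  have h1 : DifferentiableAt ℝ (fderiv ℝ a) q :=
    (ha.fderiv_right (m := 1) (by norm_num)).differentiableAt (by simp)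
  have := h1.hasFDerivAt.clm_apply (hasFDerivAt_const X q)
  simpa using this

variable [FiniteDimensional ℝ E]
  {a : ℝ × E → ℝ} {γ : ℝ × E → E →L[ℝ] E →L[ℝ] ℝ} {q : ℝ × E}

/-- The trace of `½ γ⁻¹ ∂_t γ`. -/
def timeTrace (γ : ℝ × E → E →L[ℝ] E →L[ℝ] ℝ) (q : ℝ × E) : ℝ :=
  LinearMap.trace ℝ E (timeShape γ q : E →ₗ[ℝ] E)

/-- The trace of the square of `½ γ⁻¹ ∂_t γ`. -/
def timeSqTrace (γ : ℝ × E → E →L[ℝ] E →L[ℝ] ℝ) (q : ℝ × E) : ℝ :=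
  LinearMap.trace ℝ E ((timeShape γ q).comp (timeShape γ q) : E →ₗ[ℝ] E)

/-- The closed formula for `Γ` holds near `q`, its hypotheses being open conditions, so it can be
differentiated. The four lemmas that follow extract only those components of `∂Γ` that enter
`Ric(∂_t, ∂_t)` and the scalar curvature. -/
theorem fderiv_christoffel_warpedForm (h : IsMetricFamilyAt γ q) (ha : ContDiffAt ℝ 2 a q)
    (ha0 : a q ≠ 0) (X Y Z : ℝ × E) :
    fderiv ℝ (christoffel (warpedForm a γ)) q X Y Z =
      fderiv ℝ (fun r => ((a r)⁻¹ * (fderiv ℝ a r Y * Z.1 + fderiv ℝ a r Z * Y.1 -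
          fderiv ℝ a r (1, 0) * Y.1 * Z.1) - 1 / 2 * (a r)⁻¹ ^ 2 * fderiv ℝ γ r (1, 0) Y.2 Z.2,
       Y.1 • timeShape γ r Z.2 + Z.1 • timeShape γ r Y.2 +
        christoffel (fun z => γ (r.1, z)) r.2 Y.2 Z.2 -
          (a r * Y.1 * Z.1) • sliceGradient γ a r)) q X := by
  rw [← fderiv_apply_const₂ (h.warpedForm ha ha0).differentiableAt_christoffel]
  refine congrArg (fun A : (ℝ × E) →L[ℝ] ℝ × E => A X) (Filter.EventuallyEq.fderiv_eq ?_)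
  filter_upwards [h.eventually, ha.eventually (by simp),
    ha.continuousAt.eventually_ne ha0] with r h1 h2 h3
  exact christoffel_warpedForm h1 h2 h3 Y Z

theorem fderiv_christoffel_warpedForm_time_time (h : IsMetricFamilyAt γ q)
    (ha : ContDiffAt ℝ 2 a q) (ha0 : a q ≠ 0) (u : E) :
    (fderiv ℝ (christoffel (warpedForm a γ)) q (0, u) (1, 0) (1, 0)).2 =
      -(fderiv ℝ a q (0, u) • sliceGradient γ a q +
        a q • fderiv ℝ (sliceGradient γ a) q (0, u)) := by
  rw [fderiv_christoffel_warpedForm h ha ha0]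
  simp only [map_zero, smul_zero, mul_one, mul_zero, sub_zero, add_sub_cancel_right, add_zero,
    zero_sub]
  have had := (ha.differentiableAt (by simp)).hasFDerivAt
  have h1 := had.smul (h.differentiableAt_sliceGradient ha).hasFDerivAt
  have h0 := ((hasDerivAt_inv ha0).comp_hasFDerivAt q had).mul (ha.hasFDerivAt_fderiv_apply (1, 0))
  have h2 := h0.prodMk h1.neg
  erw [h2.fderiv]
  simp
  abel

theorem fderiv_christoffel_warpedForm_space_time (h : IsMetricFamilyAt γ q)
    (ha : ContDiffAt ℝ 2 a q) (ha0 : a q ≠ 0) (X : ℝ × E) (u : E) :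
    fderiv ℝ (christoffel (warpedForm a γ)) q X (0, u) (1, 0) =
      ((a q)⁻¹ * fderiv ℝ (fderiv ℝ a) q X (0, u) -
        (a q)⁻¹ ^ 2 * fderiv ℝ a q X * fderiv ℝ a q (0, u),
        fderiv ℝ (timeShape γ) q X u) := by
  rw [fderiv_christoffel_warpedForm h ha ha0]
  simp only [map_zero, smul_zero, mul_one, one_smul, mul_zero, sub_zero, zero_add, add_zero,
    zero_smul]
  have had := (ha.differentiableAt (by simp)).hasFDerivAt
  have h0 := ((hasDerivAt_inv ha0).comp_hasFDerivAt q had).mul (ha.hasFDerivAt_fderiv_apply (0, u))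
  have h1 := h.differentiableAt_timeShape.hasFDerivAt.clm_apply (hasFDerivAt_const u q)
  have h2 := h0.prodMk h1
  erw [h2.fderiv]
  simp
  field_simp
  ring

theorem fderiv_christoffel_warpedForm_time_space_space (h : IsMetricFamilyAt γ q)
    (ha : ContDiffAt ℝ 2 a q) (ha0 : a q ≠ 0) (v w : E) :
    (fderiv ℝ (christoffel (warpedForm a γ)) q (1, 0) (0, v) (0, w)).1 =
      (a q)⁻¹ ^ 3 * fderiv ℝ a q (1, 0) * fderiv ℝ γ q (1, 0) v w -
        1 / 2 * (a q)⁻¹ ^ 2 * fderiv ℝ (fun r => fderiv ℝ γ r (1, 0)) q (1, 0) v w := by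
  have hd : DifferentiableAt ℝ (christoffel (warpedForm a γ)) q :=
    (h.warpedForm ha ha0).differentiableAt_christoffel
  have hd1 : DifferentiableAt ℝ (fun r => christoffel (warpedForm a γ) r (0, v) (0, w)) q :=
    (hd.clm_apply (differentiableAt_const _)).clm_apply (differentiableAt_const _)
  have h1 : (fun r => (christoffel (warpedForm a γ) r (0, v) (0, w)).1) =ᶠ[𝓝 q]
      fun r => -(1 / 2) * ((a r)⁻¹ ^ 2 * fderiv ℝ γ r (1, 0) v w) := by
    filter_upwards [h.eventually, ha.eventually (by simp),
      ha.continuousAt.eventually_ne ha0] with r h1 h2 h3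
    rw [christoffel_warpedForm h1 h2 h3]
    simp
    ring
  have had := (ha.differentiableAt (by simp)).hasFDerivAt
  have h2 := ((((hasDerivAt_inv ha0).comp_hasFDerivAt q had).pow 2).mul
    (((h.contDiffAt_timeDeriv.differentiableAt (by simp)).hasFDerivAt.clm_apply
      (hasFDerivAt_const v q)).clm_apply (hasFDerivAt_const w q))).const_mul (-(1 / 2) : ℝ)
  have h3 := congrArg (fun A : (ℝ × E) →L[ℝ] ℝ => A (1, 0))
    ((hd1.hasFDerivAt.fst.congr_of_eventuallyEq h1.symm).unique h2)
  rw [← fderiv_apply_const₂ hd]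
  simp at h3
  rw [h3]
  field_simp
  ring

theorem fderiv_christoffel_warpedForm_space (h : IsMetricFamilyAt γ q)
    (ha : ContDiffAt ℝ 2 a q) (ha0 : a q ≠ 0) (u v w : E) :
    (fderiv ℝ (christoffel (warpedForm a γ)) q (0, u) (0, v) (0, w)).2 =
      fderiv ℝ (christoffel fun z => γ (q.1, z)) q.2 u v w := by
  have hd : DifferentiableAt ℝ (christoffel (warpedForm a γ)) q :=
    (h.warpedForm ha ha0).differentiableAt_christoffel
  have hd1 : DifferentiableAt ℝ (fun r => christoffel (warpedForm a γ) r (0, v) (0, w)) q :=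
    (hd.clm_apply (differentiableAt_const _)).clm_apply (differentiableAt_const _)
  have ht : Filter.Tendsto (fun z => (q.1, z)) (𝓝 q.2) (𝓝 q) :=
    (Continuous.prodMk_right q.1).tendsto q.2
  have h1 : (fun z => (christoffel (warpedForm a γ) (q.1, z) (0, v) (0, w)).2) =ᶠ[𝓝 q.2]
      fun z => christoffel (fun z => γ (q.1, z)) z v w := by
    filter_upwards [ht.eventually h.eventually, ht.eventually (ha.eventually (by simp)),
      ht.eventually (ha.continuousAt.eventually_ne ha0)] with z h1 h2 h3
    rw [christoffel_warpedForm h1 h2 h3]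
    simp
  have h2 := (h.slice.differentiableAt_christoffel.hasFDerivAt.clm_apply
      (hasFDerivAt_const v q.2)).clm_apply (hasFDerivAt_const w q.2)
  have h3 := congrArg (fun A : E →L[ℝ] E => A u)
    (((hasFDerivAt_slice hd1).snd.congr_of_eventuallyEq h1.symm).unique h2)
  rw [← fderiv_apply_const₂ hd]
  simpa using h3

/-- The trace of the Riccati equation for the slices. Only the slice block of `u ↦ R(u, ∂_t) ∂_t`
contributes to the trace. -/
theorem ricciCoord_warpedForm_time (h : IsMetricFamilyAt γ q) (ha : ContDiffAt ℝ 2 a q)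
    (ha0 : a q ≠ 0) :
    ricciCoord (warpedForm a γ) q (1, 0) (1, 0) =
      -(a q * sliceLaplacian γ a q) -
        LinearMap.trace ℝ E (fderiv ℝ (timeShape γ) q (1, 0) : E →ₗ[ℝ] E) +
        (a q)⁻¹ * fderiv ℝ a q (1, 0) * timeTrace γ q - timeSqTrace γ q := by
  let Q : E →L[ℝ] E := -(a q • raise (γ q) (hessianCoord (fun z => γ (q.1, z))
      (fun z => a (q.1, z)) q.2)) - fderiv ℝ (timeShape γ) q (1, 0) +
      ((a q)⁻¹ * fderiv ℝ a q (1, 0)) • timeShape γ q - (timeShape γ q).comp (timeShape γ q)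
  rw [ricciCoord_apply, trace_prod_eq _ (Q : E →ₗ[ℝ] E)]
  · have h1 : curvatureEnd (warpedForm a γ) q (1, 0) (1, 0) (1, 0) = 0 := by
      rw [curvatureEnd_apply]; abel
    rw [ContinuousLinearMap.coe_coe, h1]
    simp [Q, timeTrace, timeSqTrace, sliceLaplacian, metricTrace]
  · intro u
    rw [ContinuousLinearMap.coe_coe, ContinuousLinearMap.coe_coe, curvatureEnd_apply]
    simp only [Prod.snd_add, Prod.snd_sub]
    rw [fderiv_christoffel_warpedForm_time_time h ha ha0]
    have h3 : fderiv ℝ (christoffel (warpedForm a γ)) q (1, 0) (0, u) (1, 0) = _ :=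
      fderiv_christoffel_warpedForm_space_time h ha ha0 (1, 0) u
    rw [h3, christoffel_warpedForm h ha ha0, christoffel_warpedForm h ha ha0,
      christoffel_warpedForm h ha ha0, christoffel_warpedForm h ha ha0]
    simp only [Q, _root_.sub_apply, _root_.add_apply, _root_.smul_apply, _root_.neg_apply,
      ← h.fderiv_sliceGradient ha, ContinuousLinearMap.comp_apply]
    simp [smul_smul, mul_inv_cancel_left₀ ha0]
    module

/-- The metric is block diagonal, so the mixed components of `C` play no role. The slice part of the
trace is passed as an endomorphism `Q` because in applications `Q` is an explicit sum with known
trace. -/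
theorem metricTrace_warpedForm (h : IsMetricFamilyAt γ q) (ha : ContDiffAt ℝ 2 a q)
    (ha0 : a q ≠ 0) (C : (ℝ × E) →L[ℝ] (ℝ × E) →L[ℝ] ℝ) (Q : E →L[ℝ] E)
    (hQ : ∀ u v, γ q (Q u) v = C (0, u) (0, v)) :
    metricTrace (warpedForm a γ q) C =
      (a q)⁻¹ ^ 2 * C (1, 0) (1, 0) + LinearMap.trace ℝ E (Q : E →ₗ[ℝ] E) := by
  have hW := (h.warpedForm ha ha0).invertible
  rw [metricTrace, trace_prod_eq _ (Q : E →ₗ[ℝ] E)]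
  · congr 1
    have h1 := raise_apply_apply (C := C) hW (1, 0) (1, 0)
    rw [warpedForm_apply] at h1
    simp at h1
    rw [ContinuousLinearMap.coe_coe, ← h1]
    field_simp
  · intro u
    refine form_ext h.invertible fun v => ?_
    have h1 := raise_apply_apply (C := C) hW (0, u) (0, v)
    rw [warpedForm_apply] at h1
    simp at h1
    simp [hQ, h1]

/-- The extra term is `-dφ` applied to the time component of `Γ`, that is, the normal derivative
times the second fundamental form of the slice. -/
theorem hessianCoord_warpedForm (h : IsMetricFamilyAt γ q) (ha : ContDiffAt ℝ 2 a q)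
    (ha0 : a q ≠ 0) {φ : ℝ × E → ℝ} (hφ : ContDiffAt ℝ 2 φ q) (u v : E) :
    hessianCoord (warpedForm a γ) φ q (0, u) (0, v) =
      hessianCoord (fun z => γ (q.1, z)) (fun z => φ (q.1, z)) q.2 u v +
        (a q)⁻¹ ^ 2 * fderiv ℝ φ q (1, 0) * γ q (timeShape γ q u) v := by
  have ht : Filter.Tendsto (fun z => (q.1, z)) (𝓝 q.2) (𝓝 q) :=
    (Continuous.prodMk_right q.1).tendsto q.2
  have h1 : (fun z => fderiv ℝ (fun z => φ (q.1, z)) z v) =ᶠ[𝓝 q.2]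
      fun z => fderiv ℝ φ (q.1, z) (0, v) := by
    filter_upwards [ht.eventually (hφ.eventually (by simp))] with z hz
    exact fderiv_slice (q := (q.1, z)) (hz.differentiableAt (by simp)) v
  have h2 : fderiv ℝ (fderiv ℝ fun z => φ (q.1, z)) q.2 u v =
      fderiv ℝ (fderiv ℝ φ) q (0, u) (0, v) := by
    rw [← fderiv_apply_const (((contDiffAt_slice hφ).fderiv_right
      (m := 1) (by norm_num)).differentiableAt (by simp)), h1.fderiv_eq,
      fderiv_slice (A := fun r => fderiv ℝ φ r (0, v))
        (hφ.hasFDerivAt_fderiv_apply (0, v)).differentiableAt,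
      (hφ.hasFDerivAt_fderiv_apply (0, v)).fderiv]
    rfl
  have h3 : ∀ α : ℝ, ∀ w : E, fderiv ℝ φ q (α, w) =
      α * fderiv ℝ φ q (1, 0) + fderiv ℝ φ q (0, w) := by
    intro α w
    have : (α, w) = α • ((1 : ℝ), (0 : E)) + (0, w) := by ext <;> simp
    rw [this, map_add, map_smul, smul_eq_mul]
  rw [hessianCoord_apply, hessianCoord_apply, h2, christoffel_warpedForm h ha ha0,
    fderiv_slice (hφ.differentiableAt (by simp)), h.timeDeriv_eq]
  simp
  rw [h3]
  ring

/-- The Gauss equation, arranged so that all second time derivatives and the Laplacian of the lapse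
sit in `Ric(∂_t, ∂_t)`. The intrinsic term does not involve `a`, so it cancels when two lapses are
compared. -/
theorem metricTrace_ricciCoord_warpedForm (h : IsMetricFamilyAt γ q) (ha : ContDiffAt ℝ 2 a q)
    (ha0 : a q ≠ 0) :
    metricTrace (warpedForm a γ q) (ricciCoord (warpedForm a γ) q) =
      metricTrace (γ q) (ricciCoord (fun z => γ (q.1, z)) q.2) +
        2 * (a q)⁻¹ ^ 2 * ricciCoord (warpedForm a γ) q (1, 0) (1, 0) -
        (a q)⁻¹ ^ 2 * (timeTrace γ q ^ 2 - timeSqTrace γ q) := by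
  set L := timeShape γ q with hL
  set Lt := fderiv ℝ (timeShape γ) q (1, 0) with hLt
  -- The slice block of the Ricci tensor with an index raised. The first two groups come from the
  -- trace over slice directions (intrinsic Ricci and Gauss terms), the last from the time component
  -- of `R(∂_t, v) w`.
  let Q : E →L[ℝ] E := raise (γ q) (ricciCoord (fun z => γ (q.1, z)) q.2) +
    (-((a q)⁻¹ ^ 2 * timeTrace γ q) • L + (a q)⁻¹ ^ 2 • L.comp L) +
    (((a q)⁻¹ ^ 3 * fderiv ℝ a q (1, 0)) • L - (a q)⁻¹ ^ 2 • Lt -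
      (a q)⁻¹ • raise (γ q) (hessianCoord (fun z => γ (q.1, z)) (fun z => a (q.1, z)) q.2) -
      (a q)⁻¹ ^ 2 • L.comp L)
  rw [metricTrace_warpedForm h ha ha0 _ Q]
  · have : LinearMap.trace ℝ E (Q : E →ₗ[ℝ] E) =
      metricTrace (γ q) (ricciCoord (fun z => γ (q.1, z)) q.2) +
      (-((a q)⁻¹ ^ 2 * timeTrace γ q) * timeTrace γ q + (a q)⁻¹ ^ 2 * timeSqTrace γ q) +
      ((a q)⁻¹ ^ 3 * fderiv ℝ a q (1, 0) * timeTrace γ q -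
        (a q)⁻¹ ^ 2 * LinearMap.trace ℝ E (Lt : E →ₗ[ℝ] E) -
      (a q)⁻¹ * sliceLaplacian γ a q - (a q)⁻¹ ^ 2 * timeSqTrace γ q) := by
      simp [Q, timeTrace, timeSqTrace, sliceLaplacian, metricTrace, hL]
    rw [this, ricciCoord_warpedForm_time h ha ha0]
    field_simp
    ring
  · intro v w
    -- The slice block of `u ↦ R(u, v) w`: intrinsic curvature plus the two quadratic terms of the
    -- Gauss equation. The second of them has rank one, so its trace is an evaluation.
    let P : E →L[ℝ] E := curvatureEnd (fun z => γ (q.1, z)) q.2 v w -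
      ((a q)⁻¹ ^ 2 * γ q (L v) w) • L + ((a q)⁻¹ ^ 2) • ((γ q).flip w ∘L L).smulRight (L v)
    rw [ricciCoord_apply, trace_prod_eq _ (P : E →ₗ[ℝ] E)]
    · have hP : LinearMap.trace ℝ E (P : E →ₗ[ℝ] E) =
        ricciCoord (fun z => γ (q.1, z)) q.2 v w - (a q)⁻¹ ^ 2 * γ q (L v) w * timeTrace γ q +
          (a q)⁻¹ ^ 2 * γ q (L (L v)) w := by
        have : LinearMap.trace ℝ E
            ((((γ q).flip w ∘L L).smulRight (L v) : E →L[ℝ] E) : E →ₗ[ℝ] E) =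
            γ q (L (L v)) w :=
          LinearMap.trace_smulRight (((γ q).flip w ∘L L : E →L[ℝ] ℝ) : E →ₗ[ℝ] ℝ) (L v)
        simp only [P, ContinuousLinearMap.toLinearMap_add,
          ContinuousLinearMap.toLinearMap_sub, ContinuousLinearMap.toLinearMap_smul, map_add, map_sub, map_smul, this, smul_eq_mul,
          ricciCoord_apply, timeTrace, ← hL]
      rw [hP, ContinuousLinearMap.coe_coe, curvatureEnd_apply]
      simp only [Prod.fst_add, Prod.fst_sub]
      -- The derivative of `Γ` is known with the time vector in the last slot; symmetry of `Γ` near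
      -- `q` allows the exchange.
      have hsymm : fderiv ℝ (christoffel (warpedForm a γ)) q (0, v) (1, 0) (0, w) =
          fderiv ℝ (christoffel (warpedForm a γ)) q (0, v) (0, w) (1, 0) := by
        have hd := (h.warpedForm ha ha0).differentiableAt_christoffel
        rw [← fderiv_apply_const₂ hd, ← fderiv_apply_const₂ hd]
        refine congrArg (fun A : (ℝ × E) →L[ℝ] ℝ × E => A (0, v)) (Filter.EventuallyEq.fderiv_eq ?_)
        filter_upwards [(h.warpedForm ha ha0).eventually] with r hr
        exact hr.christoffel_symm _ _
      rw [fderiv_christoffel_warpedForm_time_space_space h ha ha0, hsymm,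
        fderiv_christoffel_warpedForm_space_time h ha ha0, christoffel_warpedForm h ha ha0,
        christoffel_warpedForm h ha ha0, christoffel_warpedForm h ha ha0,
        christoffel_warpedForm h ha ha0, h.timeDeriv_timeDeriv]
      -- The slice Hessian of the lapse in terms of space-time derivatives, read off from
      -- `hessianCoord_warpedForm` applied to `a` itself.
      have hh : hessianCoord (fun z => γ (q.1, z)) (fun z => a (q.1, z)) q.2 v w =
          fderiv ℝ (fderiv ℝ a) q (0, v) (0, w) -
            fderiv ℝ a q (0, christoffel (fun z => γ (q.1, z)) q.2 v w) := by
        have h1 := hessianCoord_warpedForm h ha ha0 ha v w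
        rw [hessianCoord_apply, christoffel_warpedForm h ha ha0, h.timeDeriv_eq] at h1
        simp at h1
        have h3 : ∀ α : ℝ, ∀ w : E, fderiv ℝ a q (α, w) =
            α * fderiv ℝ a q (1, 0) + fderiv ℝ a q (0, w) := by
          intro α w
          have : (α, w) = α • ((1 : ℝ), (0 : E)) + (0, w) := by ext <;> simp
          rw [this, map_add, map_smul, smul_eq_mul]
        rw [h3] at h1
        linear_combination -h1
      have h3 : ∀ α : ℝ, ∀ w : E, fderiv ℝ a q (α, w) =
            α * fderiv ℝ a q (1, 0) + fderiv ℝ a q (0, w) := by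
        intro α w
        have : (α, w) = α • ((1 : ℝ), (0 : E)) + (0, w) := by ext <;> simp
        rw [this, map_add, map_smul, smul_eq_mul]
      simp only [Q, _root_.sub_apply, _root_.add_apply, _root_.smul_apply, map_add, map_sub,
        map_smul, raise_apply_apply h.invertible, hh, ContinuousLinearMap.comp_apply, smul_eq_mul,
        ← hL, ← hLt, h.timeDeriv_eq, map_zero, _root_.zero_apply]
      simp only [zero_smul, mul_zero, zero_mul, zero_add, sub_zero, add_zero, one_smul, zero_sub,
        mul_one, one_mul]
      rw [h3 (-_), ← h.timeShape_symm (L v), ← hL]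
      field_simp
      ring
    · intro u
      rw [ContinuousLinearMap.coe_coe, ContinuousLinearMap.coe_coe, curvatureEnd_apply]
      simp only [Prod.snd_add, Prod.snd_sub]
      rw [fderiv_christoffel_warpedForm_space h ha ha0, fderiv_christoffel_warpedForm_space h ha ha0,
        christoffel_warpedForm h ha ha0, christoffel_warpedForm h ha ha0,
        christoffel_warpedForm h ha ha0, christoffel_warpedForm h ha ha0]
      simp [P, curvatureEnd_apply, h.timeDeriv_eq, ← hL]
      module

end WarpedCurvature

/-! ### The pointwise evolution identity -/

section Evolution

variable {E : Type*} [NormedAddCommGroup E] [NormedSpace ℝ E] [FiniteDimensional ℝ E]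
  {γ : ℝ × E → E →L[ℝ] E →L[ℝ] ℝ} {q : ℝ × E}

theorem IsMetricFamilyAt.differentiableAt_timeTrace (h : IsMetricFamilyAt γ q) :
    DifferentiableAt ℝ (timeTrace γ) q := by
  let T : (E →L[ℝ] E) →L[ℝ] ℝ := LinearMap.toContinuousLinearMap
    (LinearMap.trace ℝ E ∘ₗ ContinuousLinearMap.coeLM ℝ)
  exact T.differentiableAt.comp q h.differentiableAt_timeShape

theorem IsMetricFamilyAt.contDiffAt_timeTrace (h : IsMetricFamilyAt γ q) :
    ContDiffAt ℝ 1 (timeTrace γ) q := by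
  let T : (E →L[ℝ] E) →L[ℝ] ℝ := LinearMap.toContinuousLinearMap
    (LinearMap.trace ℝ E ∘ₗ ContinuousLinearMap.coeLM ℝ)
  exact T.contDiff.contDiffAt.comp q
    (((h.contDiffAt_sharp.of_le (by norm_num)).clm_comp h.contDiffAt_timeDeriv).const_smul
      (1 / 2 : ℝ))

theorem IsMetricFamilyAt.continuousAt_timeSqTrace (h : IsMetricFamilyAt γ q) :
    ContinuousAt (timeSqTrace γ) q := by
  let T : (E →L[ℝ] E) →L[ℝ] ℝ := LinearMap.toContinuousLinearMap
    (LinearMap.trace ℝ E ∘ₗ ContinuousLinearMap.coeLM ℝ)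
  have h1 := h.differentiableAt_timeShape
  exact T.continuous.continuousAt.comp (h1.clm_comp h1).continuousAt

theorem IsMetricFamilyAt.fderiv_timeTrace (h : IsMetricFamilyAt γ q) (X : ℝ × E) :
    fderiv ℝ (timeTrace γ) q X =
      LinearMap.trace ℝ E (fderiv ℝ (timeShape γ) q X : E →ₗ[ℝ] E) := by
  let T : (E →L[ℝ] E) →L[ℝ] ℝ := LinearMap.toContinuousLinearMap
    (LinearMap.trace ℝ E ∘ₗ ContinuousLinearMap.coeLM ℝ)
  have h1 := T.hasFDerivAt.comp q h.differentiableAt_timeShape.hasFDerivAt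
  have h2 : timeTrace γ = T ∘ timeShape γ := rfl
  rw [h2, h1.fderiv]
  rfl

/-- The static equation in the direction normal to the slices. -/
theorem static_normal (h : IsMetricFamilyAt γ q) {f N : ℝ × E → ℝ} (hf : ContDiffAt ℝ 2 f q)
    (hf0 : f q ≠ 0) (hN : ContDiffAt ℝ 2 N q)
    (hstat : metricTrace (warpedForm f γ q) (hessianCoord (warpedForm f γ) N q) •
      warpedForm f γ q - hessianCoord (warpedForm f γ) N q +
        N q • ricciCoord (warpedForm f γ) q = 0) :
    sliceLaplacian γ N q + (f q)⁻¹ ^ 2 * fderiv ℝ N q (1, 0) * timeTrace γ q +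
      N q * (f q)⁻¹ ^ 2 * ricciCoord (warpedForm f γ) q (1, 0) (1, 0) = 0 := by
  -- On `(∂_t, ∂_t)` the full Laplacian times `f²` contains the Hessian entry once, and this cancels
  -- against the Hessian term. Second derivatives of `N` survive along the slice only.
  have h1 := congrArg (fun C : (ℝ × E) →L[ℝ] (ℝ × E) →L[ℝ] ℝ => C (1, 0) (1, 0)) hstat
  rw [metricTrace_warpedForm h hf hf0 _ (raise (γ q) (hessianCoord (fun z => γ (q.1, z))
    (fun z => N (q.1, z)) q.2) + ((f q)⁻¹ ^ 2 * fderiv ℝ N q (1, 0)) • timeShape γ q)] at h1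
  · simp [warpedForm_apply] at h1
    have h2 : LinearMap.trace ℝ E (raise (γ q) (hessianCoord (fun z => γ (q.1, z))
      (fun z => N (q.1, z)) q.2) : E →ₗ[ℝ] E) = sliceLaplacian γ N q := rfl
    have h3 : LinearMap.trace ℝ E (timeShape γ q : E →ₗ[ℝ] E) = timeTrace γ q := rfl
    rw [h2, h3] at h1
    field_simp at h1 ⊢
    linarith
  · intro u v
    rw [hessianCoord_warpedForm h hf hf0 hN]
    simp [raise_apply_apply h.invertible]

/-- The left side is the time derivative of `N (f⁻¹ - η⁻¹) tr L √det γ` divided by `√det γ`; the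
square of the trace comes from the density. The last line of the right side is the expression that
Green's formula integrates to zero. -/
theorem evolution_identity (h : IsMetricFamilyAt γ q) {f η N : ℝ × E → ℝ}
    (hf : ContDiffAt ℝ 2 f q) (hf0 : f q ≠ 0) (hη : ContDiffAt ℝ 2 η q) (hη0 : η q ≠ 0)
    (hN : ContDiffAt ℝ 2 N q)
    (hstat : metricTrace (warpedForm f γ q) (hessianCoord (warpedForm f γ) N q) •
      warpedForm f γ q - hessianCoord (warpedForm f γ) N q +
        N q • ricciCoord (warpedForm f γ) q = 0)
    (hR : metricTrace (warpedForm η γ q) (ricciCoord (warpedForm η γ) q) =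
      metricTrace (warpedForm f γ q) (ricciCoord (warpedForm f γ) q)) :
    fderiv ℝ N q (1, 0) * ((f q)⁻¹ - (η q)⁻¹) * timeTrace γ q +
      N q * (-((f q)⁻¹ ^ 2 * fderiv ℝ f q (1, 0)) + (η q)⁻¹ ^ 2 * fderiv ℝ η q (1, 0)) *
        timeTrace γ q +
      N q * ((f q)⁻¹ - (η q)⁻¹) * (fderiv ℝ (timeTrace γ) q (1, 0) + timeTrace γ q ^ 2) =
    -((η q)⁻¹ * (η q - f q) ^ 2 * ((f q)⁻¹ * timeTrace γ q) * ((f q)⁻¹ * fderiv ℝ N q (1, 0))) -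
      N q * ((f q)⁻¹ ^ 2 * (timeTrace γ q ^ 2 - timeSqTrace γ q) / 2) * (η q)⁻¹ *
        (η q - f q) ^ 2 +
      (N q * (sliceLaplacian γ η q - sliceLaplacian γ f q) -
        (η q - f q) * sliceLaplacian γ N q) := by
  have h1 := static_normal h hf hf0 hN hstat
  rw [metricTrace_ricciCoord_warpedForm h hη hη0, metricTrace_ricciCoord_warpedForm h hf hf0,
    ricciCoord_warpedForm_time h hη hη0, ricciCoord_warpedForm_time h hf hf0] at hR
  rw [ricciCoord_warpedForm_time h hf hf0] at h1
  rw [h.fderiv_timeTrace]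
  set LT := LinearMap.trace ℝ E (fderiv ℝ (timeShape γ) q (1, 0) : E →ₗ[ℝ] E)
  -- The multipliers are forced by the Laplacians: `N η / 2` brings the coefficient of `Δη` to `N`,
  -- and `η - f` is the required coefficient of `ΔN`. With them the coefficient of `Δf` and the
  -- terms in `tr ∂_t L`, `∂_t f` and `∂_t η` match as well.
  linear_combination (norm := (field_simp; ring)) (N q * η q / 2) * hR + (η q - f q) * h1

end Evolution

/-! ### Elementary symmetric functions of principal curvatures as traces -/

section ElementarySymmetric

theorem _root_.Multiset.esymm_one {R : Type*} [CommSemiring R] (s : Multiset R) :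
    s.esymm 1 = s.sum := by
  simp [Multiset.esymm, Multiset.powersetCard_one, Multiset.map_map]

/-- Newton's identity in degree two. In the induction the pairs in `x ::ₘ s` either avoid `x` or
contain it. -/
theorem _root_.Multiset.two_mul_esymm_two {R : Type*} [CommRing R] (s : Multiset R) :
    2 * s.esymm 2 = s.sum ^ 2 - (s.map fun x => x ^ 2).sum := by
  induction s using Multiset.induction_on with
  | empty => simp [Multiset.esymm, Multiset.powersetCard_zero_right]
  | cons x s ih =>
    have h1 : (x ::ₘ s).esymm 2 = s.esymm 2 + x * s.esymm 1 := by
      simp [Multiset.esymm, Multiset.powersetCard_cons, Multiset.map_map,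
        Multiset.sum_map_mul_left]
    rw [h1, mul_add, ih, Multiset.esymm_one]
    simp
    ring

variable {V : Type*} [AddCommGroup V] [Module ℝ V] [FiniteDimensional ℝ V]

/-- An endomorphism which is self-adjoint for an inner product has a basis of eigenvectors. -/
theorem exists_eigenbasis (B : V → V → ℝ) (hsymm : ∀ u v, B u v = B v u)
    (hadd : ∀ u v w, B (u + v) w = B u w + B v w) (hsmul : ∀ (c : ℝ) u v, B (c • u) v = c * B u v)
    (hpos : ∀ u, u ≠ 0 → 0 < B u u) (L : V →ₗ[ℝ] V) (hL : ∀ u v, B (L u) v = B u (L v)) :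
    ∃ (b : Module.Basis (Fin (Module.finrank ℝ V)) ℝ V) (l : Fin (Module.finrank ℝ V) → ℝ),
      ∀ i, L (b i) = l i • b i := by
  have h0 : B 0 0 = 0 := by simpa using hsmul 0 0 0
  -- `B` is installed as a local inner product so that the spectral theorem for symmetric operators
  -- applies to `L`.
  let c : InnerProductSpace.Core ℝ V :=
    { inner := B
      conj_inner_symm := fun u v => hsymm v u
      re_inner_nonneg := fun u => by
        by_cases hu : u = 0
        · subst hu; exact h0.ge
        · exact (hpos u hu).le
      add_left := hadd
      smul_left := fun u v c => hsmul c u v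
      definite := fun u hu => by
        by_contra h
        exact (hpos u h).ne' hu }
  let _ : NormedAddCommGroup V := c.toNormedAddCommGroup
  let _ : InnerProductSpace ℝ V := InnerProductSpace.ofCore c.toCore
  have hs : L.IsSymmetric := hL
  exact ⟨(hs.eigenvectorBasis rfl).toBasis, hs.eigenvalues rfl, fun i => by
    simp [hs.apply_eigenvectorBasis rfl i]⟩

theorem roots_charpoly_of_eigenbasis {ι : Type*} [Fintype ι] (L : V →ₗ[ℝ] V)
    (b : Module.Basis ι ℝ V) (l : ι → ℝ) (h : ∀ i, L (b i) = l i • b i) :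
    L.charpoly.roots = Finset.univ.val.map l := by
  classical
  have h1 : LinearMap.toMatrix b b L = Matrix.diagonal l := by
    ext i j
    rw [LinearMap.toMatrix_apply, h, map_smul, Module.Basis.repr_self]
    by_cases hij : i = j
    · subst hij; simp
    · simp [hij]
  rw [← LinearMap.charpoly_toMatrix L b, h1, Matrix.charpoly_diagonal]
  exact Polynomial.roots_multiset_prod_X_sub_C (Finset.univ.val.map l) ▸ by
    rw [Multiset.map_map]; rfl

theorem trace_of_eigenbasis {ι W : Type*} [Fintype ι] [AddCommGroup W] [Module ℝ W]
    (L : W →ₗ[ℝ] W) (b : Module.Basis ι ℝ W) (l : ι → ℝ) (h : ∀ i, L (b i) = l i • b i) :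
    LinearMap.trace ℝ W L = ∑ i, l i := by
  classical
  rw [LinearMap.trace_eq_matrix_trace ℝ b]
  simp [Matrix.trace, LinearMap.toMatrix_apply, h]

/-- Self-adjointness matters: the real roots of a characteristic polynomial give the traces only if
all eigenvalues are real, which an eigenbasis ensures. -/
theorem esymm_roots_charpoly (B : V → V → ℝ) (hsymm : ∀ u v, B u v = B v u)
    (hadd : ∀ u v w, B (u + v) w = B u w + B v w) (hsmul : ∀ (c : ℝ) u v, B (c • u) v = c * B u v)
    (hpos : ∀ u, u ≠ 0 → 0 < B u u) (L : V →ₗ[ℝ] V) (hL : ∀ u v, B (L u) v = B u (L v)) :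
    L.charpoly.roots.esymm 1 = LinearMap.trace ℝ V L ∧
      L.charpoly.roots.esymm 2 =
        (LinearMap.trace ℝ V L ^ 2 - LinearMap.trace ℝ V (L ∘ₗ L)) / 2 := by
  obtain ⟨b, l, hb⟩ := exists_eigenbasis B hsymm hadd hsmul hpos L hL
  have hb2 : ∀ i, (L ∘ₗ L) (b i) = (l i ^ 2) • b i := fun i => by
    simp [hb, smul_smul, sq]
  have h2 := Multiset.two_mul_esymm_two L.charpoly.roots
  rw [Multiset.esymm_one, trace_of_eigenbasis L b l hb, trace_of_eigenbasis (L ∘ₗ L) b _ hb2]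
  rw [roots_charpoly_of_eigenbasis L b l hb] at h2 ⊢
  rw [Multiset.map_map] at h2
  refine ⟨rfl, ?_⟩
  rw [eq_div_iff two_ne_zero, mul_comm, h2]
  rfl

end ElementarySymmetric

/-! ### The volume density and Jacobi's formula -/

section VolumeDensity

variable {D : Type*} [NormedAddCommGroup D] [NormedSpace ℝ D]

theorem contDiffAt_det {ι : Type*} [Fintype ι] [DecidableEq ι] {m : WithTop ℕ∞}
    {A : D → Matrix ι ι ℝ} {y : D} (hA : ∀ i j, ContDiffAt ℝ m (fun z => A z i j) y) :
    ContDiffAt ℝ m (fun z => (A z).det) y := by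
  simp only [Matrix.det_apply']
  exact ContDiffAt.sum fun σ _ => contDiffAt_const.mul (contDiffAt_prod fun i _ => hA _ _)

/-- The derivative of the determinant at the identity is the trace. -/
theorem hasFDerivAt_det_of_eq_one {ι : Type*} [Fintype ι] [DecidableEq ι]
    {A : D → Matrix ι ι ℝ} {A' : ι → ι → D →L[ℝ] ℝ} {y : D}
    (hA : ∀ i j, HasFDerivAt (fun z => A z i j) (A' i j) y) (h1 : A y = 1) :
    HasFDerivAt (fun z => (A z).det) (∑ i, A' i i) y := by
  simp only [Matrix.det_apply']
  have h := HasFDerivAt.fun_sum (u := Finset.univ) fun (σ : Equiv.Perm ι) _ =>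
    (HasFDerivAt.finsetProd (u := Finset.univ) fun i _ => hA (σ i) i).const_mul
      (((Equiv.Perm.sign σ : ℤˣ) : ℤ) : ℝ)
  refine h.congr_fderiv ?_
  -- In the Leibniz expansion at the identity matrix only the identity permutation contributes to
  -- first order.
  rw [Finset.sum_eq_single 1]
  · simp [h1]
  · intro σ _ hσ
    rw [Finset.sum_eq_zero, smul_zero]
    intro i _
    -- A nontrivial permutation moves at least two points, so after the factor `i` is differentiated
    -- a vanishing off-diagonal factor is still left.
    obtain ⟨j, hj, hji⟩ : ∃ j, σ j ≠ j ∧ j ≠ i := by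
      by_contra hcon
      push Not at hcon
      refine hσ (Equiv.ext fun j => ?_)
      by_cases hji : j = i
      · subst hji
        by_contra hne
        have h2 : σ (σ j) = σ j := by
          by_contra h3
          exact hne (hcon (σ j) h3)
        exact hne (σ.injective h2)
      · by_contra h3
        exact hji (hcon j h3)
    rw [Finset.prod_eq_zero (Finset.mem_erase.2 ⟨hji, Finset.mem_univ j⟩), zero_smul]
    rw [h1, Matrix.one_apply_ne hj]
  · simp

variable {n : ℕ}

local notation "𝔼" => EuclideanSpace ℝ (Fin n)

/-- The matrix of a bilinear form in the standard basis. -/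
def formMatrix (B : EuclideanSpace ℝ (Fin n) →L[ℝ] EuclideanSpace ℝ (Fin n) →L[ℝ] ℝ) :
    Matrix (Fin n) (Fin n) ℝ :=
  Matrix.of fun i j => B (EuclideanSpace.single i 1) (EuclideanSpace.single j 1)

/-- The matrix of an endomorphism in the standard basis. -/
def endMatrix (A : EuclideanSpace ℝ (Fin n) →L[ℝ] EuclideanSpace ℝ (Fin n)) :
    Matrix (Fin n) (Fin n) ℝ :=
  Matrix.of fun i j => A (EuclideanSpace.single j 1) i

theorem volumeDensity_eq (B : 𝔼 →L[ℝ] 𝔼 →L[ℝ] ℝ) : volumeDensity B = √(formMatrix B).det := rfl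

theorem euclidean_sum (u : 𝔼) : u = ∑ k, u k • EuclideanSpace.single k (1 : ℝ) := by
  ext i
  simp [Finset.sum_apply, Pi.single_apply]

theorem toMatrix_eq_endMatrix (A : 𝔼 →L[ℝ] 𝔼) :
    LinearMap.toMatrix (EuclideanSpace.basisFun (Fin n) ℝ).toBasis
      (EuclideanSpace.basisFun (Fin n) ℝ).toBasis (A : 𝔼 →ₗ[ℝ] 𝔼) = endMatrix A := by
  ext i j
  simp [LinearMap.toMatrix_apply, endMatrix]

theorem trace_eq_sum_apply (A : 𝔼 →L[ℝ] 𝔼) :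
    LinearMap.trace ℝ 𝔼 (A : 𝔼 →ₗ[ℝ] 𝔼) = ∑ i, A (EuclideanSpace.single i 1) i := by
  rw [LinearMap.trace_eq_matrix_trace ℝ (EuclideanSpace.basisFun (Fin n) ℝ).toBasis,
    toMatrix_eq_endMatrix]
  rfl

theorem det_endMatrix (A : 𝔼 →L[ℝ] 𝔼) : (endMatrix A).det = A.det := by
  rw [← toMatrix_eq_endMatrix, LinearMap.det_toMatrix]

theorem formMatrix_bilinearComp (B : 𝔼 →L[ℝ] 𝔼 →L[ℝ] ℝ) (A C : 𝔼 →L[ℝ] 𝔼) :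
    formMatrix (B.bilinearComp A C) = (endMatrix A).transpose * formMatrix B * endMatrix C := by
  ext i j
  simp only [formMatrix, endMatrix, Matrix.mul_apply, Matrix.of_apply, Matrix.transpose_apply,
    ContinuousLinearMap.bilinearComp_apply]
  conv_lhs => rw [euclidean_sum (A (EuclideanSpace.single i 1)),
    euclidean_sum (C (EuclideanSpace.single j 1))]
  simp only [map_sum, map_smul, _root_.sum_apply, _root_.smul_apply, smul_eq_mul,
    Finset.mul_sum, Finset.sum_mul]
  refine Finset.sum_congr rfl fun k _ => Finset.sum_congr rfl fun l _ => ?_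
  ring

/-- This factor is the Jacobian of the change of variables, which makes chart integrals independent
of the chart. -/
theorem volumeDensity_bilinearComp (B : 𝔼 →L[ℝ] 𝔼 →L[ℝ] ℝ) (A : 𝔼 →L[ℝ] 𝔼) :
    volumeDensity (B.bilinearComp A A) = |A.det| * volumeDensity B := by
  rw [volumeDensity_eq, volumeDensity_eq, formMatrix_bilinearComp, Matrix.det_mul, Matrix.det_mul,
    Matrix.det_transpose, det_endMatrix, mul_right_comm, Real.sqrt_mul (mul_self_nonneg _),
    Real.sqrt_mul_self_eq_abs]

theorem det_formMatrix_pos {B : 𝔼 →L[ℝ] 𝔼 →L[ℝ] ℝ} (hsymm : ∀ u v, B u v = B v u)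
    (hpos : ∀ u, u ≠ 0 → 0 < B u u) : 0 < (formMatrix B).det := by
  refine Matrix.PosDef.det_pos (Matrix.PosDef.of_dotProduct_mulVec_pos ?_ ?_)
  · ext i j
    simp [formMatrix, Matrix.conjTranspose_apply, hsymm]
  · intro x hx
    have h1 : dotProduct (star x) (Matrix.mulVec (formMatrix B) x) =
        B (WithLp.toLp 2 x) (WithLp.toLp 2 x) := by
      conv_rhs => rw [euclidean_sum (WithLp.toLp 2 x)]
      simp only [map_sum, map_smul, _root_.sum_apply, _root_.smul_apply, smul_eq_mul,
        dotProduct, Matrix.mulVec, formMatrix, Matrix.of_apply, Finset.mul_sum]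
      rw [Finset.sum_comm]
      refine Finset.sum_congr rfl fun k _ => Finset.sum_congr rfl fun l _ => ?_
      simp
      ring
    rw [h1]
    exact hpos _ (by simpa using hx)

theorem volumeDensity_pos {B : 𝔼 →L[ℝ] 𝔼 →L[ℝ] ℝ} (hsymm : ∀ u v, B u v = B v u)
    (hpos : ∀ u, u ≠ 0 → 0 < B u u) : 0 < volumeDensity B :=
  Real.sqrt_pos.2 (det_formMatrix_pos hsymm hpos)

theorem contDiffAt_volumeDensity {m : WithTop ℕ∞} {B : D → 𝔼 →L[ℝ] 𝔼 →L[ℝ] ℝ} {y : D}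
    (hB : ContDiffAt ℝ m B y) (h0 : 0 < volumeDensity (B y)) :
    ContDiffAt ℝ m (fun z => volumeDensity (B z)) y := by
  have h1 : ContDiffAt ℝ m (fun z => (formMatrix (B z)).det) y :=
    contDiffAt_det fun i j => (hB.clm_apply contDiffAt_const).clm_apply contDiffAt_const
  exact h1.sqrt (Real.sqrt_pos.1 h0).ne'

/-- Jacobi's formula for the volume density. -/
theorem fderiv_volumeDensity {B : D → 𝔼 →L[ℝ] 𝔼 →L[ℝ] ℝ} {y : D}
    (hB : DifferentiableAt ℝ B y) (hi : (B y).IsInvertible) (h0 : 0 < volumeDensity (B y)) (w : D) :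
    fderiv ℝ (fun z => volumeDensity (B z)) y w =
      1 / 2 * volumeDensity (B y) * metricTrace (B y) (fderiv ℝ B y w) := by
  -- Writing `B z` as `B y` composed with `P z` reduces the derivative of the determinant to the
  -- case of a matrix equal to `1` at `y`.
  let P : D → 𝔼 →L[ℝ] 𝔼 := fun z => raise (B y) (B z)
  have hP : HasFDerivAt P ((ContinuousLinearMap.compL ℝ 𝔼 (𝔼 →L[ℝ] ℝ) 𝔼 (sharp (B y))).comp
      (fderiv ℝ B y)) y :=
    (ContinuousLinearMap.compL ℝ 𝔼 (𝔼 →L[ℝ] ℝ) 𝔼 (sharp (B y))).hasFDerivAt.comp y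
      hB.hasFDerivAt
  have hM : ∀ z, formMatrix (B z) = (endMatrix (P z)).transpose * formMatrix (B y) := by
    intro z
    have h1 : B z = (B y).bilinearComp (P z) (ContinuousLinearMap.id ℝ 𝔼) := by
      ext u v
      rw [ContinuousLinearMap.bilinearComp_apply, raise_apply_apply hi]
      rfl
    have h2 : endMatrix (ContinuousLinearMap.id ℝ 𝔼) = 1 := by
      rw [← toMatrix_eq_endMatrix]
      exact LinearMap.toMatrix_id _
    conv_lhs => rw [h1, formMatrix_bilinearComp, h2, Matrix.mul_one]
  have hPy : endMatrix (P y) = 1 := by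
    have : P y = ContinuousLinearMap.id ℝ 𝔼 := by
      ext u : 1
      exact sharp_self_apply hi u
    rw [this, ← toMatrix_eq_endMatrix]
    exact LinearMap.toMatrix_id _
  have hdet := hasFDerivAt_det_of_eq_one (A := fun z => endMatrix (P z)) (y := y)
    (A' := fun i j => (EuclideanSpace.proj i).comp
      (((ContinuousLinearMap.compL ℝ 𝔼 (𝔼 →L[ℝ] ℝ) 𝔼 (sharp (B y))).comp
      (fderiv ℝ B y)).flip (EuclideanSpace.single j 1))) (fun i j => by
        have := (EuclideanSpace.proj (𝕜 := ℝ) i).hasFDerivAt.comp y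
          (hP.clm_apply (hasFDerivAt_const (EuclideanSpace.single j (1 : ℝ)) y))
        refine this.congr_fderiv ?_
        ext; simp) hPy
  have hsq : HasFDerivAt (fun z => volumeDensity (B z)) _ y :=
    HasFDerivAt.sqrt (f := fun z => (formMatrix (B z)).det) (x := y)
    (f' := (formMatrix (B y)).det • ∑ i, (EuclideanSpace.proj i).comp
      (((ContinuousLinearMap.compL ℝ 𝔼 (𝔼 →L[ℝ] ℝ) 𝔼 (sharp (B y))).comp
      (fderiv ℝ B y)).flip (EuclideanSpace.single i 1))) (by
      have h2 : (fun z => (formMatrix (B z)).det) =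
          fun z => (endMatrix (P z)).det * (formMatrix (B y)).det := by
        funext z
        rw [hM z, Matrix.det_mul, Matrix.det_transpose]
      rw [h2]
      have h3 := hdet.mul_const (formMatrix (B y)).det
      simpa [hPy] using h3) (Real.sqrt_pos.1 h0).ne'
  rw [hsq.fderiv, metricTrace, trace_eq_sum_apply, volumeDensity_eq]
  have h4 : √(formMatrix (B y)).det ≠ 0 := (show 0 < √(formMatrix (B y)).det from h0).ne'
  have h5 : (formMatrix (B y)).det = √(formMatrix (B y)).det ^ 2 :=
    (Real.sq_sqrt (Real.sqrt_pos.1 h0).le).symm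
  simp [raise]
  conv_lhs => enter [2, 1]; rw [h5]
  field_simp

end VolumeDensity

/-! ### Divergence in coordinates -/

section Divergence

variable {E : Type*} [NormedAddCommGroup E] [NormedSpace ℝ E]

theorem metricTrace_add (B C C' : E →L[ℝ] E →L[ℝ] ℝ) :
    metricTrace B (C + C') = metricTrace B C + metricTrace B C' := by
  simp [metricTrace, raise]

theorem metricTrace_sub (B C C' : E →L[ℝ] E →L[ℝ] ℝ) :
    metricTrace B (C - C') = metricTrace B C - metricTrace B C' := by
  simp [metricTrace, raise]

theorem metricTrace_smul (B C : E →L[ℝ] E →L[ℝ] ℝ) (c : ℝ) :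
    metricTrace B (c • C) = c * metricTrace B C := by
  simp [metricTrace, raise]

variable [FiniteDimensional ℝ E]

/-- Lowering an index identifies `E` with its dual and carries the endomorphism raised from `C.flip`
to the transpose of the one raised from `C`; a transpose has the same trace. -/
theorem metricTrace_flip {B : E →L[ℝ] E →L[ℝ] ℝ} (hB : B.IsInvertible)
    (hs : ∀ u v, B u v = B v u) (C : E →L[ℝ] E →L[ℝ] ℝ) :
    metricTrace B C.flip = metricTrace B C := by
  have hB' := hB
  obtain ⟨e, rfl⟩ := hB
  let e' : E ≃ₗ[ℝ] Module.Dual ℝ E := e.toLinearEquiv.trans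
    (LinearMap.toContinuousLinearMap : (E →ₗ[ℝ] ℝ) ≃ₗ[ℝ] (E →L[ℝ] ℝ)).symm
  rw [metricTrace, metricTrace, ← LinearMap.trace_transpose' (raise _ C : E →ₗ[ℝ] E)]
  refine trace_eq_of_intertwine e' _ _ fun u => LinearMap.ext fun v => ?_
  change (e : E →L[ℝ] E →L[ℝ] ℝ) (raise _ C.flip u) v = (e : E →L[ℝ] E →L[ℝ] ℝ) u (raise _ C v)
  rw [raise_apply_apply hB', hs u, raise_apply_apply hB']
  rfl

/-- With one argument fixed, the Christoffel form is half of `∂_w G` plus half of an antisymmetric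
form, and the latter has no trace. -/
theorem IsMetricAt.trace_christoffel_flip {G : E → E →L[ℝ] E →L[ℝ] ℝ} {y : E}
    (hG : IsMetricAt G y) (w : E) :
    LinearMap.trace ℝ E ((christoffel G y).flip w : E →ₗ[ℝ] E) =
      1 / 2 * metricTrace (G y) (fderiv ℝ G y w) := by
  let C : E →L[ℝ] E →L[ℝ] ℝ := (fderiv ℝ G y).flip w
  have h1 : (christoffelFirst G y).flip w = (1 / 2 : ℝ) • (fderiv ℝ G y w + (C - C.flip)) := by
    ext u v
    simp only [ContinuousLinearMap.flip_apply, christoffelFirst_apply, _root_.smul_apply,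
      _root_.add_apply, _root_.sub_apply, smul_eq_mul, C]
    rw [hG.fderiv_symm v w u]
    ring
  have h2 : (christoffel G y).flip w = raise (G y) ((christoffelFirst G y).flip w) := by
    ext u
    rfl
  rw [h2]
  change metricTrace (G y) _ = _
  rw [h1, metricTrace_smul, metricTrace_add, metricTrace_sub,
    metricTrace_flip hG.invertible hG.symm_apply, sub_self, add_zero]

variable {n : ℕ}

local notation "𝔼" => EuclideanSpace ℝ (Fin n)

/-- The classical formula `div W = (√det G)⁻¹ ∂_i (√det G Wⁱ)`: by Jacobi's formula the logarithmic
derivative of the density is the trace of the Christoffel symbols. -/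
theorem trace_fderiv_volumeDensity_smul {G : 𝔼 → 𝔼 →L[ℝ] 𝔼 →L[ℝ] ℝ} {y : 𝔼} {W : 𝔼 → 𝔼}
    (hG : IsMetricAt G y) (h0 : 0 < volumeDensity (G y)) (hW : DifferentiableAt ℝ W y) :
    LinearMap.trace ℝ 𝔼 (fderiv ℝ (fun z => volumeDensity (G z) • W z) y : 𝔼 →ₗ[ℝ] 𝔼) =
      (LinearMap.trace ℝ 𝔼 (fderiv ℝ W y : 𝔼 →ₗ[ℝ] 𝔼) +
        LinearMap.trace ℝ 𝔼 ((christoffel G y).flip (W y) : 𝔼 →ₗ[ℝ] 𝔼)) * volumeDensity (G y) := by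
  have hD : DifferentiableAt ℝ (fun z => volumeDensity (G z)) y :=
    (contDiffAt_volumeDensity hG.contDiffAt h0).differentiableAt (by simp)
  have h1 : LinearMap.trace ℝ 𝔼 (((fderiv ℝ (fun z => volumeDensity (G z)) y).smulRight (W y) :
      𝔼 →L[ℝ] 𝔼) : 𝔼 →ₗ[ℝ] 𝔼) = fderiv ℝ (fun z => volumeDensity (G z)) y (W y) :=
    LinearMap.trace_smulRight (fderiv ℝ (fun z => volumeDensity (G z)) y : 𝔼 →ₗ[ℝ] ℝ) (W y)
  rw [fderiv_fun_smul hD hW, ContinuousLinearMap.toLinearMap_add,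
    ContinuousLinearMap.toLinearMap_smul, map_add, map_smul, h1,
    fderiv_volumeDensity hG.differentiableAt hG.invertible h0, hG.trace_christoffel_flip,
    smul_eq_mul]
  ring

/-- The divergence of `φ ∇v - v ∇φ` is `φ Δv - v Δφ`. -/
theorem trace_fderiv_volumeDensity_smul_gradient {G : 𝔼 → 𝔼 →L[ℝ] 𝔼 →L[ℝ] ℝ} {y : 𝔼} {φ v : 𝔼 → ℝ}
    (hG : IsMetricAt G y) (h0 : 0 < volumeDensity (G y)) (hφ : ContDiffAt ℝ 2 φ y)
    (hv : ContDiffAt ℝ 2 v y) :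
    LinearMap.trace ℝ 𝔼 (fderiv ℝ (fun z => volumeDensity (G z) •
        (φ z • sharp (G z) (fderiv ℝ v z) - v z • sharp (G z) (fderiv ℝ φ z))) y : 𝔼 →ₗ[ℝ] 𝔼) =
      (φ y * metricTrace (G y) (hessianCoord G v y) -
        v y * metricTrace (G y) (hessianCoord G φ y)) * volumeDensity (G y) := by
  have hgrad : ∀ ψ : 𝔼 → ℝ, ContDiffAt ℝ 2 ψ y →
      DifferentiableAt ℝ (fun z => sharp (G z) (fderiv ℝ ψ z)) y := fun ψ hψ =>
    (hG.contDiffAt_sharp.differentiableAt (by simp)).clm_apply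
      ((hψ.fderiv_right (m := 1) (by norm_num)).differentiableAt (by simp))
  have hφd := hφ.differentiableAt (by simp)
  have hvd := hv.differentiableAt (by simp)
  rw [trace_fderiv_volumeDensity_smul (W := fun z => φ z • sharp (G z) (fderiv ℝ v z) -
    v z • sharp (G z) (fderiv ℝ φ z)) hG h0 ((hφd.fun_smul (hgrad v hv)).sub
    (hvd.fun_smul (hgrad φ hφ)))]
  congr 1
  -- Covariant derivative of `φ ∇v - v ∇φ` by the product rule: the Hessian part, plus two rank-one
  -- terms whose traces are both `⟨∇φ, ∇v⟩` and which therefore cancel.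
  have h2 : (fderiv ℝ (fun z => φ z • sharp (G z) (fderiv ℝ v z) -
      v z • sharp (G z) (fderiv ℝ φ z)) y) + (christoffel G y).flip
      (φ y • sharp (G y) (fderiv ℝ v y) - v y • sharp (G y) (fderiv ℝ φ y)) =
      φ y • raise (G y) (hessianCoord G v y) - v y • raise (G y) (hessianCoord G φ y) +
      ((fderiv ℝ φ y).smulRight (sharp (G y) (fderiv ℝ v y)) -
        (fderiv ℝ v y).smulRight (sharp (G y) (fderiv ℝ φ y))) := by
    rw [fderiv_fun_sub (hφd.fun_smul (hgrad v hv)) (hvd.fun_smul (hgrad φ hφ)),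
      fderiv_fun_smul hφd (hgrad v hv), fderiv_fun_smul hvd (hgrad φ hφ)]
    ext1 u
    simp [← hG.fderiv_gradient hφ u, ← hG.fderiv_gradient hv u]
    module
  have h3 : ∀ ψ χ : 𝔼 → ℝ, LinearMap.trace ℝ 𝔼 (((fderiv ℝ ψ y).smulRight
      (sharp (G y) (fderiv ℝ χ y)) : 𝔼 →L[ℝ] 𝔼) : 𝔼 →ₗ[ℝ] 𝔼) =
      G y (sharp (G y) (fderiv ℝ ψ y)) (sharp (G y) (fderiv ℝ χ y)) := by
    intro ψ χ
    rw [sharp_apply_self hG.invertible]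
    exact LinearMap.trace_smulRight (fderiv ℝ ψ y : 𝔼 →ₗ[ℝ] ℝ) _
  rw [← map_add, ← ContinuousLinearMap.toLinearMap_add, h2]
  simp only [ContinuousLinearMap.toLinearMap_add, ContinuousLinearMap.toLinearMap_sub,
    ContinuousLinearMap.toLinearMap_smul, map_add, map_sub, map_smul, h3]
  rw [hG.symm_apply (sharp (G y) (fderiv ℝ v y)), sub_self, add_zero]
  rfl

/-! ### Integration of compactly supported functions in coordinates -/

open MeasureTheory

/-- Extension by zero of a function supported in a compact subset of an open set. -/
theorem contDiff_indicator {F X : Type*} [NormedAddCommGroup F] [NormedSpace ℝ F]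
    [NormedAddCommGroup X] [NormedSpace ℝ X] {m : WithTop ℕ∞} {f : F → X} {U K : Set F}
    (hU : IsOpen U) (hK : IsCompact K) (hKU : K ⊆ U) (hf : ∀ y ∈ U, ContDiffAt ℝ m f y)
    (h0 : ∀ y ∈ U, y ∉ K → f y = 0) : ContDiff ℝ m (U.indicator f) := by
  rw [contDiff_iff_contDiffAt]
  intro y
  by_cases hy : y ∈ U
  · refine (hf y hy).congr_of_eventuallyEq ?_
    filter_upwards [hU.mem_nhds hy] with z hz
    exact Set.indicator_of_mem hz f
  · refine (contDiffAt_const (c := (0 : X))).congr_of_eventuallyEq ?_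
    filter_upwards [hK.isClosed.isOpen_compl.mem_nhds fun h => hy (hKU h)] with z hz
    by_cases hzU : z ∈ U
    · rw [Set.indicator_of_mem hzU, h0 z hzU hz]
    · exact Set.indicator_of_notMem hzU f

theorem continuous_indicator_of_compact {F X : Type*} [TopologicalSpace F] [T2Space F]
    [TopologicalSpace X] [Zero X] {f : F → X} {U K : Set F}
    (hU : IsOpen U) (hK : IsCompact K) (hKU : K ⊆ U) (hf : ContinuousOn f U)
    (h0 : ∀ y ∈ U, y ∉ K → f y = 0) : Continuous (U.indicator f) := by
  rw [continuous_iff_continuousAt]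
  intro y
  by_cases hy : y ∈ U
  · refine (hf.continuousAt (hU.mem_nhds hy)).congr ?_
    filter_upwards [hU.mem_nhds hy] with z hz
    exact (Set.indicator_of_mem hz f).symm
  · refine (continuousAt_const (y := (0 : X))).congr ?_
    filter_upwards [hK.isClosed.isOpen_compl.mem_nhds fun h => hy (hKU h)] with z hz
    by_cases hzU : z ∈ U
    · rw [Set.indicator_of_mem hzU, h0 z hzU hz]
    · exact (Set.indicator_of_notMem hzU f).symm

theorem hasCompactSupport_indicator {F X : Type*} [TopologicalSpace F] [T2Space F] [Zero X]
    {f : F → X} {U K : Set F} (hK : IsCompact K) (h0 : ∀ y ∈ U, y ∉ K → f y = 0) :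
    HasCompactSupport (U.indicator f) := by
  refine HasCompactSupport.intro hK fun y hy => ?_
  by_cases hyU : y ∈ U
  · rw [Set.indicator_of_mem hyU, h0 y hyU hy]
  · exact Set.indicator_of_notMem hyU f

theorem integrableOn_of_compact {f : 𝔼 → ℝ} {U K : Set 𝔼}
    (hU : IsOpen U) (hK : IsCompact K) (hKU : K ⊆ U) (hf : ContinuousOn f U)
    (h0 : ∀ y ∈ U, y ∉ K → f y = 0) : IntegrableOn f U := by
  rw [← integrable_indicator_iff hU.measurableSet]
  exact (continuous_indicator_of_compact hU hK hKU hf h0).integrable_of_hasCompactSupport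
    (hasCompactSupport_indicator hK h0)

/-- The integral of the divergence of a compactly supported vector field vanishes. -/
theorem integral_trace_fderiv_eq_zero {Z : 𝔼 → 𝔼} (hZ : ContDiff ℝ 1 Z)
    (hc : HasCompactSupport Z) : ∫ y, LinearMap.trace ℝ 𝔼 (fderiv ℝ Z y : 𝔼 →ₗ[ℝ] 𝔼) = 0 := by
  have hd : Differentiable ℝ Z := hZ.differentiable (by simp)
  have hcomp : ∀ i : Fin n, ContDiff ℝ 1 fun y => Z y i := fun i =>
    (EuclideanSpace.proj (𝕜 := ℝ) i).contDiff.comp hZ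
  have hcs : ∀ i : Fin n, HasCompactSupport fun y => Z y i := fun i =>
    hc.comp_left (g := fun z : 𝔼 => z i) rfl
  have h1 : ∀ y, ∀ i : Fin n, fderiv ℝ Z y (EuclideanSpace.single i 1) i =
      fderiv ℝ (fun y => Z y i) y (EuclideanSpace.single i 1) := by
    intro y i
    have := ((EuclideanSpace.proj (𝕜 := ℝ) i).hasFDerivAt.comp y (hd y).hasFDerivAt).fderiv
    have h2 : (fun y => Z y i) = EuclideanSpace.proj (𝕜 := ℝ) i ∘ Z := rfl
    rw [h2, this]
    rfl
  have hint : ∀ i : Fin n, Integrable fun y =>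
      fderiv ℝ (fun y => Z y i) y (EuclideanSpace.single i 1) := fun i =>
    (((hcomp i).continuous_fderiv (by simp)).clm_apply
      continuous_const).integrable_of_hasCompactSupport
      ((hcs i).fderiv_apply (𝕜 := ℝ) (EuclideanSpace.single i 1))
  simp only [trace_eq_sum_apply, h1]
  rw [integral_finsetSum _ fun i _ => hint i]
  refine Finset.sum_eq_zero fun i _ => ?_
  -- Integration by parts against the constant function `1`, whose derivative vanishes.
  have := integral_mul_fderiv_eq_neg_fderiv_mul_of_integrable (μ := volume)
    (f := fun _ : 𝔼 => (1 : ℝ)) (g := fun y => Z y i) (v := EuclideanSpace.single i 1)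
    (by simp) (by simpa using hint i)
    (by simpa using (hcomp i).continuous.integrable_of_hasCompactSupport (hcs i))
    (fun _ _ => differentiableAt_const _) (fun _ _ => (hcomp i).differentiable (by simp) _)
  simpa using this

/-- Green's formula in a coordinate domain. -/
theorem integral_green_coord {G : 𝔼 → 𝔼 →L[ℝ] 𝔼 →L[ℝ] ℝ} {U K : Set 𝔼} {φ v : 𝔼 → ℝ}
    (hU : IsOpen U) (hK : IsCompact K) (hKU : K ⊆ U) (hG : ∀ y ∈ U, IsMetricAt G y)
    (hpos : ∀ y ∈ U, 0 < volumeDensity (G y)) (hφ : ∀ y ∈ U, ContDiffAt ℝ 2 φ y)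
    (hv : ∀ y ∈ U, ContDiffAt ℝ 2 v y) (h0 : ∀ y ∈ U, y ∉ K → v y = 0) :
    ∫ y in U, (φ y * metricTrace (G y) (hessianCoord G v y) -
      v y * metricTrace (G y) (hessianCoord G φ y)) * volumeDensity (G y) = 0 := by
  -- The coordinate divergence of this field is the integrand. It vanishes off `K` because `v` does,
  -- near every point of `U` outside `K`; no support condition on `φ` is needed.
  let Z : 𝔼 → 𝔼 := fun z => volumeDensity (G z) •
    (φ z • sharp (G z) (fderiv ℝ v z) - v z • sharp (G z) (fderiv ℝ φ z))
  have hZ : ∀ y ∈ U, ContDiffAt ℝ 1 Z y := fun y hy =>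
    (contDiffAt_volumeDensity ((hG y hy).contDiffAt.of_le (by norm_num)) (hpos y hy)).smul
      ((((hφ y hy).of_le (by norm_num)).smul
        (((hG y hy).contDiffAt_sharp.of_le (by norm_num)).clm_apply
        ((hv y hy).fderiv_right (m := 1) (by norm_num)))).sub
      (((hv y hy).of_le (by norm_num)).smul
        (((hG y hy).contDiffAt_sharp.of_le (by norm_num)).clm_apply
        ((hφ y hy).fderiv_right (m := 1) (by norm_num)))))
  have hZ0 : ∀ y ∈ U, y ∉ K → Z y = 0 := by
    intro y hy hyK
    have h1 : v =ᶠ[𝓝 y] fun _ => 0 := by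
      filter_upwards [(hU.sdiff hK.isClosed).mem_nhds ⟨hy, hyK⟩] with z hz
      exact h0 z hz.1 hz.2
    have h2 : fderiv ℝ v y = 0 := by rw [h1.fderiv_eq]; simp
    simp [Z, h2, h0 y hy hyK]
  have h1 := integral_trace_fderiv_eq_zero (contDiff_indicator hU hK hKU hZ hZ0)
    (hasCompactSupport_indicator hK hZ0)
  rw [← integral_indicator hU.measurableSet, ← h1]
  refine integral_congr_ae (Filter.Eventually.of_forall fun y => ?_)
  by_cases hy : y ∈ U
  · have h2 : U.indicator Z =ᶠ[𝓝 y] Z := by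
      filter_upwards [hU.mem_nhds hy] with z hz
      exact Set.indicator_of_mem hz Z
    rw [Set.indicator_of_mem hy]
    simp only
    rw [h2.fderiv_eq]
    exact (trace_fderiv_volumeDensity_smul_gradient (hG y hy) (hpos y hy) (hφ y hy)
      (hv y hy)).symm
  · have h2 : U.indicator Z =ᶠ[𝓝 y] fun _ => 0 := by
      filter_upwards [hK.isClosed.isOpen_compl.mem_nhds fun h => hy (hKU h)] with z hz
      by_cases hzU : z ∈ U
      · rw [Set.indicator_of_mem hzU, hZ0 z hzU hz]
      · exact Set.indicator_of_notMem hzU Z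
    rw [Set.indicator_of_notMem hy]
    simp only
    rw [h2.fderiv_eq]
    simp

/-- Differentiation under the integral sign for integrands with compact support in space. -/
theorem hasDerivAt_integral_of_compact {F : ℝ × 𝔼 → ℝ} {J : Set ℝ} {U K : Set 𝔼}
    (hJ : IsOpen J) (hU : IsOpen U) (hK : IsCompact K) (hKU : K ⊆ U)
    (hF : ∀ s ∈ J, ∀ y ∈ U, ContDiffAt ℝ 1 F (s, y))
    (h0 : ∀ s ∈ J, ∀ y ∈ U, y ∉ K → F (s, y) = 0) {t : ℝ} (ht : t ∈ J) :
    HasDerivAt (fun s => ∫ y in U, F (s, y)) (∫ y in U, fderiv ℝ F (t, y) (1, 0)) t := by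
  -- A closed ball of half the radius stays in `J`. On its product with `K` the time derivative has
  -- a bound `C`, and `C` times the indicator of `K` dominates the difference quotients.
  obtain ⟨ε, hε, hball⟩ := Metric.isOpen_iff.1 hJ t ht
  have hI : Metric.closedBall t (ε / 2) ⊆ J :=
    (Metric.closedBall_subset_ball (by linarith)).trans hball
  have hdc : ∀ s ∈ J, ∀ y ∈ U, ContinuousAt (fun r : ℝ × 𝔼 => fderiv ℝ F r (1, 0)) (s, y) :=
    fun s hs y hy => (((hF s hs y hy).fderiv_right (m := 0) (by norm_num)).clm_apply
      contDiffAt_const).continuousAt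
  have hd0 : ∀ s ∈ J, ∀ y ∈ U, y ∉ K → fderiv ℝ F (s, y) (1, 0) = 0 := by
    intro s hs y hy hyK
    have : F =ᶠ[𝓝 (s, y)] fun _ => 0 := by
      filter_upwards [(hJ.prod (hU.sdiff hK.isClosed)).mem_nhds ⟨hs, hy, hyK⟩] with z hz
      exact h0 z.1 hz.1 z.2 hz.2.1 hz.2.2
    rw [this.fderiv_eq]
    simp
  have hcmp : IsCompact (Metric.closedBall t (ε / 2) ×ˢ K) :=
    (isCompact_closedBall t (ε / 2)).prod hK
  obtain ⟨C, hC⟩ := hcmp.exists_bound_of_continuousOn (f := fun r => fderiv ℝ F r (1, 0))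
    fun r hr => (hdc r.1 (hI hr.1) r.2 (hKU hr.2)).continuousWithinAt
  have hcont : ∀ s ∈ J, ContinuousOn (fun y => F (s, y)) U := fun s hs y hy =>
    ((hF s hs y hy).continuousAt.comp (f := fun y => (s, y))
      (by fun_prop)).continuousWithinAt
  have hInt : ∀ s ∈ J, IntegrableOn (fun y => F (s, y)) U := fun s hs =>
    integrableOn_of_compact hU hK hKU (hcont s hs) (h0 s hs)
  have key := hasDerivAt_integral_of_dominated_loc_of_deriv_le (𝕜 := ℝ) (μ := volume.restrict U)
    (F := fun s y => F (s, y)) (F' := fun s y => fderiv ℝ F (s, y) (1, 0)) (x₀ := t)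
    (bound := K.indicator fun _ => C) (Metric.closedBall_mem_nhds t (by linarith : 0 < ε / 2))
    (by
      filter_upwards [hJ.mem_nhds ht] with s hs
      exact (hInt s hs).aestronglyMeasurable)
    (hInt t ht)
    (ContinuousOn.aestronglyMeasurable (fun y hy => ((hdc t ht y hy).comp
      (f := fun y => (t, y)) (by fun_prop)).continuousWithinAt) hU.measurableSet)
    (by
      filter_upwards [ae_restrict_mem hU.measurableSet] with y hy s hs
      by_cases hyK : y ∈ K
      · rw [Set.indicator_of_mem hyK]
        exact hC (s, y) ⟨hs, hyK⟩
      · rw [Set.indicator_of_notMem hyK, hd0 s (hI hs) y hy hyK, norm_zero])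
    (by
      refine Integrable.restrict ?_
      rw [integrable_indicator_iff hK.measurableSet]
      exact integrableOn_const (hs := hK.measure_lt_top.ne))
    (by
      filter_upwards [ae_restrict_mem hU.measurableSet] with y hy s hs
      have h1 := ((hF s (hI hs) y hy).differentiableAt (by simp)).hasFDerivAt
      have h2 : HasDerivAt (fun s : ℝ => (s, y)) ((1 : ℝ), (0 : 𝔼)) s :=
        (hasDerivAt_id s).prodMk (hasDerivAt_const s y)
      exact h1.comp_hasDerivAt s h2)
  exact key.2

end Divergence

/-! ### Geometric quantities in arbitrary local parametrizations -/

section Charts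

variable {D : Type*} [NormedAddCommGroup D] [NormedSpace ℝ D]
  {E : Type*} [NormedAddCommGroup E] [NormedSpace ℝ E]
  {H : Type*} [TopologicalSpace H] {I : ModelWithCorners ℝ E H}
  {M : Type*} [TopologicalSpace M] [ChartedSpace H M]
  {E' : Type*} [NormedAddCommGroup E'] [NormedSpace ℝ E']
  {H' : Type*} [TopologicalSpace H'] {I' : ModelWithCorners ℝ E' H'}
  {M' : Type*} [TopologicalSpace M'] [ChartedSpace H' M']
  {E'' : Type*} [NormedAddCommGroup E''] [NormedSpace ℝ E'']
  {H'' : Type*} [TopologicalSpace H''] {I'' : ModelWithCorners ℝ E'' H''}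
  {M'' : Type*} [TopologicalSpace M''] [ChartedSpace H'' M'']

theorem differential_comp {ψ : M → M'} {F : M' → M''} {y : M}
    (hF : MDifferentiableAt I' I'' F (ψ y)) (hψ : MDifferentiableAt I I' ψ y) :
    differential I I'' (F ∘ ψ) y = (differential I' I'' F (ψ y)).comp (differential I I' ψ y) :=
  mfderiv_comp y hF hψ

theorem pullback_comp (g : M'' → E'' →L[ℝ] E'' →L[ℝ] ℝ) {ψ : M → M'} {F : M' → M''} {y : M}
    (hF : MDifferentiableAt I' I'' F (ψ y)) (hψ : MDifferentiableAt I I' ψ y) :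
    pullback I I'' g (F ∘ ψ) y = pullback I I' (pullback I' I'' g F) ψ y := by
  ext u v
  simp only [pullback_apply, differential_comp hF hψ, ContinuousLinearMap.comp_apply,
    Function.comp_apply]

theorem pullback_congr (g : M' → E' →L[ℝ] E' →L[ℝ] ℝ) {F F' : M → M'} {y : M}
    (h : F =ᶠ[𝓝 y] F') : pullback I I' g F y = pullback I I' g F' y := by
  unfold pullback differential
  rw [h.mfderiv_eq, h.eq_of_nhds]

theorem differential_eq_fderiv {f : D → E} {y : D} :
    differential 𝓘(ℝ, D) 𝓘(ℝ, E) f y = fderiv ℝ f y :=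
  mfderiv_eq_fderiv

variable [I.Boundaryless] [I'.Boundaryless]

theorem differential_eq_fderiv_written {ψ : M → M'} {p : M} (hψ : MDifferentiableAt I I' ψ p) :
    differential I I' ψ p = fderiv ℝ (writtenInExtChartAt I I' p ψ) (extChartAt I p p) := by
  refine (if_pos hψ).trans ?_
  rw [I.range_eq_univ, fderivWithin_univ]

theorem differential_eq_fderiv_extChartAt {ψ : D → M} {y : D}
    (hψ : MDifferentiableAt 𝓘(ℝ, D) I ψ y) :
    differential 𝓘(ℝ, D) I ψ y = fderiv ℝ (extChartAt I (ψ y) ∘ ψ) y := by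
  rw [differential_eq_fderiv_written hψ]
  rfl

variable [IsManifold I ∞ M]

theorem contMDiffAt_extChartAt_symm {x : M} {y : E} (hy : y ∈ (extChartAt I x).target) :
    ContMDiffAt 𝓘(ℝ, E) I ∞ (extChartAt I x).symm y :=
  (contMDiffOn_extChartAt_symm x).contMDiffAt ((isOpen_extChartAt_target x).mem_nhds hy)

theorem mdifferentiableAt_extChartAt_symm {x : M} {y : E} (hy : y ∈ (extChartAt I x).target) :
    MDifferentiableAt 𝓘(ℝ, E) I (extChartAt I x).symm y :=
  (contMDiffAt_extChartAt_symm hy).mdifferentiableAt (by simp)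

theorem contDiffAt_extChartAt_comp {ψ : D → M} {y : D} {x : M}
    (hψ : ContMDiffAt 𝓘(ℝ, D) I ∞ ψ y) (hx : ψ y ∈ (extChartAt I x).source) :
    ContDiffAt ℝ ∞ (extChartAt I x ∘ ψ) y := by
  rw [← contMDiffAt_iff_contDiffAt]
  exact (contMDiffAt_extChartAt' (by simpa using hx)).comp y hψ

/-- Pulling back a tensor is the same as pulling back its expression in a chart. -/
theorem pullback_eq_coordPullback (g : M → E →L[ℝ] E →L[ℝ] ℝ) {ψ : D → M} {y : D} {x : M}
    (hψ : ContMDiffAt 𝓘(ℝ, D) I ∞ ψ y) (hx : ψ y ∈ (extChartAt I x).source) :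
    pullback 𝓘(ℝ, D) I g ψ y = coordPullback (chartMetric I g x) (extChartAt I x ∘ ψ) y := by
  have h1 : (extChartAt I x).symm ∘ (extChartAt I x ∘ ψ) =ᶠ[𝓝 y] ψ := by
    filter_upwards [hψ.continuousAt.preimage_mem_nhds
      ((isOpen_extChartAt_source x).mem_nhds hx)] with z hz
    exact (extChartAt I x).left_inv hz
  have h2 : (extChartAt I x ∘ ψ) y ∈ (extChartAt I x).target := (extChartAt I x).map_source hx
  have h3 := (contDiffAt_extChartAt_comp hψ hx).differentiableAt (by simp)
  rw [← pullback_congr g h1, pullback_comp g (I' := 𝓘(ℝ, E)) (mdifferentiableAt_extChartAt_symm h2)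
    h3.mdifferentiableAt]
  ext u v
  rw [coordPullback_apply, pullback_apply, differential_eq_fderiv]
  rfl

/-- Tangent vectors at `x` are already read in the preferred chart at `x`, so the inverse of that
chart has identity differential at the base point. -/
theorem chartMetric_self (g : M → E →L[ℝ] E →L[ℝ] ℝ) (x : M) :
    chartMetric I g x (extChartAt I x x) = g x := by
  have h1 : differential 𝓘(ℝ, E) I (extChartAt I x).symm (extChartAt I x x) =
      ContinuousLinearMap.id ℝ E := by
    have := mfderivWithin_range_extChartAt_symm (I := I) (x := x)
    rw [I.range_eq_univ, mfderivWithin_univ] at this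
    exact this
  unfold chartMetric pullback
  rw [h1, (extChartAt I x).left_inv (mem_extChartAt_source x)]
  rfl

section Transformation

variable [FiniteDimensional ℝ D] [FiniteDimensional ℝ E] {g : M → E →L[ℝ] E →L[ℝ] ℝ}
  {ψ : D → M} {y : D}

/-- Geometric data of `(M, g)` are computed in any local parametrization. -/
structure IsParametrizationAt (I : ModelWithCorners ℝ E H) (g : M → E →L[ℝ] E →L[ℝ] ℝ)
    (ψ : D → M) (y : D) : Prop where
  eventually_contMDiffAt : ∀ᶠ z in 𝓝 y, ContMDiffAt 𝓘(ℝ, D) I ∞ ψ z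
  isInvertible : (differential 𝓘(ℝ, D) I ψ y).IsInvertible
  isMetricAt : IsMetricAt (chartMetric I g (ψ y)) (extChartAt I (ψ y) (ψ y))

namespace IsParametrizationAt

theorem contMDiffAt (h : IsParametrizationAt I g ψ y) : ContMDiffAt 𝓘(ℝ, D) I ∞ ψ y :=
  h.eventually_contMDiffAt.self_of_nhds

theorem contDiffAt (h : IsParametrizationAt I g ψ y) :
    ContDiffAt ℝ ∞ (extChartAt I (ψ y) ∘ ψ) y :=
  contDiffAt_extChartAt_comp h.contMDiffAt (mem_extChartAt_source _)

theorem differential_eq (h : IsParametrizationAt I g ψ y) :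
    differential 𝓘(ℝ, D) I ψ y = fderiv ℝ (extChartAt I (ψ y) ∘ ψ) y :=
  differential_eq_fderiv_extChartAt (h.contMDiffAt.mdifferentiableAt (by simp))

theorem pullback_eventuallyEq (h : IsParametrizationAt I g ψ y) :
    pullback 𝓘(ℝ, D) I g ψ =ᶠ[𝓝 y]
      coordPullback (chartMetric I g (ψ y)) (extChartAt I (ψ y) ∘ ψ) := by
  filter_upwards [h.eventually_contMDiffAt, h.contMDiffAt.continuousAt.preimage_mem_nhds
      ((isOpen_extChartAt_source (ψ y)).mem_nhds (mem_extChartAt_source (I := I) (ψ y)))]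
    with z hz1 hz2
  exact pullback_eq_coordPullback g hz1 hz2

theorem ricciCoord_pullback (h : IsParametrizationAt I g ψ y) :
    ricciCoord (pullback 𝓘(ℝ, D) I g ψ) y = (ricci I g (ψ y)).bilinearComp
      (differential 𝓘(ℝ, D) I ψ y) (differential 𝓘(ℝ, D) I ψ y) := by
  have hi := h.isInvertible
  rw [h.differential_eq] at hi ⊢
  rw [ricciCoord_congr h.pullback_eventuallyEq]
  exact ricciCoord_coordPullback h.isMetricAt (h.contDiffAt.of_le (ENat.LEInfty.out)) hi

theorem hessianCoord_pullback (h : IsParametrizationAt I g ψ y) {φ : M → ℝ}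
    (hφ : ContMDiffAt I 𝓘(ℝ, ℝ) ∞ φ (ψ y)) :
    hessianCoord (pullback 𝓘(ℝ, D) I g ψ) (φ ∘ ψ) y = (hessian I g φ (ψ y)).bilinearComp
      (differential 𝓘(ℝ, D) I ψ y) (differential 𝓘(ℝ, D) I ψ y) := by
  have hi := h.isInvertible
  rw [h.differential_eq] at hi ⊢
  have h1 : φ ∘ ψ =ᶠ[𝓝 y] (φ ∘ (extChartAt I (ψ y)).symm) ∘ (extChartAt I (ψ y) ∘ ψ) := by
    filter_upwards [h.contMDiffAt.continuousAt.preimage_mem_nhds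
      ((isOpen_extChartAt_source (ψ y)).mem_nhds (mem_extChartAt_source (I := I) (ψ y)))]
      with z hz
    simp only [Function.comp_apply]
    rw [(extChartAt I (ψ y)).left_inv hz]
  rw [hessianCoord_congr h.pullback_eventuallyEq h1]
  refine hessianCoord_coordPullback h.isMetricAt (h.contDiffAt.of_le (ENat.LEInfty.out))
    hi ?_
  have h2 : ContMDiffAt 𝓘(ℝ, E) 𝓘(ℝ, ℝ) ∞ (φ ∘ (extChartAt I (ψ y)).symm)
      (extChartAt I (ψ y) (ψ y)) := by
    refine ContMDiffAt.comp _ ?_ (contMDiffAt_extChartAt_symm (mem_extChartAt_target (ψ y)))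
    rwa [(extChartAt I (ψ y)).left_inv (mem_extChartAt_source (ψ y))]
  exact (contMDiffAt_iff_contDiffAt.1 h2).of_le (ENat.LEInfty.out)

theorem isInvertible_metric (h : IsParametrizationAt I g ψ y) : (g (ψ y)).IsInvertible := by
  have := h.isMetricAt.invertible
  rwa [chartMetric_self] at this

/-- The scalar curvature at a point is defined in the preferred chart there, and that chart changes
from point to point. This invariance allows the whole neighbourhood to be treated in a single
parametrization. -/
theorem scalarCurvature_eq (h : IsParametrizationAt I g ψ y) :
    metricTrace (pullback 𝓘(ℝ, D) I g ψ y) (ricciCoord (pullback 𝓘(ℝ, D) I g ψ) y) =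
      scalarCurvature I g (ψ y) := by
  rw [h.ricciCoord_pullback]
  exact metricTrace_bilinearComp h.isInvertible_metric h.isInvertible

theorem laplacian_eq (h : IsParametrizationAt I g ψ y) {φ : M → ℝ}
    (hφ : ContMDiffAt I 𝓘(ℝ, ℝ) ∞ φ (ψ y)) :
    metricTrace (pullback 𝓘(ℝ, D) I g ψ y) (hessianCoord (pullback 𝓘(ℝ, D) I g ψ) (φ ∘ ψ) y) =
      laplacian I g φ (ψ y) := by
  rw [h.hessianCoord_pullback hφ]
  exact metricTrace_bilinearComp h.isInvertible_metric h.isInvertible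

theorem static_pullback (h : IsParametrizationAt I g ψ y) {N : M → ℝ}
    (hN : IsStaticPotential I g N) :
    metricTrace (pullback 𝓘(ℝ, D) I g ψ y) (hessianCoord (pullback 𝓘(ℝ, D) I g ψ) (N ∘ ψ) y) •
      pullback 𝓘(ℝ, D) I g ψ y - hessianCoord (pullback 𝓘(ℝ, D) I g ψ) (N ∘ ψ) y +
        (N ∘ ψ) y • ricciCoord (pullback 𝓘(ℝ, D) I g ψ) y = 0 := by
  rw [h.laplacian_eq hN.smooth.contMDiffAt, h.hessianCoord_pullback hN.smooth.contMDiffAt,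
    h.ricciCoord_pullback]
  ext u v
  have := congrArg (fun C : E →L[ℝ] E →L[ℝ] ℝ => C (differential 𝓘(ℝ, D) I ψ y u)
    (differential 𝓘(ℝ, D) I ψ y v)) (hN.static (ψ y))
  simpa [pullback_apply] using this

end IsParametrizationAt

end Transformation

section Smoothness

variable [FiniteDimensional ℝ D]

/-- In finite dimension an operator-valued map is as smooth as its values on vectors, so smoothness
of a tensor can be checked on components. -/
theorem contDiffAt_clm_of_apply {F : Type*} [NormedAddCommGroup F] [NormedSpace ℝ F]
    [FiniteDimensional ℝ F] {m : WithTop ℕ∞} {A : D → F →L[ℝ] E} {y : D}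
    (h : ∀ u, ContDiffAt ℝ m (fun z => A z u) y) : ContDiffAt ℝ m A y := by
  let d := Module.finrank ℝ F
  have hd : d = Module.finrank ℝ (Fin d → ℝ) := (Module.finrank_fin_fun ℝ).symm
  let e₁ := ContinuousLinearEquiv.ofFinrankEq hd
  let e₂ := (e₁.arrowCongr (1 : E ≃L[ℝ] E)).trans (ContinuousLinearEquiv.piRing (Fin d))
  rw [← Function.id_comp A, ← e₂.symm_comp_self]
  exact e₂.symm.contDiff.contDiffAt.comp y (contDiffAt_pi.mpr fun i => h _)

theorem contMDiffAt_differential_apply {ψ : D → M} {y : D}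
    (hψ : ContMDiffAt 𝓘(ℝ, D) I ∞ ψ y) (u : D) :
    ContMDiffAt 𝓘(ℝ, D) I.tangent ∞ (fun z => (⟨ψ z, mfderiv 𝓘(ℝ, D) I ψ z u⟩ :
      TangentBundle I M)) y := by
  have h1 : ContMDiffAt 𝓘(ℝ, D) (𝓘(ℝ, D).tangent) ∞
      (fun z : D => (⟨z, u⟩ : TangentBundle 𝓘(ℝ, D) D)) y :=
    (contMDiffAt_vectorSpace_iff_contDiffAt (V := fun _ => u)).2 contDiffAt_const
  have h2 := hψ.mfderiv_const (m := ∞) (by simp)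
  exact ContMDiffWithinAt.clm_apply_of_inCoordinates (s := Set.univ)
    (b₁ := fun z : D => z) (b₂ := ψ) (v := fun _ => u) (ϕ := fun z => mfderiv 𝓘(ℝ, D) I ψ z)
    h2 h1 hψ

/-- Each component is the smooth bundle metric evaluated on two smooth vector fields along `ψ`. The
argument works for any smooth `ψ`, immersion or not. -/
theorem contDiffAt_pullback_metricForm
    (g : Bundle.ContMDiffRiemannianMetric I ∞ E (fun x : M => TangentSpace I x))
    {ψ : D → M} {y : D} (hψ : ContMDiffAt 𝓘(ℝ, D) I ∞ ψ y) :
    ContDiffAt ℝ ∞ (pullback 𝓘(ℝ, D) I (metricForm g) ψ) y := by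
  have key : ∀ u v, ContDiffAt ℝ ∞ (fun z => pullback 𝓘(ℝ, D) I (metricForm g) ψ z u v) y := by
    intro u v
    rw [← contMDiffAt_iff_contDiffAt]
    have h1 := ContMDiffAt.clm_bundle_apply₂ (F₁ := E) (F₂ := E) (F₃ := ℝ)
      (E₃ := Bundle.Trivial M ℝ)
      (g.contMDiff.contMDiffAt.comp y hψ) (contMDiffAt_differential_apply hψ u)
      (contMDiffAt_differential_apply hψ v)
    rw [Bundle.contMDiffAt_totalSpace] at h1
    exact h1.2
  exact contDiffAt_clm_of_apply fun u => contDiffAt_clm_of_apply fun v => key u v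

end Smoothness

end Charts

/-! ### The integral over a closed manifold and Green's formula -/

section SurfaceIntegral

open MeasureTheory

variable {E : Type*} [NormedAddCommGroup E] [NormedSpace ℝ E]

theorem hessianCoord_add {G : E → E →L[ℝ] E →L[ℝ] ℝ} {φ ψ : E → ℝ} {y : E}
    (hφ : ContDiffAt ℝ 2 φ y) (hψ : ContDiffAt ℝ 2 ψ y) :
    hessianCoord G (φ + ψ) y = hessianCoord G φ y + hessianCoord G ψ y := by
  have h1 : fderiv ℝ (φ + ψ) =ᶠ[𝓝 y] fderiv ℝ φ + fderiv ℝ ψ := by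
    filter_upwards [hφ.eventually (by simp), hψ.eventually (by simp)] with z h1 h2
    exact fderiv_add (h1.differentiableAt (by simp)) (h2.differentiableAt (by simp))
  have h2 : ∀ φ : E → ℝ, ContDiffAt ℝ 2 φ y → DifferentiableAt ℝ (fderiv ℝ φ) y := fun φ hφ =>
    (hφ.fderiv_right (m := 1) (by norm_num)).differentiableAt (by simp)
  ext u v
  simp only [hessianCoord_apply, _root_.add_apply]
  rw [h1.fderiv_eq, h1.eq_of_nhds, fderiv_add (h2 φ hφ) (h2 ψ hψ)]
  simp only [_root_.add_apply, Pi.add_apply]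
  ring

theorem hessianCoord_zero (G : E → E →L[ℝ] E →L[ℝ] ℝ) (y : E) :
    hessianCoord G 0 y = 0 := by
  ext u v
  have h1 : fderiv ℝ (0 : E → ℝ) = 0 := by
    ext1 z
    exact fderiv_const_apply (0 : ℝ)
  have h2 : fderiv ℝ (0 : E → E →L[ℝ] ℝ) y = 0 := fderiv_const_apply 0
  rw [hessianCoord_apply, h1, h2]
  simp

theorem continuousAt_metricTrace [FiniteDimensional ℝ E] {D : Type*} [TopologicalSpace D]
    {B C : D → E →L[ℝ] E →L[ℝ] ℝ} {y : D} (hB : ContinuousAt (fun z => sharp (B z)) y)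
    (hC : ContinuousAt C y) : ContinuousAt (fun z => metricTrace (B z) (C z)) y := by
  let T : (E →L[ℝ] E) →L[ℝ] ℝ := LinearMap.toContinuousLinearMap
    (LinearMap.trace ℝ E ∘ₗ ContinuousLinearMap.coeLM ℝ)
  exact T.continuous.continuousAt.comp (hB.clm_comp hC)

theorem IsMetricAt.continuousAt_hessianCoord [FiniteDimensional ℝ E]
    {G : E → E →L[ℝ] E →L[ℝ] ℝ} {φ : E → ℝ} {y : E} (hG : IsMetricAt G y)
    (hφ : ContDiffAt ℝ 2 φ y) : ContinuousAt (hessianCoord G φ) y := by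
  have h1 : ContDiffAt ℝ 1 (fderiv ℝ φ) y := hφ.fderiv_right (m := 1) (by norm_num)
  have h2 : ContDiffAt ℝ 0 (fderiv ℝ (fderiv ℝ φ)) y := h1.fderiv_right (m := 0) (by norm_num)
  exact h2.continuousAt.sub
    (((ContinuousLinearMap.compL ℝ E E ℝ).continuous.continuousAt.comp h1.continuousAt).clm_comp
      hG.contDiffAt_christoffel.continuousAt)

variable {n : ℕ} {S : Type*} [TopologicalSpace S]
  [ChartedSpace (EuclideanSpace ℝ (Fin n)) S]

local notation "𝔼" => EuclideanSpace ℝ (Fin n)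

/-- The integral of a function over a coordinate domain. -/
def chartIntegral (g : S → 𝔼 →L[ℝ] 𝔼 →L[ℝ] ℝ) (x : S) (ψ : S → ℝ) : ℝ :=
  ∫ y in (extChartAt (𝓡 n) x).target,
    ψ ((extChartAt (𝓡 n) x).symm y) * volumeDensity (chartMetric (𝓡 n) g x y)

/-- A field of inner products on `S` which is of class `C²`. -/
structure IsRiemannianMetric (g : S → 𝔼 →L[ℝ] 𝔼 →L[ℝ] ℝ) : Prop where
  isMetricAt : ∀ x, ∀ y ∈ (extChartAt (𝓡 n) x).target, IsMetricAt (chartMetric (𝓡 n) g x) y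
  volumeDensity_pos : ∀ x, ∀ y ∈ (extChartAt (𝓡 n) x).target,
    0 < volumeDensity (chartMetric (𝓡 n) g x y)

theorem chartIntegral_congr_support {g : S → 𝔼 →L[ℝ] 𝔼 →L[ℝ] ℝ} {x : S} {ψ : S → ℝ} {U : Set S}
    (hU : Function.support ψ ⊆ U) :
    chartIntegral g x ψ = ∫ y in (extChartAt (𝓡 n) x).target ∩ (extChartAt (𝓡 n) x).symm ⁻¹' U,
      ψ ((extChartAt (𝓡 n) x).symm y) * volumeDensity (chartMetric (𝓡 n) g x y) := by
  refine (setIntegral_eq_of_subset_of_forall_sdiff_eq_zero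
    (isOpen_extChartAt_target (I := 𝓡 n) x).measurableSet Set.inter_subset_left fun y hy => ?_)
  have : ψ ((extChartAt (𝓡 n) x).symm y) = 0 := by
    by_contra h
    exact hy.2 ⟨hy.1, hU h⟩
  rw [this, zero_mul]

variable [IsManifold (𝓡 n) ∞ S]

/-- The integral of a function supported in two coordinate domains can be computed in both. -/
theorem chartIntegral_eq_chartIntegral (g : S → 𝔼 →L[ℝ] 𝔼 →L[ℝ] ℝ) {x x₀ : S} {ψ : S → ℝ}
    (hx : Function.support ψ ⊆ (extChartAt (𝓡 n) x).source)
    (hx₀ : Function.support ψ ⊆ (extChartAt (𝓡 n) x₀).source) :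
    chartIntegral g x ψ = chartIntegral g x₀ ψ := by
  rw [chartIntegral_congr_support hx₀, chartIntegral_congr_support (x := x₀) hx]
  set e := extChartAt (𝓡 n) x with he
  set e₀ := extChartAt (𝓡 n) x₀ with he₀
  -- The overlap of the two charts, seen in the first. The transition map carries it bijectively
  -- onto the overlap seen in the second, and its Jacobian is absorbed by the volume density.
  let A : Set 𝔼 := e.target ∩ e.symm ⁻¹' e₀.source
  have hAo : IsOpen A :=
    (continuousOn_extChartAt_symm x).isOpen_inter_preimage (isOpen_extChartAt_target (I := 𝓡 n) x)
      (isOpen_extChartAt_source (I := 𝓡 n) x₀)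
  have himg : (e₀ ∘ e.symm) '' A = e₀.target ∩ e₀.symm ⁻¹' e.source := by
    ext z
    constructor
    · rintro ⟨y, hy, rfl⟩
      refine ⟨e₀.map_source hy.2, ?_⟩
      simp only [Set.mem_preimage, Function.comp_apply]
      rw [e₀.left_inv hy.2]
      exact e.map_target hy.1
    · rintro ⟨hz1, hz2⟩
      refine ⟨e (e₀.symm z), ⟨e.map_source hz2, ?_⟩, ?_⟩
      · simp only [Set.mem_preimage]
        rw [e.left_inv hz2]
        exact e₀.map_target hz1
      · simp only [Function.comp_apply]
        rw [e.left_inv hz2, e₀.right_inv hz1]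
  have hinj : Set.InjOn (e₀ ∘ e.symm) A := by
    intro y hy z hz hyz
    have h1 := e₀.injOn hy.2 hz.2 hyz
    rw [← e.right_inv hy.1, ← e.right_inv hz.1, h1]
  have hd : ∀ y ∈ A, ContDiffAt ℝ ∞ (e₀ ∘ e.symm) y := fun y hy =>
    contDiffAt_extChartAt_comp (contMDiffAt_extChartAt_symm hy.1) hy.2
  rw [← himg, integral_image_eq_integral_abs_det_fderiv_smul volume hAo.measurableSet
    (fun y hy => ((hd y hy).differentiableAt (by simp)).hasFDerivAt.hasFDerivWithinAt) hinj]
  refine setIntegral_congr_fun hAo.measurableSet fun y hy => ?_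
  have h1 : chartMetric (𝓡 n) g x y = coordPullback (chartMetric (𝓡 n) g x₀) (e₀ ∘ e.symm) y :=
    pullback_eq_coordPullback g (contMDiffAt_extChartAt_symm hy.1) hy.2
  have h2 : e₀.symm ((e₀ ∘ e.symm) y) = e.symm y := e₀.left_inv hy.2
  rw [h1, h2, coordPullback, volumeDensity_bilinearComp, smul_eq_mul]
  ring

namespace IsRiemannianMetric

variable {g : S → EuclideanSpace ℝ (Fin n) →L[ℝ] EuclideanSpace ℝ (Fin n) →L[ℝ] ℝ}

theorem isParametrizationAt (hg : IsRiemannianMetric g) {x : S} {y : 𝔼}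
    (hy : y ∈ (extChartAt (𝓡 n) x).target) :
    IsParametrizationAt (𝓡 n) g (extChartAt (𝓡 n) x).symm y where
  eventually_contMDiffAt := by
    filter_upwards [(isOpen_extChartAt_target (I := 𝓡 n) x).mem_nhds hy] with z hz
    exact contMDiffAt_extChartAt_symm hz
  isInvertible := by
    have := isInvertible_mfderivWithin_extChartAt_symm (I := 𝓡 n) hy
    rwa [(𝓡 n).range_eq_univ, mfderivWithin_univ] at this
  isMetricAt := hg.isMetricAt _ _ (mem_extChartAt_target _)

theorem laplacian_eq (hg : IsRiemannianMetric g) {x : S} {y : 𝔼}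
    (hy : y ∈ (extChartAt (𝓡 n) x).target) {φ : S → ℝ} (hφ : ContMDiff (𝓡 n) 𝓘(ℝ, ℝ) ∞ φ) :
    laplacian (𝓡 n) g φ ((extChartAt (𝓡 n) x).symm y) = metricTrace (chartMetric (𝓡 n) g x y)
      (hessianCoord (chartMetric (𝓡 n) g x) (φ ∘ (extChartAt (𝓡 n) x).symm) y) :=
  ((hg.isParametrizationAt hy).laplacian_eq hφ.contMDiffAt).symm

theorem contDiffAt_comp_symm {φ : S → ℝ} (hφ : ContMDiff (𝓡 n) 𝓘(ℝ, ℝ) ∞ φ) {x : S} {y : 𝔼}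
    (hy : y ∈ (extChartAt (𝓡 n) x).target) :
    ContDiffAt ℝ 2 (φ ∘ (extChartAt (𝓡 n) x).symm) y :=
  (contMDiffAt_iff_contDiffAt.1 (hφ.contMDiffAt.comp y
    (contMDiffAt_extChartAt_symm hy))).of_le ENat.LEInfty.out

/-- The definition uses a different chart at each point; by invariance the values near `p` are all
computed in the chart at `p`, where continuity is visible. -/
theorem continuous_laplacian (hg : IsRiemannianMetric g) {φ : S → ℝ}
    (hφ : ContMDiff (𝓡 n) 𝓘(ℝ, ℝ) ∞ φ) : Continuous (laplacian (𝓡 n) g φ) := by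
  rw [continuous_iff_continuousAt]
  intro p
  set e := extChartAt (𝓡 n) p with he
  have hp := mem_extChartAt_target (I := 𝓡 n) p
  have h1 : ContinuousAt (fun y => metricTrace (chartMetric (𝓡 n) g p y)
      (hessianCoord (chartMetric (𝓡 n) g p) (φ ∘ e.symm) y)) (e p) :=
    continuousAt_metricTrace (hg.isMetricAt p _ hp).contDiffAt_sharp.continuousAt
      ((hg.isMetricAt p _ hp).continuousAt_hessianCoord (contDiffAt_comp_symm hφ hp))
  have h2 := ContinuousAt.comp (f := e) h1 (continuousAt_extChartAt p)
  refine h2.congr ?_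
  filter_upwards [(isOpen_extChartAt_source (I := 𝓡 n) p).mem_nhds (mem_extChartAt_source p)]
    with z hz
  have h3 := hg.laplacian_eq (e.map_source hz) hφ
  rw [e.left_inv hz] at h3
  exact h3.symm

theorem laplacian_add {φ ψ : S → ℝ}
    (hφ : ContMDiff (𝓡 n) 𝓘(ℝ, ℝ) ∞ φ) (hψ : ContMDiff (𝓡 n) 𝓘(ℝ, ℝ) ∞ ψ) :
    laplacian (𝓡 n) g (φ + ψ) = laplacian (𝓡 n) g φ + laplacian (𝓡 n) g ψ := by
  funext p
  have hp := mem_extChartAt_target (I := 𝓡 n) p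
  simp only [laplacian, hessian, Pi.add_apply]
  rw [show (φ + ψ) ∘ (extChartAt (𝓡 n) p).symm = φ ∘ (extChartAt (𝓡 n) p).symm +
    ψ ∘ (extChartAt (𝓡 n) p).symm from rfl, hessianCoord_add (contDiffAt_comp_symm hφ hp)
    (contDiffAt_comp_symm hψ hp), metricTrace_add]

theorem laplacian_eq_zero {φ : S → ℝ} {p : S} (hφ : φ =ᶠ[𝓝 p] 0) :
    laplacian (𝓡 n) g φ p = 0 := by
  have h1 : φ ∘ (extChartAt (𝓡 n) p).symm =ᶠ[𝓝 (extChartAt (𝓡 n) p p)] 0 := by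
    have hc := continuousAt_extChartAt_symm (I := 𝓡 n) p
    rw [ContinuousAt, (extChartAt (𝓡 n) p).left_inv (mem_extChartAt_source p)] at hc
    exact hc.eventually hφ
  rw [laplacian, hessian, hessianCoord_congr Filter.EventuallyEq.rfl h1, hessianCoord_zero]
  simp [metricTrace, raise]

theorem laplacian_sum {ι : Type*} (s : Finset ι) {φ : ι → S → ℝ}
    (hφ : ∀ i ∈ s, ContMDiff (𝓡 n) 𝓘(ℝ, ℝ) ∞ (φ i)) :
    laplacian (𝓡 n) g (∑ i ∈ s, φ i) = ∑ i ∈ s, laplacian (𝓡 n) g (φ i) := by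
  classical
  induction s using Finset.induction_on with
  | empty =>
    funext p
    simp only [Finset.sum_empty, Pi.zero_apply]
    exact laplacian_eq_zero Filter.EventuallyEq.rfl
  | insert i s his ih =>
    have h1 : ContMDiff (𝓡 n) 𝓘(ℝ, ℝ) ∞ (∑ j ∈ s, φ j) := by
      have := contMDiff_finsetSum (I := 𝓘(ℝ, ℝ)) (I' := 𝓡 n) (n := ∞) (t := s) (f := φ)
        fun j hj => hφ j (Finset.mem_insert_of_mem hj)
      convert this using 1
      funext p
      simp
    rw [Finset.sum_insert his, Finset.sum_insert his,
      laplacian_add (hφ i (Finset.mem_insert_self i s)) h1,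
      ih fun j hj => hφ j (Finset.mem_insert_of_mem hj)]

theorem continuousOn_volumeDensity (hg : IsRiemannianMetric g) (x : S) :
    ContinuousOn (fun y => volumeDensity (chartMetric (𝓡 n) g x y)) (extChartAt (𝓡 n) x).target :=
  fun y hy => (contDiffAt_volumeDensity (hg.isMetricAt x y hy).contDiffAt
    (hg.volumeDensity_pos x y hy)).continuousAt.continuousWithinAt

variable [T2Space S] [CompactSpace S]

/-- Supplies the compact set `K` required by the coordinate integration lemmas; compactness of `S`
enters here. -/
theorem isCompact_image_tsupport {ψ : S → ℝ} {x : S}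
    (hx : tsupport ψ ⊆ (extChartAt (𝓡 n) x).source) :
    IsCompact (extChartAt (𝓡 n) x '' tsupport ψ) ∧
      extChartAt (𝓡 n) x '' tsupport ψ ⊆ (extChartAt (𝓡 n) x).target ∧
      ∀ y ∈ (extChartAt (𝓡 n) x).target, y ∉ extChartAt (𝓡 n) x '' tsupport ψ →
        ψ ((extChartAt (𝓡 n) x).symm y) = 0 := by
  refine ⟨(isClosed_tsupport ψ).isCompact.image_of_continuousOn
    ((continuousOn_extChartAt x).mono hx), ?_, fun y hy hyK => ?_⟩
  · rintro _ ⟨p, hp, rfl⟩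
    exact (extChartAt (𝓡 n) x).map_source (hx hp)
  · by_contra h
    exact hyK ⟨_, subset_tsupport ψ h, (extChartAt (𝓡 n) x).right_inv hy⟩

theorem integrableOn_chart (hg : IsRiemannianMetric g) {ψ : S → ℝ} {x : S}
    (hψ : ContinuousOn ψ (extChartAt (𝓡 n) x).source)
    (hx : tsupport ψ ⊆ (extChartAt (𝓡 n) x).source) :
    IntegrableOn (fun y => ψ ((extChartAt (𝓡 n) x).symm y) *
      volumeDensity (chartMetric (𝓡 n) g x y)) (extChartAt (𝓡 n) x).target := by
  obtain ⟨hK, hKU, h0⟩ := isCompact_image_tsupport hx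
  refine integrableOn_of_compact (isOpen_extChartAt_target (I := 𝓡 n) x) hK hKU ?_ fun y hy hyK => by
    rw [h0 y hy hyK, zero_mul]
  exact (hψ.comp (continuousOn_extChartAt_symm x) fun y hy =>
    (extChartAt (𝓡 n) x).map_target hy).mul (hg.continuousOn_volumeDensity x)

variable (n S) in
theorem finite_chartPartition : {x : S | (Function.support (chartPartition n S x)).Nonempty}.Finite :=
  (chartPartition n S).locallyFinite.finite_nonempty_of_compact

variable (n S) in
/-- The finitely many indices with a nonzero function in the partition of unity. -/
def partitionIndices : Finset S := (finite_chartPartition n S).toFinset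

theorem chartPartition_eq_zero {x : S} (hx : x ∉ partitionIndices n S) (p : S) :
    chartPartition n S x p = 0 := by
  by_contra h
  exact hx ((finite_chartPartition n S).mem_toFinset.2 ⟨p, h⟩)

theorem sum_chartPartition (p : S) :
    ∑ x ∈ partitionIndices n S, chartPartition n S x p = 1 := by
  refine (chartPartition n S).sum_finsupport' (x₀ := p) (Set.mem_univ p) fun x hx => ?_
  rw [SmoothPartitionOfUnity.mem_finsupport] at hx
  exact (finite_chartPartition n S).mem_toFinset.2 ⟨p, hx⟩

theorem tsupport_chartPartition (x : S) :
    tsupport (chartPartition n S x) ⊆ (extChartAt (𝓡 n) x).source := by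
  rw [extChartAt_source]
  exact chartPartition_isSubordinate n S x

theorem tsupport_chartPartition_mul (x : S) (ψ : S → ℝ) :
    tsupport (fun p => chartPartition n S x p * ψ p) ⊆ (extChartAt (𝓡 n) x).source :=
  (tsupport_mul_subset_left (f := chartPartition n S x) (g := ψ)).trans (tsupport_chartPartition x)

theorem surfaceIntegral_eq_sum (g : S → 𝔼 →L[ℝ] 𝔼 →L[ℝ] ℝ) (ψ : S → ℝ) :
    surfaceIntegral g ψ = ∑ x ∈ partitionIndices n S,
      chartIntegral g x fun p => chartPartition n S x p * ψ p := by
  refine finsum_eq_sum_of_support_subset _ fun x hx => ?_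
  by_contra h
  refine hx ?_
  simp [chartPartition_eq_zero h]

theorem continuous_chartPartition (x : S) : Continuous (chartPartition n S x) :=
  (chartPartition n S x).contMDiff.continuous

theorem integrableOn_chartPartition (hg : IsRiemannianMetric g) {ψ : S → ℝ} (hψ : Continuous ψ)
    (x : S) : IntegrableOn (fun y => chartPartition n S x ((extChartAt (𝓡 n) x).symm y) *
      ψ ((extChartAt (𝓡 n) x).symm y) * volumeDensity (chartMetric (𝓡 n) g x y))
        (extChartAt (𝓡 n) x).target :=
  hg.integrableOn_chart (ψ := fun p => chartPartition n S x p * ψ p)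
    ((continuous_chartPartition x).mul hψ).continuousOn (tsupport_chartPartition_mul x ψ)

theorem surfaceIntegral_add (hg : IsRiemannianMetric g) {φ ψ : S → ℝ} (hφ : Continuous φ)
    (hψ : Continuous ψ) :
    surfaceIntegral g (fun p => φ p + ψ p) = surfaceIntegral g φ + surfaceIntegral g ψ := by
  rw [surfaceIntegral_eq_sum, surfaceIntegral_eq_sum, surfaceIntegral_eq_sum,
    ← Finset.sum_add_distrib]
  refine Finset.sum_congr rfl fun x _ => ?_
  rw [chartIntegral, chartIntegral, chartIntegral, ← integral_add
    (hg.integrableOn_chartPartition hφ x) (hg.integrableOn_chartPartition hψ x)]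
  congr 1
  funext y
  ring

theorem surfaceIntegral_neg (φ : S → ℝ) :
    surfaceIntegral g (fun p => -φ p) = -surfaceIntegral g φ := by
  rw [surfaceIntegral_eq_sum, surfaceIntegral_eq_sum, ← Finset.sum_neg_distrib]
  refine Finset.sum_congr rfl fun x _ => ?_
  rw [chartIntegral, chartIntegral, ← integral_neg]
  congr 1
  funext y
  ring

theorem surfaceIntegral_zero : surfaceIntegral g (fun _ : S => (0 : ℝ)) = 0 := by
  rw [surfaceIntegral_eq_sum]
  simp [chartIntegral]

theorem surfaceIntegral_sum (hg : IsRiemannianMetric g) {ι : Type*} (s : Finset ι) {φ : ι → S → ℝ}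
    (hφ : ∀ i ∈ s, Continuous (φ i)) :
    surfaceIntegral g (fun p => ∑ i ∈ s, φ i p) = ∑ i ∈ s, surfaceIntegral g (φ i) := by
  classical
  induction s using Finset.induction_on with
  | empty => simpa using surfaceIntegral_zero
  | insert i s his ih =>
    simp only [Finset.sum_insert his]
    rw [hg.surfaceIntegral_add (hφ i (Finset.mem_insert_self i s))
      (continuous_finsetSum s fun j hj => hφ j (Finset.mem_insert_of_mem hj)),
      ih fun j hj => hφ j (Finset.mem_insert_of_mem hj)]

/-- The integral of a function supported in a coordinate domain is computed in this domain. -/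
theorem surfaceIntegral_eq_chartIntegral (hg : IsRiemannianMetric g) {ψ : S → ℝ} {x₀ : S}
    (hψ : Continuous ψ) (hx₀ : tsupport ψ ⊆ (extChartAt (𝓡 n) x₀).source) :
    surfaceIntegral g ψ = chartIntegral g x₀ ψ := by
  have h1 : ∀ x, chartIntegral g x (fun p => chartPartition n S x p * ψ p) =
      chartIntegral g x₀ fun p => chartPartition n S x p * ψ p := fun x =>
    chartIntegral_eq_chartIntegral g ((subset_tsupport _).trans (tsupport_chartPartition_mul x ψ))
      ((subset_tsupport _).trans
        ((tsupport_mul_subset_right (f := chartPartition n S x) (g := ψ)).trans hx₀))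
  -- All pieces are moved to the chart at `x₀`; there the weights add up to `1`.
  rw [surfaceIntegral_eq_sum, Finset.sum_congr rfl fun x _ => h1 x]
  simp only [chartIntegral]
  rw [← integral_finsetSum]
  · congr 1
    funext y
    rw [← Finset.sum_mul, ← Finset.sum_mul, sum_chartPartition, one_mul]
  · intro x _
    exact hg.integrableOn_chart (ψ := fun p => chartPartition n S x p * ψ p)
      ((continuous_chartPartition x).mul hψ).continuousOn
      ((tsupport_mul_subset_right (f := chartPartition n S x) (g := ψ)).trans hx₀)

theorem surfaceIntegral_nonneg (hg : IsRiemannianMetric g) {ψ : S → ℝ} (h : ∀ p, 0 ≤ ψ p) :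
    0 ≤ surfaceIntegral g ψ := by
  rw [surfaceIntegral_eq_sum]
  refine Finset.sum_nonneg fun x _ => setIntegral_nonneg
    (isOpen_extChartAt_target (I := 𝓡 n) x).measurableSet fun y hy => ?_
  exact mul_nonneg (mul_nonneg ((chartPartition n S).nonneg x _) (h _))
    (hg.volumeDensity_pos x y hy).le

/-- A nonnegative continuous function with vanishing integral vanishes. -/
theorem eq_zero_of_surfaceIntegral_eq_zero (hg : IsRiemannianMetric g) {ψ : S → ℝ}
    (hψ : Continuous ψ) (h : ∀ p, 0 ≤ ψ p) (h0 : surfaceIntegral g ψ = 0) (p : S) : ψ p = 0 := by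
  obtain ⟨x, hx⟩ := (chartPartition n S).exists_pos_of_mem (Set.mem_univ p)
  have hnn : ∀ x, ∀ y ∈ (extChartAt (𝓡 n) x).target, 0 ≤
      chartPartition n S x ((extChartAt (𝓡 n) x).symm y) *
      ψ ((extChartAt (𝓡 n) x).symm y) * volumeDensity (chartMetric (𝓡 n) g x y) := fun x y hy =>
    mul_nonneg (mul_nonneg ((chartPartition n S).nonneg x _) (h _)) (hg.volumeDensity_pos x y hy).le
  have hxs : x ∈ partitionIndices n S := by
    by_contra hcon
    rw [chartPartition_eq_zero hcon] at hx
    exact lt_irrefl 0 hx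
  rw [surfaceIntegral_eq_sum] at h0
  have h1 := (Finset.sum_eq_zero_iff_of_nonneg fun x _ => setIntegral_nonneg
    (isOpen_extChartAt_target (I := 𝓡 n) x).measurableSet (hnn x)).1 h0 x hxs
  have hps : p ∈ (extChartAt (𝓡 n) x).source := tsupport_chartPartition x (subset_tsupport _ hx.ne')
  have hint := hg.integrableOn_chartPartition hψ x
  rw [setIntegral_eq_zero_iff_of_nonneg_ae (by
    filter_upwards [ae_restrict_mem (isOpen_extChartAt_target (I := 𝓡 n) x).measurableSet] with y hy
    exact hnn x y hy) hint] at h1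
  have hcont : ContinuousOn (fun y => chartPartition n S x ((extChartAt (𝓡 n) x).symm y) *
      ψ ((extChartAt (𝓡 n) x).symm y) * volumeDensity (chartMetric (𝓡 n) g x y)) (extChartAt (𝓡 n) x).target :=
    (((continuous_chartPartition x).mul hψ).comp_continuousOn
      (continuousOn_extChartAt_symm x)).mul (hg.continuousOn_volumeDensity x)
  -- A continuous function vanishing almost everywhere on an open set vanishes at each of its
  -- points.
  have h2 := Measure.eqOn_open_of_ae_eq h1 (isOpen_extChartAt_target (I := 𝓡 n) x) hcont continuousOn_const
  have h3 := h2 ((extChartAt (𝓡 n) x).map_source hps)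
  simp only [(extChartAt (𝓡 n) x).left_inv hps, Pi.zero_apply] at h3
  rcases mul_eq_zero.1 h3 with h4 | h4
  · rcases mul_eq_zero.1 h4 with h5 | h5
    · exact absurd h5 hx.ne'
    · exact h5
  · exact absurd h4 (hg.volumeDensity_pos x _ ((extChartAt (𝓡 n) x).map_source hps)).ne'

/-- Green's formula on a closed manifold. -/
theorem surfaceIntegral_green (hg : IsRiemannianMetric g) {φ v : S → ℝ}
    (hφ : ContMDiff (𝓡 n) 𝓘(ℝ, ℝ) ∞ φ) (hv : ContMDiff (𝓡 n) 𝓘(ℝ, ℝ) ∞ v) :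
    surfaceIntegral g (fun p => φ p * laplacian (𝓡 n) g v p - v p * laplacian (𝓡 n) g φ p) = 0 := by
  -- It suffices to localize `v`: the Green expression is linear in `v`, and its support is
  -- contained in that of `v`.
  let w : S → S → ℝ := fun x p => chartPartition n S x p * v p
  have hw : ∀ x, ContMDiff (𝓡 n) 𝓘(ℝ, ℝ) ∞ (w x) := fun x =>
    (chartPartition n S x).contMDiff.mul hv
  have hsum : ∑ x ∈ partitionIndices n S, w x = v := by
    funext p
    rw [Finset.sum_apply]
    simp only [w]
    rw [← Finset.sum_mul, sum_chartPartition, one_mul]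
  have h1 : ∀ p, φ p * laplacian (𝓡 n) g v p - v p * laplacian (𝓡 n) g φ p =
      ∑ x ∈ partitionIndices n S,
        (φ p * laplacian (𝓡 n) g (w x) p - w x p * laplacian (𝓡 n) g φ p) := by
    intro p
    rw [Finset.sum_sub_distrib, ← Finset.mul_sum, ← Finset.sum_mul]
    conv_lhs => rw [← hsum, laplacian_sum _ fun x _ => hw x]
    simp only [Finset.sum_apply]
  have hcont : ∀ x, Continuous fun p =>
      φ p * laplacian (𝓡 n) g (w x) p - w x p * laplacian (𝓡 n) g φ p := fun x =>
    (hφ.continuous.mul (hg.continuous_laplacian (hw x))).sub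
      ((hw x).continuous.mul (hg.continuous_laplacian hφ))
  simp only [h1]
  rw [hg.surfaceIntegral_sum _ fun x _ => hcont x]
  refine Finset.sum_eq_zero fun x _ => ?_
  have hts : tsupport (fun p => φ p * laplacian (𝓡 n) g (w x) p -
      w x p * laplacian (𝓡 n) g φ p) ⊆ tsupport (w x) := by
    refine closure_minimal (fun p hp => ?_) (isClosed_tsupport _)
    by_contra hcon
    have h2 : w x =ᶠ[𝓝 p] 0 := notMem_tsupport_iff_eventuallyEq.1 hcon
    refine hp ?_
    simp only
    rw [laplacian_eq_zero h2, h2.eq_of_nhds]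
    simp
  have hwx : tsupport (w x) ⊆ (extChartAt (𝓡 n) x).source := tsupport_chartPartition_mul x v
  rw [hg.surfaceIntegral_eq_chartIntegral (hcont x) (hts.trans hwx), chartIntegral]
  obtain ⟨hK, hKU, h0⟩ := isCompact_image_tsupport hwx
  rw [← integral_green_coord (isOpen_extChartAt_target (I := 𝓡 n) x) hK hKU (hg.isMetricAt x)
    (hg.volumeDensity_pos x) (fun y hy => contDiffAt_comp_symm hφ hy)
    (fun y hy => contDiffAt_comp_symm (hw x) hy) h0]
  refine setIntegral_congr_fun (isOpen_extChartAt_target (I := 𝓡 n) x).measurableSet fun y hy => ?_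
  rw [hg.laplacian_eq hy (hw x), hg.laplacian_eq hy hφ]
  rfl

end IsRiemannianMetric

end SurfaceIntegral

/-! ### Second fundamental form of a slice -/

section Hypersurface

variable {E : Type*} [NormedAddCommGroup E] [NormedSpace ℝ E]

theorem hasDerivAt_time {F : Type*} [NormedAddCommGroup F] [NormedSpace ℝ F] {A : ℝ × E → F}
    {t : ℝ} {z : E} (hA : DifferentiableAt ℝ A (t, z)) :
    HasDerivAt (fun s => A (s, z)) (fderiv ℝ A (t, z) (1, 0)) t := by
  have h1 : HasDerivAt (fun s : ℝ => (s, z)) ((1 : ℝ), (0 : E)) t :=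
    (hasDerivAt_id t).prodMk (hasDerivAt_const t z)
  exact hA.hasFDerivAt.comp_hasDerivAt t h1

variable [FiniteDimensional ℝ E]

theorem isInvertible_of_pos {B : E →L[ℝ] E →L[ℝ] ℝ} (h : ∀ u, u ≠ 0 → 0 < B u u) :
    B.IsInvertible :=
  isInvertible_of_injective fun u hu => by
    by_contra h0
    exact (h u h0).ne' (hu u)

/-- Metric families which correspond under a change of coordinates independent of time have
corresponding time derivatives. -/
theorem timeShape_of_bilinearComp {γ γ' : ℝ × E → E →L[ℝ] E →L[ℝ] ℝ} {t : ℝ} {z z' : E}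
    (hγ : IsMetricFamilyAt γ (t, z)) (hγ' : IsMetricFamilyAt γ' (t, z')) {A : E →L[ℝ] E}
    (hA : A.IsInvertible) (h : ∀ᶠ s in 𝓝 t, γ (s, z) = (γ' (s, z')).bilinearComp A A) (u : E) :
    A (timeShape γ (t, z) u) = timeShape γ' (t, z') (A u) := by
  -- `A` does not depend on time, so it passes through the time derivative.
  have hd : ∀ u v, fderiv ℝ γ (t, z) (1, 0) u v = fderiv ℝ γ' (t, z') (1, 0) (A u) (A v) := by
    intro u v
    have h1 := ((hasDerivAt_time hγ.differentiableAt).clm_apply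
      (hasDerivAt_const t u)).clm_apply (hasDerivAt_const t v)
    have h2 := ((hasDerivAt_time hγ'.differentiableAt).clm_apply
      (hasDerivAt_const t (A u))).clm_apply (hasDerivAt_const t (A v))
    have h3 : (fun s => γ (s, z) u v) =ᶠ[𝓝 t] fun s => γ' (s, z') (A u) (A v) := by
      filter_upwards [h] with s hs
      rw [hs]
      rfl
    have h4 := h1.unique (h2.congr_of_eventuallyEq h3)
    simpa using h4
  refine form_ext hγ'.invertible fun w => ?_
  obtain ⟨e, rfl⟩ := hA
  obtain ⟨v, rfl⟩ := e.surjective w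
  have h1 := hγ.apply_timeShape u v
  rw [hd, h.self_of_nhds, ← hγ'.apply_timeShape] at h1
  exact h1

theorem timeTrace_of_bilinearComp {γ γ' : ℝ × E → E →L[ℝ] E →L[ℝ] ℝ} {t : ℝ} {z z' : E}
    (hγ : IsMetricFamilyAt γ (t, z)) (hγ' : IsMetricFamilyAt γ' (t, z')) {A : E →L[ℝ] E}
    (hA : A.IsInvertible) (h : ∀ᶠ s in 𝓝 t, γ (s, z) = (γ' (s, z')).bilinearComp A A) :
    timeTrace γ (t, z) = timeTrace γ' (t, z') :=
  trace_eq_of_isInvertible hA _ _ fun u => timeShape_of_bilinearComp hγ hγ' hA h u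

theorem timeSqTrace_of_bilinearComp {γ γ' : ℝ × E → E →L[ℝ] E →L[ℝ] ℝ} {t : ℝ} {z z' : E}
    (hγ : IsMetricFamilyAt γ (t, z)) (hγ' : IsMetricFamilyAt γ' (t, z')) {A : E →L[ℝ] E}
    (hA : A.IsInvertible) (h : ∀ᶠ s in 𝓝 t, γ (s, z) = (γ' (s, z')).bilinearComp A A) :
    timeSqTrace γ (t, z) = timeSqTrace γ' (t, z') :=
  trace_eq_of_isInvertible hA _ _ fun u => by
    simp only [ContinuousLinearMap.coe_coe, ContinuousLinearMap.comp_apply]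
    rw [timeShape_of_bilinearComp hγ hγ' hA h, timeShape_of_bilinearComp hγ hγ' hA h]

variable {H : Type*} [TopologicalSpace H] {I : ModelWithCorners ℝ E H}
  {S : Type*} [TopologicalSpace S] [ChartedSpace H S]
  {E' : Type*} [NormedAddCommGroup E'] [NormedSpace ℝ E'] [FiniteDimensional ℝ E']
  {H' : Type*} [TopologicalSpace H'] {I' : ModelWithCorners ℝ E' H'} [I'.Boundaryless]
  {M' : Type*} [TopologicalSpace M'] [ChartedSpace H' M'] [IsManifold I' ∞ M']
  {g : M' → E' →L[ℝ] E' →L[ℝ] ℝ} {γ : ℝ × E → E →L[ℝ] E →L[ℝ] ℝ} {a : ℝ × E → ℝ}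
  {Y : ℝ × E → M'} {F : S → M'} {p : S} {t : ℝ} {ν : E'}

/-- `Y` parametrizes a neighbourhood of `F p` in such a way that `F` is its slice at time `t`,
the metric is `a² dt² + γ`, and `ν = a⁻¹ ∂_t` is the unit normal of the slice. -/
structure IsSliceAt (I : ModelWithCorners ℝ E H) (I' : ModelWithCorners ℝ E' H')
    (g : M' → E' →L[ℝ] E' →L[ℝ] ℝ) (F : S → M') (p : S) (ν : E') (Y : ℝ × E → M')
    (a : ℝ × E → ℝ) (γ : ℝ × E → E →L[ℝ] E →L[ℝ] ℝ) (t : ℝ) : Prop where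
  isParametrizationAt : IsParametrizationAt I' g Y (t, extChartAt I p p)
  pullback_eq : pullback 𝓘(ℝ, ℝ × E) I' g Y =ᶠ[𝓝 (t, extChartAt I p p)] warpedForm a γ
  isMetricFamilyAt : IsMetricFamilyAt γ (t, extChartAt I p p)
  contDiffAt : ContDiffAt ℝ 2 a (t, extChartAt I p p)
  ne_zero : a (t, extChartAt I p p) ≠ 0
  slice : ∀ z, F ((extChartAt I p).symm z) = Y (t, z)
  normal : differential 𝓘(ℝ, ℝ × E) I' Y (t, extChartAt I p p) (1, 0) =
    a (t, extChartAt I p p) • ν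
  induced : pullback I I' g F p = γ (t, extChartAt I p p)

namespace IsSliceAt

/-- By the transformation rule for Christoffel symbols, `D²F + Γ(dF, dF)` is the image under `dY` of
the Christoffel symbols of `a² dt² + γ`. Pairing with `ν = a⁻¹ ∂_t` picks out their time component
`-½ a⁻² ∂_t γ`. -/
theorem secondFundamentalForm_eq (h : IsSliceAt I I' g F p ν Y a γ t) :
    secondFundamentalForm I I' g F p ν = (1 / 2 * (a (t, extChartAt I p p))⁻¹) •
      fderiv ℝ γ (t, extChartAt I p p) (1, 0) := by
  set q : ℝ × E := (t, extChartAt I p p) with hq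
  have ha0 : a q ≠ 0 := h.ne_zero
  have hγ : IsMetricFamilyAt γ q := h.isMetricFamilyAt
  have hpe : pullback 𝓘(ℝ, ℝ × E) I' g Y =ᶠ[𝓝 q] warpedForm a γ := h.pullback_eq
  have hFp : F p = Y q := by
    rw [hq, ← h.slice, (extChartAt I p).left_inv (mem_extChartAt_source p)]
  set Φ : ℝ × E → E' := extChartAt I' (Y q) ∘ Y with hΦ
  have hΦc : ContDiffAt ℝ ∞ Φ q := h.isParametrizationAt.contDiffAt
  have hdY : differential 𝓘(ℝ, ℝ × E) I' Y q = fderiv ℝ Φ q := h.isParametrizationAt.differential_eq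
  have hW : writtenInExtChartAt I I' p F = fun z => Φ (t, z) := by
    funext z
    simp only [writtenInExtChartAt, Function.comp_apply, h.slice, hFp, hΦ]
  have h2 : ContDiffAt ℝ 1 (fderiv ℝ Φ) q := (hΦc.of_le (m := 2) ENat.LEInfty.out).fderiv_right (m := 1)
    (by norm_num)
  have hD1 : ∀ u, fderiv ℝ (fun z => Φ (t, z)) (extChartAt I p p) u = fderiv ℝ Φ q (0, u) :=
    fun u => fderiv_slice (A := Φ) (q := q) (hΦc.differentiableAt (by simp)) u
  have hD2 : ∀ u v, fderiv ℝ (fderiv ℝ fun z => Φ (t, z)) (extChartAt I p p) u v =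
      fderiv ℝ (fderiv ℝ Φ) q (0, u) (0, v) := by
    intro u v
    have h3 : fderiv ℝ (fun z => Φ (t, z)) =ᶠ[𝓝 (extChartAt I p p)]
        fun z => (fderiv ℝ Φ (t, z)).comp (ContinuousLinearMap.inr ℝ ℝ E) := by
      have hc : ContinuousAt (fun z : E => (t, z)) (extChartAt I p p) := by fun_prop
      filter_upwards [hc.eventually ((hΦc.of_le (m := 1) (ENat.LEInfty.out)).eventually
        (by simp))] with z hz
      exact (hasFDerivAt_slice (A := Φ) (q := (t, z)) (hz.differentiableAt (by simp))).fderiv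
    have h4 := (((ContinuousLinearMap.compL ℝ E (ℝ × E) E').flip
      (ContinuousLinearMap.inr ℝ ℝ E)).hasFDerivAt.comp (extChartAt I p p)
        (hasFDerivAt_slice (A := fderiv ℝ Φ) (q := q) (h2.differentiableAt (by simp)))).fderiv
    rw [h3.fderiv_eq]
    exact (congrArg (fun L => L u v) h4).trans rfl
  ext u v
  have hdef : secondFundamentalForm I I' g F p ν u v =
      -(g (F p) (fderiv ℝ (fderiv ℝ (writtenInExtChartAt I I' p F)) (extChartAt I p p) u v +
        christoffel (chartMetric I' g (F p)) (extChartAt I' (F p) (F p))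
          (fderiv ℝ (writtenInExtChartAt I I' p F) (extChartAt I p p) u)
          (fderiv ℝ (writtenInExtChartAt I I' p F) (extChartAt I p p) v)) ν) := rfl
  have hΓ := christoffel_coordPullback (G := chartMetric I' g (Y q)) (Φ := Φ) (y := q)
    h.isParametrizationAt.isMetricAt (hΦc.of_le (ENat.LEInfty.out))
    (hdY ▸ h.isParametrizationAt.isInvertible) (0, u) (0, v)
  rw [christoffel_congr (h.isParametrizationAt.pullback_eventuallyEq.symm.trans hpe),
    ← hdY] at hΓ
  have hν : ν = (a q)⁻¹ • differential 𝓘(ℝ, ℝ × E) I' Y q (1, 0) := by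
    rw [h.normal, smul_smul, inv_mul_cancel₀ ha0, one_smul]
  -- The pullback has no mixed terms, so pairing with `∂_t` sees the time component alone.
  have hp : ∀ c, g (Y q) (differential 𝓘(ℝ, ℝ × E) I' Y q c)
      (differential 𝓘(ℝ, ℝ × E) I' Y q (1, 0)) = a q ^ 2 * c.1 := by
    intro c
    rw [← pullback_apply, hpe.self_of_nhds, warpedForm_apply]
    simp only [map_zero, mul_one, add_zero]
  rw [hdef, hW, hFp, hD1, hD1, hD2, ← hdY, add_comm]
  have hΓ' : christoffel (chartMetric I' g (Y q)) (extChartAt I' (Y q) (Y q))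
      (differential 𝓘(ℝ, ℝ × E) I' Y q (0, u)) (differential 𝓘(ℝ, ℝ × E) I' Y q (0, v)) +
        fderiv ℝ (fderiv ℝ Φ) q (0, u) (0, v) = _ := hΓ.symm
  rw [hΓ', hν, map_smul, hp, christoffel_warpedForm hγ h.contDiffAt ha0]
  simp only [_root_.smul_apply, smul_eq_mul]
  field_simp
  ring

theorem shapeOperator_eq (h : IsSliceAt I I' g F p ν Y a γ t) :
    shapeOperator I I' g F p ν = (a (t, extChartAt I p p))⁻¹ •
      (timeShape γ (t, extChartAt I p p) : E →ₗ[ℝ] E) := by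
  ext u
  simp only [shapeOperator, h.secondFundamentalForm_eq, h.induced, raise, timeShape,
    ContinuousLinearMap.coe_coe, ContinuousLinearMap.comp_apply, _root_.smul_apply, map_smul,
    LinearMap.smul_apply, smul_smul]
  rw [mul_comm]

theorem meanCurvature_eq (h : IsSliceAt I I' g F p ν Y a γ t) :
    meanCurvature I I' g F p ν =
      (a (t, extChartAt I p p))⁻¹ * timeTrace γ (t, extChartAt I p p) := by
  rw [meanCurvature, h.shapeOperator_eq, map_smul, smul_eq_mul, timeTrace]

/-- The shape operator is self-adjoint for the positive form `γ`, so its symmetric functions are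
given by traces. -/
theorem sigma_eq (h : IsSliceAt I I' g F p ν Y a γ t)
    (hpos : ∀ u, u ≠ 0 → 0 < γ (t, extChartAt I p p) u u) :
    sigma I I' 1 g F p ν = (a (t, extChartAt I p p))⁻¹ * timeTrace γ (t, extChartAt I p p) ∧
      sigma I I' 2 g F p ν = (a (t, extChartAt I p p))⁻¹ ^ 2 *
        (timeTrace γ (t, extChartAt I p p) ^ 2 - timeSqTrace γ (t, extChartAt I p p)) / 2 := by
  set q : ℝ × E := (t, extChartAt I p p) with hq
  obtain ⟨h1, h2⟩ := esymm_roots_charpoly (fun u v => γ q u v) h.isMetricFamilyAt.symm_apply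
    (fun u v w => by simp) (fun c u v => by simp) hpos (shapeOperator I I' g F p ν)
    (fun u v => by
      rw [h.shapeOperator_eq]
      simp only [LinearMap.smul_apply, map_smul, _root_.smul_apply]
      exact congrArg _ (h.isMetricFamilyAt.timeShape_symm u v))
  refine ⟨h1.trans ?_, h2.trans ?_⟩
  · rw [h.shapeOperator_eq, map_smul, smul_eq_mul, timeTrace]
  · rw [h.shapeOperator_eq, LinearMap.smul_comp, LinearMap.comp_smul, map_smul, map_smul, map_smul,
      timeTrace, timeSqTrace]
    simp only [smul_eq_mul]
    rw [show ((timeShape γ q).comp (timeShape γ q) : E →ₗ[ℝ] E) =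
      (timeShape γ q : E →ₗ[ℝ] E) ∘ₗ (timeShape γ q : E →ₗ[ℝ] E) from rfl]
    ring

end IsSliceAt

end Hypersurface

/-! ### The swept region and its metric -/

section NormalFlow

variable {n : ℕ}
  {M : Type*} [TopologicalSpace M] [ChartedSpace (EuclideanSpace ℝ (Fin (n + 1))) M]
  {S : Type*} [TopologicalSpace S] [ChartedSpace (EuclideanSpace ℝ (Fin n)) S]

local notation "𝔼" => EuclideanSpace ℝ (Fin n)

local notation "𝔽" => EuclideanSpace ℝ (Fin (n + 1))

/-- The local parametrization of `ℝ × S` given by the chart of `S` at `x`. -/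
def flowChart (x : S) (q : ℝ × EuclideanSpace ℝ (Fin n)) : ℝ × S :=
  (q.1, (extChartAt (𝓡 n) x).symm q.2)

/-- The family of induced metrics `g_t` in the chart of `S` at `x`. -/
def flowMetric (g : M → EuclideanSpace ℝ (Fin (n + 1)) →L[ℝ] EuclideanSpace ℝ (Fin (n + 1)) →L[ℝ] ℝ)
    (X : ℝ × S → M) (x : S) (q : ℝ × EuclideanSpace ℝ (Fin n)) :
    EuclideanSpace ℝ (Fin n) →L[ℝ] EuclideanSpace ℝ (Fin n) →L[ℝ] ℝ :=
  chartMetric (𝓡 n) (inducedMetric g X q.1) x q.2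

/-- The normal field, with values in the model space. -/
def normalVector {X : ℝ × S → M} (ν : ∀ q : ℝ × S, TangentSpace (𝓡 (n + 1)) (X q)) (q : ℝ × S) :
    EuclideanSpace ℝ (Fin (n + 1)) :=
  ν q

variable [IsManifold (𝓡 n) ∞ S]

theorem isInvertible_differential_symm {x : S} {y : EuclideanSpace ℝ (Fin n)}
    (hy : y ∈ (extChartAt (𝓡 n) x).target) :
    (differential 𝓘(ℝ, 𝔼) (𝓡 n) (extChartAt (𝓡 n) x).symm y).IsInvertible := by
  have := isInvertible_mfderivWithin_extChartAt_symm (I := 𝓡 n) hy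
  rwa [(𝓡 n).range_eq_univ, mfderivWithin_univ] at this

theorem contMDiffAt_flowChart {x : S} {q : ℝ × EuclideanSpace ℝ (Fin n)}
    (hq : q.2 ∈ (extChartAt (𝓡 n) x).target) :
    ContMDiffAt 𝓘(ℝ, ℝ × 𝔼) (𝓘(ℝ, ℝ).prod (𝓡 n)) ∞ (flowChart x) q :=
  ContMDiffAt.prodMk contDiffAt_fst.contMDiffAt
    ((contMDiffAt_extChartAt_symm hq).comp q contDiffAt_snd.contMDiffAt)

theorem differential_flowChart {x : S} {q : ℝ × EuclideanSpace ℝ (Fin n)}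
    (hq : q.2 ∈ (extChartAt (𝓡 n) x).target) :
    differential 𝓘(ℝ, ℝ × 𝔼) (𝓘(ℝ, ℝ).prod (𝓡 n)) (flowChart x) q =
      (ContinuousLinearMap.id ℝ ℝ).prodMap
        (differential 𝓘(ℝ, 𝔼) (𝓡 n) (extChartAt (𝓡 n) x).symm q.2) := by
  have h1 : MDifferentiableAt 𝓘(ℝ, ℝ × 𝔼) 𝓘(ℝ, ℝ) (Prod.fst : ℝ × 𝔼 → ℝ) q :=
    differentiableAt_fst.mdifferentiableAt
  have h2 : MDifferentiableAt 𝓘(ℝ, ℝ × 𝔼) 𝓘(ℝ, 𝔼) (Prod.snd : ℝ × 𝔼 → 𝔼) q :=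
    differentiableAt_snd.mdifferentiableAt
  have h3 := mdifferentiableAt_extChartAt_symm (I := 𝓡 n) hq
  have h4 := h1.mfderiv_prod (h3.comp q h2)
  refine h4.trans ?_
  have h5 := differential_comp h3 h2
  have h6 : mfderiv 𝓘(ℝ, ℝ × 𝔼) 𝓘(ℝ, ℝ) (Prod.fst : ℝ × 𝔼 → ℝ) q =
      ContinuousLinearMap.fst ℝ ℝ 𝔼 := by
    rw [mfderiv_eq_fderiv]
    exact fderiv_fst
  have h7 : differential 𝓘(ℝ, ℝ × 𝔼) 𝓘(ℝ, 𝔼) (Prod.snd : ℝ × 𝔼 → 𝔼) q =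
      ContinuousLinearMap.snd ℝ ℝ 𝔼 := by
    rw [differential_eq_fderiv]
    exact fderiv_snd
  rw [h7] at h5
  rw [h6]
  exact congrArg _ h5

theorem isInvertible_differential_flowChart {x : S} {q : ℝ × EuclideanSpace ℝ (Fin n)}
    (hq : q.2 ∈ (extChartAt (𝓡 n) x).target) :
    (differential 𝓘(ℝ, ℝ × 𝔼) (𝓘(ℝ, ℝ).prod (𝓡 n)) (flowChart x) q).IsInvertible := by
  rw [differential_flowChart hq]
  obtain ⟨e, he⟩ := isInvertible_differential_symm hq
  exact ⟨(ContinuousLinearEquiv.refl ℝ ℝ).prodCongr e, by rw [← he]; rfl⟩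

theorem pullback_warpedMetric
    (g : M → EuclideanSpace ℝ (Fin (n + 1)) →L[ℝ] EuclideanSpace ℝ (Fin (n + 1)) →L[ℝ] ℝ)
    (X : ℝ × S → M) (a : ℝ × S → ℝ) {x : S} {q : ℝ × EuclideanSpace ℝ (Fin n)}
    (hq : q.2 ∈ (extChartAt (𝓡 n) x).target) :
    pullback 𝓘(ℝ, ℝ × 𝔼) (𝓘(ℝ, ℝ).prod (𝓡 n)) (warpedMetric g X a) (flowChart x) q =
      warpedForm (a ∘ flowChart x) (flowMetric g X x) q := by
  refine ContinuousLinearMap.ext fun u => ContinuousLinearMap.ext fun v => ?_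
  rw [pullback_apply, differential_flowChart hq, warpedForm_apply]
  rfl

/-- The passage between the metric families of two charts. -/
theorem flowMetric_eq_bilinearComp
    (g : M → EuclideanSpace ℝ (Fin (n + 1)) →L[ℝ] EuclideanSpace ℝ (Fin (n + 1)) →L[ℝ] ℝ)
    (X : ℝ × S → M) {x : S} {z : EuclideanSpace ℝ (Fin n)}
    (hz : z ∈ (extChartAt (𝓡 n) x).target) (s : ℝ) :
    flowMetric g X x (s, z) =
      (flowMetric g X ((extChartAt (𝓡 n) x).symm z) (s, extChartAt (𝓡 n)
        ((extChartAt (𝓡 n) x).symm z) ((extChartAt (𝓡 n) x).symm z))).bilinearComp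
        (differential 𝓘(ℝ, 𝔼) (𝓡 n) (extChartAt (𝓡 n) x).symm z)
        (differential 𝓘(ℝ, 𝔼) (𝓡 n) (extChartAt (𝓡 n) x).symm z) := by
  rw [differential_eq_fderiv_extChartAt (mdifferentiableAt_extChartAt_symm hz)]
  exact pullback_eq_coordPullback (inducedMetric g X s) (contMDiffAt_extChartAt_symm hz)
    (mem_extChartAt_source _)

theorem contDiffAt_comp_flowChart {J : Set ℝ} (hJ : IsOpen J) {a : ℝ × S → ℝ}
    (ha : ContMDiffOn (𝓘(ℝ, ℝ).prod (𝓡 n)) 𝓘(ℝ, ℝ) ∞ a (J ×ˢ Set.univ)) {x : S}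
    {q : ℝ × EuclideanSpace ℝ (Fin n)} (hq1 : q.1 ∈ J) (hq2 : q.2 ∈ (extChartAt (𝓡 n) x).target) :
    ContDiffAt ℝ ∞ (a ∘ flowChart x) q := by
  rw [← contMDiffAt_iff_contDiffAt]
  exact (ha.contMDiffAt ((hJ.prod isOpen_univ).mem_nhds ⟨hq1, Set.mem_univ _⟩)).comp q
    (contMDiffAt_flowChart hq2)

theorem contMDiff_slice {J : Set ℝ} (hJ : IsOpen J) {a : ℝ × S → ℝ}
    (ha : ContMDiffOn (𝓘(ℝ, ℝ).prod (𝓡 n)) 𝓘(ℝ, ℝ) ∞ a (J ×ˢ Set.univ)) {t : ℝ} (ht : t ∈ J) :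
    ContMDiff (𝓡 n) 𝓘(ℝ, ℝ) ∞ fun p => a (t, p) := fun p =>
  ContMDiffAt.comp (f := fun p : S => (t, p)) p
    (ha.contMDiffAt ((hJ.prod isOpen_univ).mem_nhds ⟨ht, Set.mem_univ _⟩))
    (contMDiffAt_const.prodMk contMDiffAt_id)

theorem eventually_mem_flowDomain {J : Set ℝ} (hJ : IsOpen J) {x : S}
    {q : ℝ × EuclideanSpace ℝ (Fin n)} (hq1 : q.1 ∈ J) (hq2 : q.2 ∈ (extChartAt (𝓡 n) x).target) :
    ∀ᶠ r in 𝓝 q, r.1 ∈ J ∧ r.2 ∈ (extChartAt (𝓡 n) x).target :=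
  (hJ.prod (isOpen_extChartAt_target (I := 𝓡 n) x)).mem_nhds ⟨hq1, hq2⟩

variable [IsManifold (𝓡 (n + 1)) ∞ M]
  {gbar : Bundle.ContMDiffRiemannianMetric (𝓡 (n + 1)) ∞ (EuclideanSpace ℝ (Fin (n + 1)))
      (fun x : M => TangentSpace (𝓡 (n + 1)) x)}
  {J : Set ℝ} {X : ℝ × S → M} {ν : ∀ q : ℝ × S, TangentSpace (𝓡 (n + 1)) (X q)} {f : ℝ × S → ℝ}

namespace IsNormalFlow

theorem contMDiffAt (hX : IsNormalFlow (metricForm gbar) J X ν f) (hJ : IsOpen J) {q : ℝ × S}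
    (hq : q.1 ∈ J) : ContMDiffAt (𝓘(ℝ, ℝ).prod (𝓡 n)) (𝓡 (n + 1)) ∞ X q :=
  hX.smooth.contMDiffAt ((hJ.prod isOpen_univ).mem_nhds ⟨hq, Set.mem_univ _⟩)

theorem differential_apply (hX : IsNormalFlow (metricForm gbar) J X ν f) (hJ : IsOpen J) {t : ℝ}
    (ht : t ∈ J) (p : S) (w : ℝ × EuclideanSpace ℝ (Fin n)) :
    differential (𝓘(ℝ, ℝ).prod (𝓡 n)) (𝓡 (n + 1)) X (t, p) w =
      (w.1 * f (t, p)) • normalVector ν (t, p) +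
        differential (𝓡 n) (𝓡 (n + 1)) (fun p' => X (t, p')) p w.2 := by
  have h1 := mfderiv_prod_eq_add_apply (p := (t, p)) (v := w)
    ((hX.contMDiffAt hJ (q := (t, p)) ht).mdifferentiableAt (by simp))
  refine h1.trans ?_
  congr 1
  have h2 : differential 𝓘(ℝ, ℝ) (𝓡 (n + 1)) (fun s : ℝ => X (s, p)) t 1 =
      f (t, p) • normalVector ν (t, p) := hX.flow t ht p
  have h3 : differential 𝓘(ℝ, ℝ) (𝓡 (n + 1)) (fun s : ℝ => X (s, p)) t w.1 =
      w.1 • differential 𝓘(ℝ, ℝ) (𝓡 (n + 1)) (fun s : ℝ => X (s, p)) t 1 := by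
    rw [← map_smul, smul_eq_mul, mul_one]
  refine h3.trans ?_
  rw [h2, mul_smul]

/-- Since `∂_t X = f ν` with `ν` a unit normal, the time part has squared length `f²` and the mixed
terms vanish. -/
theorem pullback_eq_warpedMetric (hX : IsNormalFlow (metricForm gbar) J X ν f) (hJ : IsOpen J)
    {t : ℝ} (ht : t ∈ J) (p : S) :
    pullback (𝓘(ℝ, ℝ).prod (𝓡 n)) (𝓡 (n + 1)) (metricForm gbar) X (t, p) =
      warpedMetric (metricForm gbar) X f (t, p) := by
  refine ContinuousLinearMap.ext fun u => ContinuousLinearMap.ext fun v => ?_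
  have h1 : metricForm gbar (X (t, p)) (normalVector ν (t, p)) (normalVector ν (t, p)) = 1 := hX.unit t ht p
  have h2 : ∀ w, metricForm gbar (X (t, p))
      (differential (𝓡 n) (𝓡 (n + 1)) (fun p' => X (t, p')) p w) (normalVector ν (t, p)) = 0 :=
    hX.normal t ht p
  have h3 : ∀ w, metricForm gbar (X (t, p)) (normalVector ν (t, p))
      (differential (𝓡 n) (𝓡 (n + 1)) (fun p' => X (t, p')) p w) = 0 := fun w =>
    (gbar.symm _ _ _).trans (h2 w)
  rw [pullback_apply, hX.differential_apply hJ ht, hX.differential_apply hJ ht]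
  have h4 : warpedMetric (metricForm gbar) X f (t, p) u v = f (t, p) ^ 2 * (u.1 * v.1) +
      metricForm gbar (X (t, p)) (differential (𝓡 n) (𝓡 (n + 1)) (fun p' => X (t, p')) p u.2)
        (differential (𝓡 n) (𝓡 (n + 1)) (fun p' => X (t, p')) p v.2) := rfl
  rw [h4]
  simp only [map_add, map_smul, _root_.add_apply, _root_.smul_apply, smul_eq_mul]
  rw [h1, h2, h3]
  ring

theorem pullback_chart (hX : IsNormalFlow (metricForm gbar) J X ν f) (hJ : IsOpen J) {x : S}
    {q : ℝ × EuclideanSpace ℝ (Fin n)} (hq1 : q.1 ∈ J) (hq2 : q.2 ∈ (extChartAt (𝓡 n) x).target) :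
    pullback 𝓘(ℝ, ℝ × 𝔼) (𝓡 (n + 1)) (metricForm gbar) (X ∘ flowChart x) q =
      warpedForm (f ∘ flowChart x) (flowMetric (metricForm gbar) X x) q := by
  rw [pullback_comp (metricForm gbar) (I' := 𝓘(ℝ, ℝ).prod (𝓡 n))
    ((hX.contMDiffAt hJ (q := flowChart x q) hq1).mdifferentiableAt (by simp))
    ((contMDiffAt_flowChart hq2).mdifferentiableAt (by simp)), ← pullback_warpedMetric _ _ _ hq2]
  refine ContinuousLinearMap.ext fun u => ContinuousLinearMap.ext fun v => ?_
  have : pullback (𝓘(ℝ, ℝ).prod (𝓡 n)) (𝓡 (n + 1)) (metricForm gbar) X (flowChart x q) =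
    warpedMetric (metricForm gbar) X f (flowChart x q) := hX.pullback_eq_warpedMetric hJ hq1 _
  exact congrArg (fun B : (ℝ × 𝔼) →L[ℝ] (ℝ × 𝔼) →L[ℝ] ℝ =>
    B (differential 𝓘(ℝ, ℝ × 𝔼) (𝓘(ℝ, ℝ).prod (𝓡 n)) (flowChart x) q u)
      (differential 𝓘(ℝ, ℝ × 𝔼) (𝓘(ℝ, ℝ).prod (𝓡 n)) (flowChart x) q v)) this

theorem contMDiffAt_chart (hX : IsNormalFlow (metricForm gbar) J X ν f) (hJ : IsOpen J) {x : S}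
    {q : ℝ × EuclideanSpace ℝ (Fin n)} (hq1 : q.1 ∈ J) (hq2 : q.2 ∈ (extChartAt (𝓡 n) x).target) :
    ContMDiffAt 𝓘(ℝ, ℝ × 𝔼) (𝓡 (n + 1)) ∞ (X ∘ flowChart x) q :=
  (hX.contMDiffAt hJ (q := flowChart x q) hq1).comp q (contMDiffAt_flowChart hq2)

/-- Smoothness jointly in `(t, z)`, obtained by restricting the pullback under the whole flow map to
slice directions rather than by treating each time separately. -/
theorem contDiffAt_flowMetric (hX : IsNormalFlow (metricForm gbar) J X ν f) (hJ : IsOpen J) {x : S}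
    {q : ℝ × EuclideanSpace ℝ (Fin n)} (hq1 : q.1 ∈ J) (hq2 : q.2 ∈ (extChartAt (𝓡 n) x).target) :
    ContDiffAt ℝ ∞ (flowMetric (metricForm gbar) X x) q := by
  have h1 := contDiffAt_pullback_metricForm gbar (hX.contMDiffAt_chart hJ hq1 hq2)
  have h2 := h1.bilinearComp (contDiffAt_const (c := ContinuousLinearMap.inr ℝ ℝ 𝔼))
  refine h2.congr_of_eventuallyEq ?_
  filter_upwards [eventually_mem_flowDomain hJ hq1 hq2] with r hr
  rw [hX.pullback_chart hJ hr.1 hr.2]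
  refine ContinuousLinearMap.ext fun u => ContinuousLinearMap.ext fun v => ?_
  simp [warpedForm_apply]


theorem flowMetric_symm (g : Bundle.ContMDiffRiemannianMetric (𝓡 (n + 1)) ∞
      (EuclideanSpace ℝ (Fin (n + 1))) (fun x : M => TangentSpace (𝓡 (n + 1)) x))
    (X : ℝ × S → M) (x : S) (q : ℝ × EuclideanSpace ℝ (Fin n)) (u v : EuclideanSpace ℝ (Fin n)) :
    flowMetric (metricForm g) X x q u v = flowMetric (metricForm g) X x q v u :=
  g.symm _ _ _

/-- Positivity uses that each slice is immersed and that the chart differential is invertible. -/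
theorem flowMetric_pos (hX : IsNormalFlow (metricForm gbar) J X ν f) {x : S}
    {q : ℝ × EuclideanSpace ℝ (Fin n)} (hq1 : q.1 ∈ J) (hq2 : q.2 ∈ (extChartAt (𝓡 n) x).target)
    {u : EuclideanSpace ℝ (Fin n)} (hu : u ≠ 0) : 0 < flowMetric (metricForm gbar) X x q u u := by
  refine gbar.pos _ _ fun h => hu ?_
  have h1 : differential 𝓘(ℝ, 𝔼) (𝓡 n) (extChartAt (𝓡 n) x).symm q.2 u = 0 :=
    hX.immersion _ hq1 _ (h.trans (map_zero _).symm)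
  exact (isInvertible_differential_symm hq2).injective (h1.trans (map_zero _).symm)

theorem isMetricFamilyAt (hX : IsNormalFlow (metricForm gbar) J X ν f) (hJ : IsOpen J) {x : S}
    {q : ℝ × EuclideanSpace ℝ (Fin n)} (hq1 : q.1 ∈ J) (hq2 : q.2 ∈ (extChartAt (𝓡 n) x).target) :
    IsMetricFamilyAt (flowMetric (metricForm gbar) X x) q where
  contDiffAt := (hX.contDiffAt_flowMetric hJ hq1 hq2).of_le ENat.LEInfty.out
  symm := Filter.Eventually.of_forall fun r u v => flowMetric_symm gbar X x r u v
  invertible := isInvertible_of_pos fun _ hu => hX.flowMetric_pos hq1 hq2 hu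

end IsNormalFlow

end NormalFlow

/-! ### Curvature quantities of the flow in chart coordinates -/

section NormalFlowCurvature

variable {n : ℕ}
  {M : Type*} [TopologicalSpace M] [ChartedSpace (EuclideanSpace ℝ (Fin (n + 1))) M]
  [IsManifold (𝓡 (n + 1)) ∞ M]
  {S : Type*} [TopologicalSpace S] [ChartedSpace (EuclideanSpace ℝ (Fin n)) S]
  [IsManifold (𝓡 n) ∞ S]
  {gbar : Bundle.ContMDiffRiemannianMetric (𝓡 (n + 1)) ∞ (EuclideanSpace ℝ (Fin (n + 1)))
      (fun x : M => TangentSpace (𝓡 (n + 1)) x)}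
  {J : Set ℝ} {X : ℝ × S → M} {ν : ∀ q : ℝ × S, TangentSpace (𝓡 (n + 1)) (X q)} {f : ℝ × S → ℝ}

local notation "𝔼" => EuclideanSpace ℝ (Fin n)

local notation "𝔽" => EuclideanSpace ℝ (Fin (n + 1))

theorem metricForm_symm
    (g : Bundle.ContMDiffRiemannianMetric (𝓡 (n + 1)) ∞ (EuclideanSpace ℝ (Fin (n + 1)))
      (fun x : M => TangentSpace (𝓡 (n + 1)) x)) (x : M) (u v : EuclideanSpace ℝ (Fin (n + 1))) :
    metricForm g x u v = metricForm g x v u :=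
  g.symm x u v

theorem metricForm_pos
    (g : Bundle.ContMDiffRiemannianMetric (𝓡 (n + 1)) ∞ (EuclideanSpace ℝ (Fin (n + 1)))
      (fun x : M => TangentSpace (𝓡 (n + 1)) x)) {x : M} {u : EuclideanSpace ℝ (Fin (n + 1))}
    (hu : u ≠ 0) : 0 < metricForm g x u u :=
  g.pos x u hu

theorem isMetricAt_metricForm
    (g : Bundle.ContMDiffRiemannianMetric (𝓡 (n + 1)) ∞ (EuclideanSpace ℝ (Fin (n + 1)))
      (fun x : M => TangentSpace (𝓡 (n + 1)) x)) {x : M} {y : EuclideanSpace ℝ (Fin (n + 1))}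
    (hy : y ∈ (extChartAt (𝓡 (n + 1)) x).target) :
    IsMetricAt (chartMetric (𝓡 (n + 1)) (metricForm g) x) y where
  contDiffAt := (contDiffAt_pullback_metricForm g (contMDiffAt_extChartAt_symm hy)).of_le
    ENat.LEInfty.out
  symm := Filter.Eventually.of_forall fun z u v => by
    rw [chartMetric, pullback_apply, pullback_apply, metricForm_symm]
  invertible := isInvertible_of_pos fun u hu => by
    rw [chartMetric, pullback_apply]
    exact metricForm_pos g fun h =>
      hu ((isInvertible_differential_symm hy).injective (h.trans (map_zero _).symm))

theorem extChartAt_prod_symm (t : ℝ) (p : S) :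
    ⇑(extChartAt (𝓘(ℝ, ℝ).prod (𝓡 n)) (t, p)).symm = flowChart p := by
  rw [extChartAt_prod]
  funext q
  simp only [PartialEquiv.prod_symm, PartialEquiv.prod_coe, flowChart]
  rfl

theorem chartMetric_warpedMetric
    (g : M → EuclideanSpace ℝ (Fin (n + 1)) →L[ℝ] EuclideanSpace ℝ (Fin (n + 1)) →L[ℝ] ℝ)
    (X : ℝ × S → M) (a : ℝ × S → ℝ) (t : ℝ) (p : S) :
    chartMetric (𝓘(ℝ, ℝ).prod (𝓡 n)) (warpedMetric g X a) (t, p) =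
      pullback 𝓘(ℝ, ℝ × 𝔼) (𝓘(ℝ, ℝ).prod (𝓡 n)) (warpedMetric g X a) (flowChart p) := by
  rw [chartMetric, extChartAt_prod_symm]

theorem differential_flowChart_time {x : S} {q : ℝ × EuclideanSpace ℝ (Fin n)}
    (hq : q.2 ∈ (extChartAt (𝓡 n) x).target) :
    differential 𝓘(ℝ, ℝ × 𝔼) (𝓘(ℝ, ℝ).prod (𝓡 n)) (flowChart x) q (1, 0) = (1, 0) := by
  rw [differential_flowChart hq]
  exact Prod.ext rfl (map_zero (differential 𝓘(ℝ, 𝔼) (𝓡 n) (extChartAt (𝓡 n) x).symm q.2))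

theorem flowChart_extChartAt (t : ℝ) (p : S) :
    flowChart p (t, extChartAt (𝓡 n) p p) = (t, p) := by
  simp [flowChart]

namespace IsNormalFlow

theorem isMetricAt_warpedForm (hX : IsNormalFlow (metricForm gbar) J X ν f) (hJ : IsOpen J)
    {a : ℝ × S → ℝ} (ha : ContMDiffOn (𝓘(ℝ, ℝ).prod (𝓡 n)) 𝓘(ℝ, ℝ) ∞ a (J ×ˢ Set.univ))
    (ha0 : ∀ t ∈ J, ∀ p : S, 0 < a (t, p)) {x : S}
    {q : ℝ × EuclideanSpace ℝ (Fin n)} (hq1 : q.1 ∈ J) (hq2 : q.2 ∈ (extChartAt (𝓡 n) x).target) :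
    IsMetricAt (warpedForm (a ∘ flowChart x) (flowMetric (metricForm gbar) X x)) q :=
  (hX.isMetricFamilyAt hJ hq1 hq2).warpedForm
    ((contDiffAt_comp_flowChart hJ ha hq1 hq2).of_le ENat.LEInfty.out) (ha0 _ hq1 _).ne'

/-- The metric condition has to be checked in the preferred chart at the image point. The chart of a
product is a product of charts, so this is again a `flowChart`, where the metric is an explicit
warped form. -/
theorem isParametrizationAt_warpedMetric (hX : IsNormalFlow (metricForm gbar) J X ν f)
    (hJ : IsOpen J) {a : ℝ × S → ℝ}
    (ha : ContMDiffOn (𝓘(ℝ, ℝ).prod (𝓡 n)) 𝓘(ℝ, ℝ) ∞ a (J ×ˢ Set.univ))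
    (ha0 : ∀ t ∈ J, ∀ p : S, 0 < a (t, p)) {x : S}
    {q : ℝ × EuclideanSpace ℝ (Fin n)} (hq1 : q.1 ∈ J) (hq2 : q.2 ∈ (extChartAt (𝓡 n) x).target) :
    IsParametrizationAt (𝓘(ℝ, ℝ).prod (𝓡 n)) (warpedMetric (metricForm gbar) X a) (flowChart x)
      q where
  eventually_contMDiffAt := by
    filter_upwards [eventually_mem_flowDomain hJ hq1 hq2] with r hr
    exact contMDiffAt_flowChart hr.2
  isInvertible := isInvertible_differential_flowChart hq2
  isMetricAt := by
    have h1 : extChartAt (𝓘(ℝ, ℝ).prod (𝓡 n)) (flowChart x q) (flowChart x q) =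
        (q.1, extChartAt (𝓡 n) (flowChart x q).2 (flowChart x q).2) := by
      rw [extChartAt_prod]
      rfl
    have h2 : (flowChart x q) = (q.1, (flowChart x q).2) := rfl
    rw [h1, h2, chartMetric_warpedMetric]
    refine (hX.isMetricAt_warpedForm hJ ha ha0 (x := (flowChart x q).2)
      (q := (q.1, extChartAt (𝓡 n) (flowChart x q).2 (flowChart x q).2)) hq1
      (mem_extChartAt_target _)).congr ?_
    filter_upwards [eventually_mem_flowDomain hJ (x := (flowChart x q).2)
      (q := (q.1, extChartAt (𝓡 n) (flowChart x q).2 (flowChart x q).2)) hq1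
      (mem_extChartAt_target _)] with r hr
    exact pullback_warpedMetric _ _ _ hr.2

theorem isParametrizationAt (hX : IsNormalFlow (metricForm gbar) J X ν f)
    (hJ : IsOpen J) {x : S} {q : ℝ × EuclideanSpace ℝ (Fin n)} (hq1 : q.1 ∈ J)
    (hq2 : q.2 ∈ (extChartAt (𝓡 n) x).target) :
    IsParametrizationAt (𝓡 (n + 1)) (metricForm gbar) (X ∘ flowChart x) q where
  eventually_contMDiffAt := by
    filter_upwards [eventually_mem_flowDomain hJ hq1 hq2] with r hr
    exact hX.contMDiffAt_chart hJ hr.1 hr.2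
  isInvertible := by
    -- The pulled-back form is nondegenerate, so the differential has no kernel; equality of
    -- dimensions makes it invertible. Global injectivity of the flow map is not needed.
    have hinj : Function.Injective
        (differential 𝓘(ℝ, ℝ × 𝔼) (𝓡 (n + 1)) (X ∘ flowChart x) q) := by
      rw [injective_iff_map_eq_zero]
      intro u hu
      refine form_ext (hX.isMetricAt_warpedForm hJ hX.speed_smooth hX.speed_pos hq1
        hq2).invertible fun w => ?_
      rw [← hX.pullback_chart hJ hq1 hq2, pullback_apply, pullback_apply, hu, map_zero, map_zero,
        map_zero]
    have hdim : Module.finrank ℝ (ℝ × 𝔼) = Module.finrank ℝ 𝔽 := by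
      simp [add_comm]
    let e := LinearEquiv.ofInjectiveOfFinrankEq
      (differential 𝓘(ℝ, ℝ × 𝔼) (𝓡 (n + 1)) (X ∘ flowChart x) q : (ℝ × 𝔼) →ₗ[ℝ] 𝔽) hinj hdim
    exact ⟨e.toContinuousLinearEquiv, by ext <;> rfl⟩
  isMetricAt := isMetricAt_metricForm gbar (mem_extChartAt_target _)

theorem isRiemannianMetric (hX : IsNormalFlow (metricForm gbar) J X ν f) (hJ : IsOpen J) {t : ℝ}
    (ht : t ∈ J) : IsRiemannianMetric (inducedMetric (metricForm gbar) X t) where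
  isMetricAt := fun _ y hy => (hX.isMetricFamilyAt hJ (q := (t, y)) ht hy).slice
  volumeDensity_pos := fun x y hy => volumeDensity_pos (flowMetric_symm gbar X x (t, y))
    fun _ hu => hX.flowMetric_pos (q := (t, y)) ht hy hu

/-- Together with `isSliceAt_warpedMetric` this treats `H̄` and `H_η` by one formula: the same
family `γ`, with lapse `f` in one case and `η` in the other. -/
theorem isSliceAt (hX : IsNormalFlow (metricForm gbar) J X ν f) (hJ : IsOpen J) {t : ℝ}
    (ht : t ∈ J) (p : S) :
    IsSliceAt (𝓡 n) (𝓡 (n + 1)) (metricForm gbar) (fun p' => X (t, p')) p (normalVector ν (t, p))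
      (X ∘ flowChart p) (f ∘ flowChart p) (flowMetric (metricForm gbar) X p) t where
  isParametrizationAt := hX.isParametrizationAt hJ ht (mem_extChartAt_target p)
  pullback_eq := by
    filter_upwards [eventually_mem_flowDomain hJ (x := p) (q := (t, extChartAt (𝓡 n) p p)) ht
      (mem_extChartAt_target p)] with r hr
    exact hX.pullback_chart hJ hr.1 hr.2
  isMetricFamilyAt := hX.isMetricFamilyAt hJ ht (mem_extChartAt_target p)
  contDiffAt := (contDiffAt_comp_flowChart hJ hX.speed_smooth ht
    (mem_extChartAt_target p)).of_le ENat.LEInfty.out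
  ne_zero := (hX.speed_pos t ht _).ne'
  slice := fun _ => rfl
  normal := by
    have hp := mem_extChartAt_target (I := 𝓡 n) p
    have h1 := hX.differential_apply hJ ht p (1, 0)
    rw [differential_comp ((hX.contMDiffAt hJ (q := flowChart p (t, extChartAt (𝓡 n) p p))
      ht).mdifferentiableAt (by simp)) ((contMDiffAt_flowChart hp).mdifferentiableAt (by simp)),
      ContinuousLinearMap.comp_apply, differential_flowChart_time hp, Function.comp_apply,
      flowChart_extChartAt]
    simpa using h1
  induced := (chartMetric_self (inducedMetric (metricForm gbar) X t) p).symm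

theorem isSliceAt_warpedMetric (hX : IsNormalFlow (metricForm gbar) J X ν f) (hJ : IsOpen J)
    {a : ℝ × S → ℝ} (ha : ContMDiffOn (𝓘(ℝ, ℝ).prod (𝓡 n)) 𝓘(ℝ, ℝ) ∞ a (J ×ˢ Set.univ))
    (ha0 : ∀ t ∈ J, ∀ p : S, 0 < a (t, p)) {t : ℝ} (ht : t ∈ J) (p : S) :
    IsSliceAt (𝓡 n) (𝓘(ℝ, ℝ).prod (𝓡 n)) (warpedMetric (metricForm gbar) X a) (fun p' => (t, p'))
      p ((a (t, p))⁻¹, 0) (flowChart p) (a ∘ flowChart p) (flowMetric (metricForm gbar) X p)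
      t where
  isParametrizationAt := hX.isParametrizationAt_warpedMetric hJ ha ha0 ht (mem_extChartAt_target p)
  pullback_eq := by
    filter_upwards [eventually_mem_flowDomain hJ (x := p) (q := (t, extChartAt (𝓡 n) p p)) ht
      (mem_extChartAt_target p)] with r hr
    exact pullback_warpedMetric _ _ _ hr.2
  isMetricFamilyAt := hX.isMetricFamilyAt hJ ht (mem_extChartAt_target p)
  contDiffAt := (contDiffAt_comp_flowChart hJ ha ht (mem_extChartAt_target p)).of_le
    ENat.LEInfty.out
  ne_zero := (ha0 t ht _).ne'
  slice := fun _ => rfl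
  normal := by
    rw [differential_flowChart_time (mem_extChartAt_target p), Function.comp_apply,
      flowChart_extChartAt]
    simp [Prod.smul_mk, mul_inv_cancel₀ (ha0 t ht p).ne']
  induced := by
    have h1 : differential (𝓡 n) (𝓘(ℝ, ℝ).prod (𝓡 n)) (fun p' : S => (t, p')) p =
        ContinuousLinearMap.inr ℝ ℝ 𝔼 := mfderiv_prod_right
    refine Eq.trans ?_ (chartMetric_self (inducedMetric (metricForm gbar) X t) p).symm
    refine ContinuousLinearMap.ext fun u => ContinuousLinearMap.ext fun v => ?_
    rw [pullback_apply, h1]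
    simp [warpedMetric]

variable {t : ℝ} {x : S} {z : EuclideanSpace ℝ (Fin n)}

/-- Mean curvatures are computed in the preferred chart at the point, the integral in the chart at
`x`. The change of chart is independent of time, so the trace is unaffected. -/
theorem timeTrace_chart (hX : IsNormalFlow (metricForm gbar) J X ν f) (hJ : IsOpen J)
    (ht : t ∈ J) (hz : z ∈ (extChartAt (𝓡 n) x).target) :
    timeTrace (flowMetric (metricForm gbar) X x) (t, z) =
      timeTrace (flowMetric (metricForm gbar) X ((extChartAt (𝓡 n) x).symm z)) (t, extChartAt (𝓡 n)
        ((extChartAt (𝓡 n) x).symm z) ((extChartAt (𝓡 n) x).symm z)) :=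
  timeTrace_of_bilinearComp (hX.isMetricFamilyAt hJ (q := (t, z)) ht hz)
    (hX.isMetricFamilyAt hJ ht (mem_extChartAt_target _)) (isInvertible_differential_symm hz)
    (Filter.Eventually.of_forall fun s => flowMetric_eq_bilinearComp _ X hz s)

theorem timeSqTrace_chart (hX : IsNormalFlow (metricForm gbar) J X ν f) (hJ : IsOpen J)
    (ht : t ∈ J) (hz : z ∈ (extChartAt (𝓡 n) x).target) :
    timeSqTrace (flowMetric (metricForm gbar) X x) (t, z) =
      timeSqTrace (flowMetric (metricForm gbar) X ((extChartAt (𝓡 n) x).symm z)) (t, extChartAt (𝓡 n)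
        ((extChartAt (𝓡 n) x).symm z) ((extChartAt (𝓡 n) x).symm z)) :=
  timeSqTrace_of_bilinearComp (hX.isMetricFamilyAt hJ (q := (t, z)) ht hz)
    (hX.isMetricFamilyAt hJ ht (mem_extChartAt_target _)) (isInvertible_differential_symm hz)
    (Filter.Eventually.of_forall fun s => flowMetric_eq_bilinearComp _ X hz s)

theorem meanCurvatureBar_chart (hX : IsNormalFlow (metricForm gbar) J X ν f) (hJ : IsOpen J)
    (ht : t ∈ J) (hz : z ∈ (extChartAt (𝓡 n) x).target) :
    meanCurvatureBar (metricForm gbar) X ν (flowChart x (t, z)) =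
      (f (flowChart x (t, z)))⁻¹ * timeTrace (flowMetric (metricForm gbar) X x) (t, z) := by
  rw [hX.timeTrace_chart hJ ht hz]
  have h := (hX.isSliceAt hJ ht ((extChartAt (𝓡 n) x).symm z)).meanCurvature_eq
  rw [Function.comp_apply, flowChart_extChartAt] at h
  exact h

theorem meanCurvatureEta_chart (hX : IsNormalFlow (metricForm gbar) J X ν f) (hJ : IsOpen J)
    {a : ℝ × S → ℝ} (ha : ContMDiffOn (𝓘(ℝ, ℝ).prod (𝓡 n)) 𝓘(ℝ, ℝ) ∞ a (J ×ˢ Set.univ))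
    (ha0 : ∀ t ∈ J, ∀ p : S, 0 < a (t, p))
    (ht : t ∈ J) (hz : z ∈ (extChartAt (𝓡 n) x).target) :
    meanCurvatureEta (metricForm gbar) X a (flowChart x (t, z)) =
      (a (flowChart x (t, z)))⁻¹ * timeTrace (flowMetric (metricForm gbar) X x) (t, z) := by
  rw [hX.timeTrace_chart hJ ht hz]
  have h := (hX.isSliceAt_warpedMetric hJ ha ha0 ht ((extChartAt (𝓡 n) x).symm z)).meanCurvature_eq
  rw [Function.comp_apply, flowChart_extChartAt] at h
  exact h

theorem sigmaBar_one (hX : IsNormalFlow (metricForm gbar) J X ν f) (hJ : IsOpen J)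
    (ht : t ∈ J) (p : S) :
    sigmaBar 1 (metricForm gbar) X ν (t, p) = meanCurvatureBar (metricForm gbar) X ν (t, p) := by
  have h := hX.isSliceAt hJ ht p
  have h1 := (h.sigma_eq fun _ hu => hX.flowMetric_pos ht (mem_extChartAt_target p) hu).1
  exact h1.trans h.meanCurvature_eq.symm

theorem sigmaBar_two_chart (hX : IsNormalFlow (metricForm gbar) J X ν f) (hJ : IsOpen J)
    (ht : t ∈ J) (hz : z ∈ (extChartAt (𝓡 n) x).target) :
    sigmaBar 2 (metricForm gbar) X ν (flowChart x (t, z)) =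
      (f (flowChart x (t, z)))⁻¹ ^ 2 *
        (timeTrace (flowMetric (metricForm gbar) X x) (t, z) ^ 2 -
          timeSqTrace (flowMetric (metricForm gbar) X x) (t, z)) / 2 := by
  rw [hX.timeTrace_chart hJ ht hz, hX.timeSqTrace_chart hJ ht hz]
  have h := ((hX.isSliceAt hJ ht ((extChartAt (𝓡 n) x).symm z)).sigma_eq fun _ hu =>
    hX.flowMetric_pos ht (mem_extChartAt_target _) hu).2
  rw [Function.comp_apply, flowChart_extChartAt] at h
  exact h

/-- The chain rule together with `∂_t X = f ν`. -/
theorem normalDerivative_chart (hX : IsNormalFlow (metricForm gbar) J X ν f) (hJ : IsOpen J)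
    {N : M → ℝ} (hN : ContMDiff (𝓡 (n + 1)) 𝓘(ℝ, ℝ) ∞ N)
    (ht : t ∈ J) (hz : z ∈ (extChartAt (𝓡 n) x).target) :
    normalDerivative N X ν (flowChart x (t, z)) =
      (f (flowChart x (t, z)))⁻¹ * fderiv ℝ (N ∘ X ∘ flowChart x) (t, z) (1, 0) := by
  have h1 : normalDerivative N X ν (flowChart x (t, z)) =
    differential (𝓡 (n + 1)) 𝓘(ℝ, ℝ) N (X (flowChart x (t, z)))
      (normalVector ν (flowChart x (t, z))) := rfl
  have hf : f (flowChart x (t, z)) ≠ 0 := (hX.speed_pos t ht _).ne'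
  have hXd : MDifferentiableAt (𝓘(ℝ, ℝ).prod (𝓡 n)) (𝓡 (n + 1)) X (flowChart x (t, z)) :=
    (hX.contMDiffAt hJ (q := flowChart x (t, z)) ht).mdifferentiableAt (by simp)
  have hφd : MDifferentiableAt 𝓘(ℝ, ℝ × 𝔼) (𝓘(ℝ, ℝ).prod (𝓡 n)) (flowChart x) (t, z) :=
    (contMDiffAt_flowChart hz).mdifferentiableAt (by simp)
  have h2 : differential (𝓘(ℝ, ℝ).prod (𝓡 n)) (𝓡 (n + 1)) X (flowChart x (t, z)) (1, 0) =
      f (flowChart x (t, z)) • normalVector ν (flowChart x (t, z)) := by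
    have := hX.differential_apply hJ ht ((extChartAt (𝓡 n) x).symm z) (1, 0)
    simpa [flowChart] using this
  rw [h1, ← differential_eq_fderiv, differential_comp (I' := 𝓡 (n + 1))
    (hN.contMDiffAt.mdifferentiableAt (by simp)) (hXd.comp _ hφd), differential_comp hXd hφd,
    ContinuousLinearMap.comp_apply, ContinuousLinearMap.comp_apply, differential_flowChart_time hz,
    Function.comp_apply, h2, map_smul, smul_eq_mul, inv_mul_cancel_left₀ hf]

theorem scalarCurvature_chart (hX : IsNormalFlow (metricForm gbar) J X ν f) (hJ : IsOpen J)
    (ht : t ∈ J) (hz : z ∈ (extChartAt (𝓡 n) x).target) :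
    metricTrace (warpedForm (f ∘ flowChart x) (flowMetric (metricForm gbar) X x) (t, z))
      (ricciCoord (warpedForm (f ∘ flowChart x) (flowMetric (metricForm gbar) X x)) (t, z)) =
      scalarCurvature (𝓡 (n + 1)) (metricForm gbar) (X (flowChart x (t, z))) := by
  have h := (hX.isParametrizationAt hJ (q := (t, z)) ht hz).scalarCurvature_eq
  rwa [hX.pullback_chart hJ ht hz, ricciCoord_congr (G' := warpedForm (f ∘ flowChart x)
    (flowMetric (metricForm gbar) X x))] at h
  filter_upwards [eventually_mem_flowDomain hJ (q := (t, z)) ht hz] with r hr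
  exact hX.pullback_chart hJ hr.1 hr.2

theorem scalarCurvature_warpedMetric_chart (hX : IsNormalFlow (metricForm gbar) J X ν f)
    (hJ : IsOpen J)
    {a : ℝ × S → ℝ} (ha : ContMDiffOn (𝓘(ℝ, ℝ).prod (𝓡 n)) 𝓘(ℝ, ℝ) ∞ a (J ×ˢ Set.univ))
    (ha0 : ∀ t ∈ J, ∀ p : S, 0 < a (t, p))
    (ht : t ∈ J) (hz : z ∈ (extChartAt (𝓡 n) x).target) :
    metricTrace (warpedForm (a ∘ flowChart x) (flowMetric (metricForm gbar) X x) (t, z))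
      (ricciCoord (warpedForm (a ∘ flowChart x) (flowMetric (metricForm gbar) X x)) (t, z)) =
      scalarCurvature (𝓘(ℝ, ℝ).prod (𝓡 n)) (warpedMetric (metricForm gbar) X a)
        (flowChart x (t, z)) := by
  have h := (hX.isParametrizationAt_warpedMetric hJ ha ha0 (q := (t, z)) ht hz).scalarCurvature_eq
  rwa [pullback_warpedMetric _ _ _ hz, ricciCoord_congr (G' := warpedForm (a ∘ flowChart x)
    (flowMetric (metricForm gbar) X x))] at h
  filter_upwards [eventually_mem_flowDomain hJ (q := (t, z)) ht hz] with r hr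
  exact pullback_warpedMetric _ _ _ hr.2

theorem static_chart (hX : IsNormalFlow (metricForm gbar) J X ν f) (hJ : IsOpen J) {N : M → ℝ}
    (hN : IsStaticPotential (𝓡 (n + 1)) (metricForm gbar) N)
    (ht : t ∈ J) (hz : z ∈ (extChartAt (𝓡 n) x).target) :
    metricTrace (warpedForm (f ∘ flowChart x) (flowMetric (metricForm gbar) X x) (t, z))
        (hessianCoord (warpedForm (f ∘ flowChart x) (flowMetric (metricForm gbar) X x))
          (N ∘ X ∘ flowChart x) (t, z)) •
      warpedForm (f ∘ flowChart x) (flowMetric (metricForm gbar) X x) (t, z) -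
      hessianCoord (warpedForm (f ∘ flowChart x) (flowMetric (metricForm gbar) X x))
          (N ∘ X ∘ flowChart x) (t, z) +
        (N ∘ X ∘ flowChart x) (t, z) •
          ricciCoord (warpedForm (f ∘ flowChart x) (flowMetric (metricForm gbar) X x)) (t, z) =
      0 := by
  have h := (hX.isParametrizationAt hJ (q := (t, z)) ht hz).static_pullback hN
  have h1 : pullback 𝓘(ℝ, ℝ × 𝔼) (𝓡 (n + 1)) (metricForm gbar) (X ∘ flowChart x) =ᶠ[𝓝 (t, z)]
      warpedForm (f ∘ flowChart x) (flowMetric (metricForm gbar) X x) := by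
    filter_upwards [eventually_mem_flowDomain hJ (q := (t, z)) ht hz] with r hr
    exact hX.pullback_chart hJ hr.1 hr.2
  rwa [h1.self_of_nhds, ricciCoord_congr h1, hessianCoord_congr h1 Filter.EventuallyEq.rfl] at h

end IsNormalFlow

end NormalFlowCurvature

/-! ### Differentiation of the weighted integral -/

section Derivative

open MeasureTheory IsRiemannianMetric

section Coordinates

variable {n : ℕ} {γ : ℝ × EuclideanSpace ℝ (Fin n) →
    EuclideanSpace ℝ (Fin n) →L[ℝ] EuclideanSpace ℝ (Fin n) →L[ℝ] ℝ}
  {f η N : ℝ × EuclideanSpace ℝ (Fin n) → ℝ}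

/-- The integrand `N (H̄ - H_η) √det γ` in coordinates. -/
def massDensity (γ : ℝ × EuclideanSpace ℝ (Fin n) →
      EuclideanSpace ℝ (Fin n) →L[ℝ] EuclideanSpace ℝ (Fin n) →L[ℝ] ℝ)
    (f η N : ℝ × EuclideanSpace ℝ (Fin n) → ℝ) (q : ℝ × EuclideanSpace ℝ (Fin n)) : ℝ :=
  N q * ((f q)⁻¹ - (η q)⁻¹) * timeTrace γ q * volumeDensity (γ q)

theorem contDiffAt_massDensity {q : ℝ × EuclideanSpace ℝ (Fin n)} (h : IsMetricFamilyAt γ q)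
    (h0 : 0 < volumeDensity (γ q))
    (hf : ContDiffAt ℝ 2 f q) (hf0 : f q ≠ 0) (hη : ContDiffAt ℝ 2 η q) (hη0 : η q ≠ 0)
    (hN : ContDiffAt ℝ 2 N q) : ContDiffAt ℝ 1 (massDensity γ f η N) q := by
  have h12 : (1 : WithTop ℕ∞) ≤ 2 := by norm_num
  exact (((hN.of_le h12).mul (((hf.of_le h12).inv hf0).sub ((hη.of_le h12).inv hη0))).mul
    h.contDiffAt_timeTrace).mul (contDiffAt_volumeDensity (h.contDiffAt.of_le h12) h0)

theorem fderiv_massDensity {t : ℝ} {z : EuclideanSpace ℝ (Fin n)} (h : IsMetricFamilyAt γ (t, z))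
    (h0 : 0 < volumeDensity (γ (t, z))) (hf : ContDiffAt ℝ 2 f (t, z)) (hf0 : f (t, z) ≠ 0)
    (hη : ContDiffAt ℝ 2 η (t, z)) (hη0 : η (t, z) ≠ 0) (hN : ContDiffAt ℝ 2 N (t, z))
    (hstat : metricTrace (warpedForm f γ (t, z)) (hessianCoord (warpedForm f γ) N (t, z)) •
      warpedForm f γ (t, z) - hessianCoord (warpedForm f γ) N (t, z) +
        N (t, z) • ricciCoord (warpedForm f γ) (t, z) = 0)
    (hR : metricTrace (warpedForm η γ (t, z)) (ricciCoord (warpedForm η γ) (t, z)) =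
      metricTrace (warpedForm f γ (t, z)) (ricciCoord (warpedForm f γ) (t, z))) :
    fderiv ℝ (massDensity γ f η N) (t, z) (1, 0) =
      (-((η (t, z))⁻¹ * (η (t, z) - f (t, z)) ^ 2 * ((f (t, z))⁻¹ * timeTrace γ (t, z)) *
        ((f (t, z))⁻¹ * fderiv ℝ N (t, z) (1, 0))) -
      N (t, z) * ((f (t, z))⁻¹ ^ 2 * (timeTrace γ (t, z) ^ 2 - timeSqTrace γ (t, z)) / 2) *
        (η (t, z))⁻¹ * (η (t, z) - f (t, z)) ^ 2 +
      (N (t, z) * (sliceLaplacian γ η (t, z) - sliceLaplacian γ f (t, z)) -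
        (η (t, z) - f (t, z)) * sliceLaplacian γ N (t, z))) * volumeDensity (γ (t, z)) := by
  have d2 : ∀ {a : ℝ × EuclideanSpace ℝ (Fin n) → ℝ}, ContDiffAt ℝ 2 a (t, z) →
      DifferentiableAt ℝ a (t, z) := fun ha => ha.differentiableAt (by simp)
  have hvol := contDiffAt_volumeDensity h.contDiffAt h0
  have key := (((hasDerivAt_time (d2 hN)).mul (((hasDerivAt_time (d2 hf)).inv hf0).sub
    ((hasDerivAt_time (d2 hη)).inv hη0))).mul (hasDerivAt_time h.differentiableAt_timeTrace)).mul
      (hasDerivAt_time (A := fun r => volumeDensity (γ r)) (d2 hvol))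
  have h1 := (hasDerivAt_time ((contDiffAt_massDensity h h0 hf hf0 hη hη0 hN).differentiableAt
    (by simp))).unique key
  -- The factor `2` compensates the `½` of Jacobi's formula, so the density has logarithmic
  -- derivative `tr L`.
  have h2 : metricTrace (γ (t, z)) (fderiv ℝ γ (t, z) (1, 0)) = 2 * timeTrace γ (t, z) := by
    have : timeTrace γ (t, z) = 1 / 2 * metricTrace (γ (t, z)) (fderiv ℝ γ (t, z) (1, 0)) := by
      rw [timeTrace, timeShape, metricTrace, ContinuousLinearMap.toLinearMap_smul, map_smul,
        smul_eq_mul]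
    rw [this]
    ring
  rw [h1, fderiv_volumeDensity h.differentiableAt h.invertible h0, h2]
  simp only [Pi.mul_apply, Pi.sub_apply, Pi.inv_apply]
  linear_combination volumeDensity (γ (t, z)) *
    evolution_identity h hf hf0 hη hη0 hN hstat hR

end Coordinates

variable {n : ℕ}
  {M : Type*} [TopologicalSpace M] [ChartedSpace (EuclideanSpace ℝ (Fin (n + 1))) M]
  [IsManifold (𝓡 (n + 1)) ∞ M]
  {S : Type*} [TopologicalSpace S] [ChartedSpace (EuclideanSpace ℝ (Fin n)) S]
  [IsManifold (𝓡 n) ∞ S]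
  {gbar : Bundle.ContMDiffRiemannianMetric (𝓡 (n + 1)) ∞ (EuclideanSpace ℝ (Fin (n + 1)))
      (fun x : M => TangentSpace (𝓡 (n + 1)) x)}
  {J : Set ℝ} {X : ℝ × S → M} {ν : ∀ q : ℝ × S, TangentSpace (𝓡 (n + 1)) (X q)} {f : ℝ × S → ℝ}
  {N : M → ℝ} {η : ℝ × S → ℝ} {t : ℝ}

/-- For functions defined pointwise through varying charts, continuity follows from one formula
valid on each chart domain. -/
theorem continuous_of_chart {φ : S → ℝ} {G : S → EuclideanSpace ℝ (Fin n) → ℝ}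
    (hG : ∀ x, ∀ z ∈ (extChartAt (𝓡 n) x).target, ContinuousAt (G x) z)
    (h : ∀ x, ∀ z ∈ (extChartAt (𝓡 n) x).target, φ ((extChartAt (𝓡 n) x).symm z) = G x z) :
    Continuous φ := by
  rw [continuous_iff_continuousAt]
  intro p
  have h1 := ContinuousAt.comp (f := extChartAt (𝓡 n) p) (hG p _ (mem_extChartAt_target p))
    (continuousAt_extChartAt p)
  refine h1.congr ?_
  filter_upwards [(isOpen_extChartAt_source (I := 𝓡 n) p).mem_nhds (mem_extChartAt_source p)]
    with z hz
  rw [Function.comp_apply, ← h p _ ((extChartAt (𝓡 n) p).map_source hz),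
    (extChartAt (𝓡 n) p).left_inv hz]

namespace IsNormalFlow

theorem contMDiffOn_potential (hX : IsNormalFlow (metricForm gbar) J X ν f)
    (hN : ContMDiff (𝓡 (n + 1)) 𝓘(ℝ, ℝ) ∞ N) :
    ContMDiffOn (𝓘(ℝ, ℝ).prod (𝓡 n)) 𝓘(ℝ, ℝ) ∞ (N ∘ X) (J ×ˢ Set.univ) :=
  hN.comp_contMDiffOn hX.smooth

theorem continuousAt_slice {F : Type*} [TopologicalSpace F] {A : ℝ × EuclideanSpace ℝ (Fin n) → F}
    {z : EuclideanSpace ℝ (Fin n)} (hA : ContinuousAt A (t, z)) :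
    ContinuousAt (fun y => A (t, y)) z :=
  ContinuousAt.comp (f := fun y => (t, y)) hA (by fun_prop)

theorem continuous_meanCurvatureBar (hX : IsNormalFlow (metricForm gbar) J X ν f) (hJ : IsOpen J)
    (ht : t ∈ J) : Continuous fun p => meanCurvatureBar (metricForm gbar) X ν (t, p) :=
  continuous_of_chart (fun x z hz => continuousAt_slice
    (A := fun q => ((f ∘ flowChart x) q)⁻¹ * timeTrace (flowMetric (metricForm gbar) X x) q)
    (((contDiffAt_comp_flowChart hJ hX.speed_smooth (q := (t, z)) ht hz).continuousAt.inv₀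
      (hX.speed_pos t ht _).ne').mul
        (hX.isMetricFamilyAt hJ (q := (t, z)) ht hz).differentiableAt_timeTrace.continuousAt))
    fun _ _ hz => hX.meanCurvatureBar_chart hJ ht hz

theorem continuous_sigmaBar_two (hX : IsNormalFlow (metricForm gbar) J X ν f) (hJ : IsOpen J)
    (ht : t ∈ J) : Continuous fun p => sigmaBar 2 (metricForm gbar) X ν (t, p) :=
  continuous_of_chart (fun x z hz => continuousAt_slice
    (A := fun q => ((f ∘ flowChart x) q)⁻¹ ^ 2 *
      (timeTrace (flowMetric (metricForm gbar) X x) q ^ 2 -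
        timeSqTrace (flowMetric (metricForm gbar) X x) q) / 2)
    (((((contDiffAt_comp_flowChart hJ hX.speed_smooth (q := (t, z)) ht hz).continuousAt.inv₀
      (hX.speed_pos t ht _).ne').pow 2).mul
        (((hX.isMetricFamilyAt hJ (q := (t, z)) ht
          hz).differentiableAt_timeTrace.continuousAt.pow 2).sub
            (hX.isMetricFamilyAt hJ (q := (t, z)) ht hz).continuousAt_timeSqTrace)).div_const 2))
    fun _ _ hz => hX.sigmaBar_two_chart hJ ht hz

theorem continuous_normalDerivative (hX : IsNormalFlow (metricForm gbar) J X ν f) (hJ : IsOpen J)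
    (hN : ContMDiff (𝓡 (n + 1)) 𝓘(ℝ, ℝ) ∞ N) (ht : t ∈ J) :
    Continuous fun p => normalDerivative N X ν (t, p) :=
  continuous_of_chart (fun x z hz => continuousAt_slice
    (A := fun q => ((f ∘ flowChart x) q)⁻¹ * fderiv ℝ (N ∘ X ∘ flowChart x) q (1, 0))
    (((contDiffAt_comp_flowChart hJ hX.speed_smooth (q := (t, z)) ht hz).continuousAt.inv₀
      (hX.speed_pos t ht _).ne').mul
        ((((contDiffAt_comp_flowChart hJ (hX.contMDiffOn_potential hN) (q := (t, z)) ht hz).of_le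
          (m := 1) ENat.LEInfty.out).fderiv_right (m := 0) (by norm_num)).continuousAt.clm_apply
            continuousAt_const)))
    fun _ _ hz => hX.normalDerivative_chart hJ hN ht hz

theorem laplacian_chart (hX : IsNormalFlow (metricForm gbar) J X ν f) (hJ : IsOpen J)
    {a : ℝ × S → ℝ} (ha : ContMDiffOn (𝓘(ℝ, ℝ).prod (𝓡 n)) 𝓘(ℝ, ℝ) ∞ a (J ×ˢ Set.univ))
    (ht : t ∈ J) {x : S} {z : EuclideanSpace ℝ (Fin n)} (hz : z ∈ (extChartAt (𝓡 n) x).target) :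
    laplacian (𝓡 n) (inducedMetric (metricForm gbar) X t) (fun p => a (t, p))
      ((extChartAt (𝓡 n) x).symm z) =
      sliceLaplacian (flowMetric (metricForm gbar) X x) (a ∘ flowChart x) (t, z) :=
  (hX.isRiemannianMetric hJ ht).laplacian_eq hz (contMDiff_slice hJ ha ht)

variable [T2Space S] [CompactSpace S]

theorem weightedIntegral_eq (hX : IsNormalFlow (metricForm gbar) J X ν f) (hJ : IsOpen J)
    (hη : ContMDiffOn (𝓘(ℝ, ℝ).prod (𝓡 n)) 𝓘(ℝ, ℝ) ∞ η (J ×ˢ Set.univ))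
    (hη_pos : ∀ t ∈ J, ∀ p : S, 0 < η (t, p)) (ht : t ∈ J) :
    weightedIntegral (metricForm gbar) N X ν η t = ∑ x ∈ partitionIndices n S,
      ∫ z in (extChartAt (𝓡 n) x).target, chartPartition n S x ((extChartAt (𝓡 n) x).symm z) *
        massDensity (flowMetric (metricForm gbar) X x) (f ∘ flowChart x) (η ∘ flowChart x)
          (N ∘ X ∘ flowChart x) (t, z) := by
  rw [weightedIntegral, surfaceIntegral_eq_sum]
  refine Finset.sum_congr rfl fun x _ => setIntegral_congr_fun
    (isOpen_extChartAt_target (I := 𝓡 n) x).measurableSet fun z hz => ?_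
  have h1 := hX.meanCurvatureBar_chart hJ ht hz
  have h2 := hX.meanCurvatureEta_chart hJ hη hη_pos ht hz
  simp only [flowChart] at h1 h2
  simp only [massDensity, Function.comp_apply, flowChart, h1, h2]
  rw [flowMetric]
  ring

/-- The evolution of `∫ N (H̄ - H_η) dσ`. -/
theorem hasDerivAt_weightedIntegral (hX : IsNormalFlow (metricForm gbar) J X ν f) (hJ : IsOpen J)
    (hN : IsStaticPotential (𝓡 (n + 1)) (metricForm gbar) N)
    (hη : ContMDiffOn (𝓘(ℝ, ℝ).prod (𝓡 n)) 𝓘(ℝ, ℝ) ∞ η (J ×ˢ Set.univ))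
    (hη_pos : ∀ t ∈ J, ∀ p : S, 0 < η (t, p)) (ht : t ∈ J)
    (hR : ∀ p : S, scalarCurvature (𝓘(ℝ, ℝ).prod (𝓡 n)) (warpedMetric (metricForm gbar) X η) (t, p) =
        scalarCurvature (𝓡 (n + 1)) (metricForm gbar) (X (t, p))) :
    HasDerivAt (weightedIntegral (metricForm gbar) N X ν η)
      (-surfaceIntegral (inducedMetric (metricForm gbar) X t) (fun p =>
          (η (t, p))⁻¹ * (η (t, p) - f (t, p)) ^ 2 * meanCurvatureBar (metricForm gbar) X ν (t, p) *
            normalDerivative N X ν (t, p)) -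
        surfaceIntegral (inducedMetric (metricForm gbar) X t) (fun p =>
          N (X (t, p)) * sigmaBar 2 (metricForm gbar) X ν (t, p) * (η (t, p))⁻¹ *
            (η (t, p) - f (t, p)) ^ 2)) t := by
  have hNX := hX.contMDiffOn_potential hN.smooth
  have hg := hX.isRiemannianMetric hJ ht
  let F : S → ℝ × EuclideanSpace ℝ (Fin n) → ℝ := fun x =>
    massDensity (flowMetric (metricForm gbar) X x) (f ∘ flowChart x) (η ∘ flowChart x)
      (N ∘ X ∘ flowChart x)
  -- The weights are constant in time, so the derivative falls on the mass density alone; their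
  -- compact supports justify differentiation under the integral sign.
  let ρ : S → EuclideanSpace ℝ (Fin n) → ℝ := fun x z =>
    chartPartition n S x ((extChartAt (𝓡 n) x).symm z)
  have c2 : ∀ {a : ℝ × S → ℝ}, ContMDiffOn (𝓘(ℝ, ℝ).prod (𝓡 n)) 𝓘(ℝ, ℝ) ∞ a (J ×ˢ Set.univ) →
      ∀ {x s z}, s ∈ J → z ∈ (extChartAt (𝓡 n) x).target →
        ContDiffAt ℝ 2 (a ∘ flowChart x) (s, z) := fun ha _ _ _ hs hz =>
    (contDiffAt_comp_flowChart hJ ha (q := (_, _)) hs hz).of_le ENat.LEInfty.out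
  have hvol : ∀ {x s z}, s ∈ J → z ∈ (extChartAt (𝓡 n) x).target →
      0 < volumeDensity (flowMetric (metricForm gbar) X x (s, z)) := fun hs hz =>
    (hX.isRiemannianMetric hJ hs).volumeDensity_pos _ _ hz
  have hF : ∀ x, ∀ s ∈ J, ∀ z ∈ (extChartAt (𝓡 n) x).target, ContDiffAt ℝ 1 (F x) (s, z) :=
    fun x s hs z hz => contDiffAt_massDensity (hX.isMetricFamilyAt hJ (q := (s, z)) hs hz)
      (hvol hs hz) (c2 hX.speed_smooth hs hz) (hX.speed_pos s hs _).ne' (c2 hη hs hz)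
      (hη_pos s hs _).ne' (c2 hNX hs hz)
  have hρ : ∀ x, ∀ z ∈ (extChartAt (𝓡 n) x).target, ContDiffAt ℝ 1 (ρ x) z := fun x z hz =>
    (contMDiffAt_iff_contDiffAt.1 ((chartPartition n S x).contMDiff.contMDiffAt.comp z
      (contMDiffAt_extChartAt_symm hz))).of_le ENat.LEInfty.out
  have hρF : ∀ x, ∀ s ∈ J, ∀ z ∈ (extChartAt (𝓡 n) x).target,
      ContDiffAt ℝ 1 (fun q : ℝ × EuclideanSpace ℝ (Fin n) => ρ x q.2 * F x q) (s, z) :=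
    fun x s hs z hz => (ContDiffAt.comp (f := Prod.snd) (s, z) (hρ x z hz)
      contDiffAt_snd).mul (hF x s hs z hz)
  have hderiv : ∀ x, HasDerivAt (fun s => ∫ z in (extChartAt (𝓡 n) x).target, ρ x z * F x (s, z))
      (∫ z in (extChartAt (𝓡 n) x).target,
        fderiv ℝ (fun q : ℝ × EuclideanSpace ℝ (Fin n) => ρ x q.2 * F x q) (t, z) (1, 0)) t := by
    intro x
    obtain ⟨hK, hKU, h0⟩ := isCompact_image_tsupport
      (tsupport_chartPartition (n := n) x)
    exact hasDerivAt_integral_of_compact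
      (F := fun q : ℝ × EuclideanSpace ℝ (Fin n) => ρ x q.2 * F x q) hJ
      (isOpen_extChartAt_target (I := 𝓡 n) x) hK hKU (hρF x)
      (fun s _ z hz hzK => by simp only [ρ, h0 z hz hzK, zero_mul]) ht
  have hsum := HasDerivAt.fun_sum fun x (_ : x ∈ partitionIndices n S) => hderiv x
  refine (hsum.congr_of_eventuallyEq ?_).congr_deriv ?_
  · filter_upwards [hJ.mem_nhds ht] with s hs
    exact hX.weightedIntegral_eq hJ hη hη_pos hs
  set A : S → ℝ := fun p => (η (t, p))⁻¹ * (η (t, p) - f (t, p)) ^ 2 *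
    meanCurvatureBar (metricForm gbar) X ν (t, p) * normalDerivative N X ν (t, p) with hA
  set B : S → ℝ := fun p => N (X (t, p)) * sigmaBar 2 (metricForm gbar) X ν (t, p) *
    (η (t, p))⁻¹ * (η (t, p) - f (t, p)) ^ 2 with hB
  set L : (S → ℝ) → S → ℝ := laplacian (𝓡 n) (inducedMetric (metricForm gbar) X t) with hL
  set φ : S → ℝ := fun p => N (X (t, p)) with hφ
  set v : S → ℝ := fun p => η (t, p) - f (t, p) with hv
  have hηs := contMDiff_slice hJ hη ht
  have hfs := contMDiff_slice hJ hX.speed_smooth ht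
  have hφs : ContMDiff (𝓡 n) 𝓘(ℝ, ℝ) ∞ φ := contMDiff_slice hJ hNX ht
  have hvs : ContMDiff (𝓡 n) 𝓘(ℝ, ℝ) ∞ v := hηs.sub hfs
  -- Additivity of the Laplacian applied to `η = (η - f) + f`.
  have hLv : ∀ p, L v p = L (fun p => η (t, p)) p - L (fun p => f (t, p)) p := by
    intro p
    have h1 := congrFun (laplacian_add
      (g := inducedMetric (metricForm gbar) X t) hvs hfs) p
    have h2 : v + (fun p => f (t, p)) = fun p => η (t, p) := by
      funext p
      simp [hv]
    rw [h2] at h1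
    rw [hL, h1, Pi.add_apply]
    ring
  have hηinv : Continuous fun p => (η (t, p))⁻¹ :=
    hηs.continuous.inv₀ fun p => (hη_pos t ht p).ne'
  have hAc : Continuous A := ((hηinv.mul (hvs.continuous.pow 2)).mul
    (hX.continuous_meanCurvatureBar hJ ht)).mul (hX.continuous_normalDerivative hJ hN.smooth ht)
  have hBc : Continuous B := ((hφs.continuous.mul (hX.continuous_sigmaBar_two hJ ht)).mul
    hηinv).mul (hvs.continuous.pow 2)
  have hCc : Continuous fun p => φ p * L v p - v p * L φ p :=
    (hφs.continuous.mul (hg.continuous_laplacian hvs)).sub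
      (hvs.continuous.mul (hg.continuous_laplacian hφs))
  -- The Green expression has integral zero. Adding it makes the integrand agree pointwise with the
  -- time derivative of the mass density, so the remaining comparison can be made chart by chart.
  have htotal : surfaceIntegral (inducedMetric (metricForm gbar) X t)
      (fun p => -A p + -B p + (φ p * L v p - v p * L φ p)) =
      -surfaceIntegral (inducedMetric (metricForm gbar) X t) A -
        surfaceIntegral (inducedMetric (metricForm gbar) X t) B := by
    rw [hg.surfaceIntegral_add (φ := fun p => -A p + -B p) (hAc.neg.add hBc.neg) hCc, hg.surfaceIntegral_green hφs hvs,
      hg.surfaceIntegral_add (φ := fun p => -A p) (ψ := fun p => -B p) hAc.neg hBc.neg, surfaceIntegral_neg,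
      surfaceIntegral_neg]
    ring
  rw [← htotal, surfaceIntegral_eq_sum]
  refine Finset.sum_congr rfl fun x _ => setIntegral_congr_fun
    (isOpen_extChartAt_target (I := 𝓡 n) x).measurableSet fun z hz => ?_
  have h1 : fderiv ℝ (fun q : ℝ × EuclideanSpace ℝ (Fin n) => ρ x q.2 * F x q) (t, z) (1, 0) =
      ρ x z * fderiv ℝ (F x) (t, z) (1, 0) :=
    (hasDerivAt_time ((hρF x t ht z hz).differentiableAt (by simp))).unique
      ((hasDerivAt_time ((hF x t ht z hz).differentiableAt (by simp))).const_mul (ρ x z))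
  have hH := hX.meanCurvatureBar_chart hJ ht hz
  have hσ := hX.sigmaBar_two_chart hJ ht hz
  have hd := hX.normalDerivative_chart hJ hN.smooth ht hz
  have hLη := hX.laplacian_chart hJ hη ht hz
  have hLf := hX.laplacian_chart hJ hX.speed_smooth ht hz
  have hLN : L φ ((extChartAt (𝓡 n) x).symm z) = _ := hX.laplacian_chart hJ hNX ht hz
  have hRx : metricTrace (warpedForm (η ∘ flowChart x) (flowMetric (metricForm gbar) X x) (t, z))
      (ricciCoord (warpedForm (η ∘ flowChart x) (flowMetric (metricForm gbar) X x)) (t, z)) =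
      metricTrace (warpedForm (f ∘ flowChart x) (flowMetric (metricForm gbar) X x) (t, z))
      (ricciCoord (warpedForm (f ∘ flowChart x) (flowMetric (metricForm gbar) X x)) (t, z)) := by
    rw [hX.scalarCurvature_warpedMetric_chart hJ hη hη_pos ht hz, hX.scalarCurvature_chart hJ ht hz]
    exact hR _
  have h2 := fderiv_massDensity (hX.isMetricFamilyAt hJ (q := (t, z)) ht hz) (hvol ht hz)
    (c2 hX.speed_smooth ht hz) (hX.speed_pos t ht _).ne' (c2 hη ht hz) (hη_pos t ht _).ne'
    (c2 hNX ht hz) (hX.static_chart hJ hN ht hz) hRx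
  simp only
  rw [h1, show fderiv ℝ (F x) (t, z) (1, 0) = _ from h2]
  simp only [flowChart] at hH hσ hd
  simp only [hA, hB, hLv, hLN]
  rw [hH, hσ, hd, show L (fun p => η (t, p)) ((extChartAt (𝓡 n) x).symm z) = _ from hLη,
    show L (fun p => f (t, p)) ((extChartAt (𝓡 n) x).symm z) = _ from hLf]
  simp only [hφ, hv, ρ, Function.comp_assoc, Function.comp_apply, flowChart]
  rw [flowMetric]
  ring

end IsNormalFlow

end Derivative

/-! ### Ingredients for the equality case -/

section Monotonicity

open IsRiemannianMetric

variable {n : ℕ}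
  {M : Type*} [TopologicalSpace M] [ChartedSpace (EuclideanSpace ℝ (Fin (n + 1))) M]
  [IsManifold (𝓡 (n + 1)) ∞ M]
  {S : Type*} [TopologicalSpace S] [T2Space S] [CompactSpace S]
  [ChartedSpace (EuclideanSpace ℝ (Fin n)) S] [IsManifold (𝓡 n) ∞ S]
  {gbar : Bundle.ContMDiffRiemannianMetric (𝓡 (n + 1)) ∞ (EuclideanSpace ℝ (Fin (n + 1)))
      (fun x : M => TangentSpace (𝓡 (n + 1)) x)}
  {J : Set ℝ} {X : ℝ × S → M} {ν : ∀ q : ℝ × S, TangentSpace (𝓡 (n + 1)) (X q)} {f : ℝ × S → ℝ}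
  {N : M → ℝ} {η : ℝ × S → ℝ}

theorem _root_.interior_nonempty_of_nontrivial {T : Set ℝ} (hT : T.OrdConnected)
    (hT' : T.Nontrivial) : (interior T).Nonempty := by
  obtain ⟨a, ha, b, hb, hab⟩ := hT'.exists_lt
  have h1 : Set.Ioo a b ⊆ interior T :=
    interior_maximal (Set.Ioo_subset_Icc_self.trans (hT.out ha hb)) isOpen_Ioo
  exact (Set.nonempty_Ioo.2 hab).mono h1

namespace IsNormalFlow

/-- With equal lapses the two mean curvatures coincide at every point of the slice. -/
theorem weightedIntegral_eq_zero (hX : IsNormalFlow (metricForm gbar) J X ν f) (hJ : IsOpen J)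
    (hη : ContMDiffOn (𝓘(ℝ, ℝ).prod (𝓡 n)) 𝓘(ℝ, ℝ) ∞ η (J ×ˢ Set.univ))
    (hη_pos : ∀ t ∈ J, ∀ p : S, 0 < η (t, p)) {t : ℝ} (ht : t ∈ J)
    (h : ∀ p, η (t, p) = f (t, p)) : weightedIntegral (metricForm gbar) N X ν η t = 0 := by
  have h1 : ∀ p, meanCurvatureBar (metricForm gbar) X ν (t, p) =
      meanCurvatureEta (metricForm gbar) X η (t, p) := by
    intro p
    have h2 := hX.meanCurvatureBar_chart hJ ht (mem_extChartAt_target (I := 𝓡 n) p)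
    have h3 := hX.meanCurvatureEta_chart hJ hη hη_pos ht (mem_extChartAt_target (I := 𝓡 n) p)
    rw [flowChart_extChartAt] at h2 h3
    rw [h2, h3, h]
  simp only [weightedIntegral, h1, sub_self, mul_zero]
  exact surfaceIntegral_zero

end IsNormalFlow

end Monotonicity

end StaticFlow

end

/-! ### The evolution formula, monotonicity and rigidity -/

theorem proposition2p2 {n : ℕ}
    {M : Type*} [TopologicalSpace M] [ChartedSpace (EuclideanSpace ℝ (Fin (n + 1))) M]
    [IsManifold (𝓡 (n + 1)) ∞ M]
    {S : Type*} [TopologicalSpace S] [T2Space S] [CompactSpace S]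
    [ChartedSpace (EuclideanSpace ℝ (Fin n)) S] [IsManifold (𝓡 n) ∞ S]
    (gbar : Bundle.ContMDiffRiemannianMetric (𝓡 (n + 1)) ∞ (EuclideanSpace ℝ (Fin (n + 1)))
      (fun x : M => TangentSpace (𝓡 (n + 1)) x))
    (g : M → EuclideanSpace ℝ (Fin (n + 1)) →L[ℝ] EuclideanSpace ℝ (Fin (n + 1)) →L[ℝ] ℝ)
    (hg : g = StaticFlow.metricForm gbar)
    (N : M → ℝ) (hN : StaticFlow.IsStaticPotential (𝓡 (n + 1)) g N)
    (J : Set ℝ) (hJ : IsOpen J) (hJ' : J.OrdConnected)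
    (X : ℝ × S → M) (ν : ∀ q : ℝ × S, TangentSpace (𝓡 (n + 1)) (X q)) (f : ℝ × S → ℝ)
    (hX : StaticFlow.IsNormalFlow g J X ν f)
    (η : ℝ × S → ℝ)
    (hη : ContMDiffOn (𝓘(ℝ, ℝ).prod (𝓡 n)) 𝓘(ℝ, ℝ) ∞ η (J ×ˢ Set.univ))
    (hη_pos : ∀ t ∈ J, ∀ p : S, 0 < η (t, p))
    (T : Set ℝ) (hTJ : T ⊆ J) (hT : T.OrdConnected) (hT' : T.Nontrivial)
    (hR : ∀ t ∈ T, ∀ p : S,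
      StaticFlow.scalarCurvature (𝓘(ℝ, ℝ).prod (𝓡 n)) (StaticFlow.warpedMetric g X η) (t, p) =
        StaticFlow.scalarCurvature (𝓡 (n + 1)) g (X (t, p))) :
    (∀ t ∈ T, HasDerivAt (StaticFlow.weightedIntegral g N X ν η)
      (-StaticFlow.surfaceIntegral (StaticFlow.inducedMetric g X t) (fun p =>
          (η (t, p))⁻¹ * (η (t, p) - f (t, p)) ^ 2 * StaticFlow.meanCurvatureBar g X ν (t, p) *
            StaticFlow.normalDerivative N X ν (t, p)) -
        StaticFlow.surfaceIntegral (StaticFlow.inducedMetric g X t) (fun p =>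
          N (X (t, p)) * StaticFlow.sigmaBar 2 g X ν (t, p) * (η (t, p))⁻¹ *
            (η (t, p) - f (t, p)) ^ 2)) t) ∧
    ((∀ t ∈ T, ∀ p : S, 0 < N (X (t, p)) ∧ 0 < StaticFlow.normalDerivative N X ν (t, p) ∧
        0 < StaticFlow.sigmaBar 1 g X ν (t, p) ∧ 0 < StaticFlow.sigmaBar 2 g X ν (t, p)) →
      AntitoneOn (StaticFlow.weightedIntegral g N X ν η) T ∧
      ((∃ c : ℝ, ∀ t ∈ T, StaticFlow.weightedIntegral g N X ν η t = c) ↔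
        ∀ t ∈ T, ∀ p : S, η (t, p) = f (t, p))) := by
  subst hg
  have hder := fun t ht => hX.hasDerivAt_weightedIntegral hJ hN hη hη_pos (hTJ ht) (hR t ht)
  refine ⟨hder, fun hpos => ?_⟩
  have hA : ∀ t ∈ T, ∀ p, 0 ≤ (η (t, p))⁻¹ * (η (t, p) - f (t, p)) ^ 2 *
      StaticFlow.meanCurvatureBar (StaticFlow.metricForm gbar) X ν (t, p) *
        StaticFlow.normalDerivative N X ν (t, p) := by
    intro t ht p
    obtain ⟨-, h2, h3, -⟩ := hpos t ht p
    rw [hX.sigmaBar_one hJ (hTJ ht)] at h3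
    have h1 := hη_pos t (hTJ ht) p
    positivity
  have hB : ∀ t ∈ T, ∀ p, 0 ≤ N (X (t, p)) *
      StaticFlow.sigmaBar 2 (StaticFlow.metricForm gbar) X ν (t, p) * (η (t, p))⁻¹ *
        (η (t, p) - f (t, p)) ^ 2 := by
    intro t ht p
    obtain ⟨h2, -, -, h3⟩ := hpos t ht p
    have h1 := hη_pos t (hTJ ht) p
    positivity
  have hiA := fun t ht => (hX.isRiemannianMetric hJ (hTJ ht)).surfaceIntegral_nonneg (hA t ht)
  have hiB := fun t ht => (hX.isRiemannianMetric hJ (hTJ ht)).surfaceIntegral_nonneg (hB t ht)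
  refine ⟨antitoneOn_of_deriv_nonpos hT.convex
    (fun t ht => (hder t ht).continuousAt.continuousWithinAt)
    (fun t ht => (hder t (interior_subset ht)).differentiableAt.differentiableWithinAt)
    fun t ht => ?_, ?_, fun h => ⟨0, fun t ht =>
      hX.weightedIntegral_eq_zero hJ hη hη_pos (hTJ ht) (h t ht)⟩⟩
  · rw [(hder t (interior_subset ht)).deriv]
    linarith [hiA t (interior_subset ht), hiB t (interior_subset ht)]
  · rintro ⟨c, hc⟩ t ht p
    -- Constancy is known on `T` only, and `t` may be an endpoint. A nontrivial interval has unique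
    -- derivatives within itself at all its points, so the two-sided derivative at `t` must be zero.
    have hu : UniqueDiffWithinAt ℝ T t :=
      uniqueDiffOn_convex hT.convex (interior_nonempty_of_nontrivial hT hT') t ht
    have h0 := hu.eq_deriv _ (hder t ht).hasDerivWithinAt
      ((hasDerivWithinAt_const t T c).congr hc (hc t ht))
    -- Two nonnegative integrals with sum zero both vanish. The `σ₂` term alone already forces `η =
    -- f`.
    have hBz : StaticFlow.surfaceIntegral (StaticFlow.inducedMetric (StaticFlow.metricForm gbar) X t)
        (fun p => N (X (t, p)) * StaticFlow.sigmaBar 2 (StaticFlow.metricForm gbar) X ν (t, p) *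
          (η (t, p))⁻¹ * (η (t, p) - f (t, p)) ^ 2) = 0 := by
      linarith [hiA t ht, hiB t ht]
    have hηs := (StaticFlow.contMDiff_slice hJ hη (hTJ ht)).continuous
    have hfs := (StaticFlow.contMDiff_slice hJ hX.speed_smooth (hTJ ht)).continuous
    have hNs := (StaticFlow.contMDiff_slice hJ (hX.contMDiffOn_potential hN.smooth)
      (hTJ ht)).continuous
    have hz := (hX.isRiemannianMetric hJ (hTJ ht)).eq_zero_of_surfaceIntegral_eq_zero
      (((hNs.mul (hX.continuous_sigmaBar_two hJ (hTJ ht))).mul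
        (hηs.inv₀ fun p => (hη_pos t (hTJ ht) p).ne')).mul ((hηs.sub hfs).pow 2))
      (hB t ht) hBz p
    obtain ⟨h2, -, -, h3⟩ := hpos t ht p
    -- The weight in front of `(η - f)²` is strictly positive since `N`, `σ₂` and `η` are.
    have h4 : N (X (t, p)) * StaticFlow.sigmaBar 2 (StaticFlow.metricForm gbar) X ν (t, p) *
        (η (t, p))⁻¹ ≠ 0 := by
      have := hη_pos t (hTJ ht) p
      positivity
    have h5 := (mul_eq_zero.1 hz).resolve_left h4
    exact sub_eq_zero.1 (pow_eq_zero_iff (two_ne_zero)|>.1 h5)
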